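/- Let $V_1=\mathbb{R}^5$ with basis $m_0,\dots,m_4$, $V_2=\mathbb{R}^3$ with basis $l_0,l_1,l_2$, and $V=\wedge^2V_1\otimes V_2$ with the natural action of $G_{\mathbb R}=\mathrm{GL}(5)_{\mathbb R}\times\mathrm{GL}(3)_{\mathbb R}$. Let $H_{\mathbb R}=\mathrm{SL}(5)_{\mathbb R}\times\mathrm{SL}(3)_{\mathbb R}\subset G_{\mathbb R}$, with its classical topology, and let $$w=(m_1\wedge m_4-3m_2\wedge m_3)\otimes l_0+(-m_0\wedge m_4+2m_1\wedge m_3)\otimes l_1+(m_0\wedge m_3-3m_1\wedge m_2)\otimes l_2 .$$ For $x=\sum_{i<j} m_i\wedge m_j\otimes x_{ij}\in V$ (with $x_{ij}\in V_2$) let $\mathrm{Pfaff}_i(x)\in\mathrm{Sym}^2V_2$ ($0\le i\le 4$) be $(-1)^i$ times the Pfaffian $x_{ab}x_{cd}-x_{ac}x_{bd}+x_{ad}x_{bc}$, where $a<b<c<d$ are the elements of $\{0,\dots,4\}\setminus\{i\}$. Regard $\mathrm{Sym}^2V_2$ as the space of symmetric $3\times3$ matrices, $uv$ being $\frac12(u\,{}^tv+v\,{}^tu)$,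 and put $\phi_1(x)(a)=\sum_i a_i\,\mathrm{Pfaff}_i(x)$ for $a=\sum_i a_im_i\in V_1$. Let $\Phi_1(x)$ be the symmetric $3\times 3$ matrix whose $(s,t)$-entry is the coefficient of $l_0^2\wedge l_1^2\wedge l_2^2\wedge l_0l_1\wedge l_1l_2\wedge l_0l_2$ in $3^{-4}\,(l_sl_t)\wedge \mathrm{Pfaff}_0(x)\wedge\cdots\wedge\mathrm{Pfaff}_4(x)\in\wedge^6\,\mathrm{Sym}^2V_2$. Let $\Phi_2(x)$ be the quadratic form $a\mapsto\mathrm{tr}\big((\phi_1(x)(a)\,\Phi_1(x))^2\big)$ on $V_1$. Let $H_{x\mathbb R}$ be the stabilizer of $x$ in $H_{\mathbb R}$, let $H_{x1\mathbb R}\subset\mathrm{SL}(5)_{\mathbb R}$ and $H_{x2\mathbb R}\subset\mathrm{SL}(3)_{\mathbb R}$ be its projections to the two factors, and let $H_{x3\mathbb R}=\mathrm{SO}(\Phi_2(x))_{\mathbb R}=\{g\in\mathrm{SL}(5)_{\mathbb R}\mid \Phi_2(x)(ga)=\Phi_2(x)(a)\ \text{for all } a\in V_1\}$. For a closed subgroup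 $K$ write $K^0$ for its connected component of $1$ in the classical topology. **Proposition.** Let $x\in G_{\mathbb R}w$. (1) Every closed connected subgroup $F$ with $H_{x\mathbb R}^0\subset F\subset H_{\mathbb R}$ is one of the seven groups $$H_{x\mathbb R}^0,\quad H_{x1\mathbb R}^0\times H_{x2\mathbb R}^0,\quad H_{x1\mathbb R}^0\times\mathrm{SL}(3)_{\mathbb R},\quad H_{x3\mathbb R}^0\times H_{x2\mathbb R}^0,\quad H_{x3\mathbb R}^0\times\mathrm{SL}(3)_{\mathbb R},\quad \mathrm{SL}(5)_{\mathbb R}\times H_{x2\mathbb R}^0,\quad \mathrm{SL}(5)_{\mathbb R}\times\mathrm{SL}(3)_{\mathbb R}.$$ (2) Every closed connected subgroup $F$ with $H_{x\mathbb R}\subset F\subset H_{\mathbb R}$ is one of the seven groups $$H_{x\mathbb R},\quad H_{x1\mathbb R}\times H_{x2\mathbb R},\quad H_{x1\mathbb R}\times\mathrm{SL}(3)_{\mathbb R},\quad H_{x3\mathbb R}\times H_{x2\mathbb R},\quad H_{x3\mathbb R}\times\mathrm{SL}(3)_{\mathbb R},\quad \mathrm{SL}(5)_{\mathbb R}\times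 H_{x2\mathbb R},\quad \mathrm{SL}(5)_{\mathbb R}\times\mathrm{SL}(3)_{\mathbb R}.$$ -/

import Mathlib

open Matrix

/-- `V = ∧² V₁ ⊗ V₂` with `V₁ = ℝ⁵` (basis `m₀, …, m₄`) and `V₂ = ℝ³` (basis `l₀, l₁, l₂`).
An element `x₀ ⊗ l₀ + x₁ ⊗ l₁ + x₂ ⊗ l₂` is the triple of `xₖ ∈ ∧² V₁`, and `∧² V₁` is the space of
alternating `5 × 5` matrices, `mᵢ ∧ mⱼ` being the matrix `Eᵢⱼ - Eⱼᵢ`. -/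
def altTensor : Submodule ℝ (Fin 3 → Matrix (Fin 5) (Fin 5) ℝ) where
  carrier := {x | ∀ k, (x k)ᵀ = -x k}
  add_mem' := by
    intro a b ha hb k
    simp only [Pi.add_apply, transpose_add, ha k, hb k, neg_add]
  zero_mem' := by
    intro k
    simp
  smul_mem' := by
    intro c a ha k
    simp only [Pi.smul_apply, transpose_smul, ha k, smul_neg]

/-- `G_ℝ = GL(5)_ℝ × GL(3)_ℝ`. -/
abbrev GReal : Type := GL (Fin 5) ℝ × GL (Fin 3) ℝ

/-- `H_ℝ = SL(5)_ℝ × SL(3)_ℝ`, with the classical topology. -/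
abbrev HReal : Type := SpecialLinearGroup (Fin 5) ℝ × SpecialLinearGroup (Fin 3) ℝ

/-- The natural action of `G_ℝ` on `∧² V₁ ⊗ V₂`: the element `g₁` sends `A ∈ ∧² V₁` to `g₁ A g₁ᵀ`,
and `g₂` sends `lⱼ` to `∑ₖ (g₂)ₖⱼ lₖ`. -/
instance altTensorAction : MulAction GReal altTensor where
  smul g x := ⟨fun k => ∑ j, (g.2 : Matrix (Fin 3) (Fin 3) ℝ) k j •
      ((g.1 : Matrix (Fin 5) (Fin 5) ℝ) * x.1 j * (g.1 : Matrix (Fin 5) (Fin 5) ℝ)ᵀ), by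
    intro k
    simp only [transpose_sum, transpose_smul, transpose_mul, transpose_transpose, x.2 _,
      Matrix.mul_neg, Matrix.neg_mul, smul_neg, Finset.sum_neg_distrib, Matrix.mul_assoc]⟩
  one_smul x := by
    apply Subtype.ext
    funext k
    change ∑ j, (1 : Matrix (Fin 3) (Fin 3) ℝ) k j •
      ((1 : Matrix (Fin 5) (Fin 5) ℝ) * x.1 j * (1 : Matrix (Fin 5) (Fin 5) ℝ)ᵀ) = x.1 k
    simp [Matrix.one_apply]
  mul_smul g h x := by
    apply Subtype.ext
    funext k
    change ∑ j, ((g.2 : Matrix (Fin 3) (Fin 3) ℝ) * (h.2 : Matrix (Fin 3) (Fin 3) ℝ)) k j •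
        (((g.1 : Matrix (Fin 5) (Fin 5) ℝ) * (h.1 : Matrix (Fin 5) (Fin 5) ℝ)) * x.1 j *
          ((g.1 : Matrix (Fin 5) (Fin 5) ℝ) * (h.1 : Matrix (Fin 5) (Fin 5) ℝ))ᵀ) =
      ∑ i, (g.2 : Matrix (Fin 3) (Fin 3) ℝ) k i • ((g.1 : Matrix (Fin 5) (Fin 5) ℝ) *
        (∑ j, (h.2 : Matrix (Fin 3) (Fin 3) ℝ) i j •
          ((h.1 : Matrix (Fin 5) (Fin 5) ℝ) * x.1 j * (h.1 : Matrix (Fin 5) (Fin 5) ℝ)ᵀ)) *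
        (g.1 : Matrix (Fin 5) (Fin 5) ℝ)ᵀ)
    simp only [Matrix.mul_apply (M := (g.2 : Matrix (Fin 3) (Fin 3) ℝ)), Finset.sum_smul,
      Matrix.mul_sum, Matrix.sum_mul, Finset.smul_sum, Matrix.mul_smul, Matrix.smul_mul,
      smul_smul, transpose_mul, Matrix.mul_assoc]
    exact Finset.sum_comm

/-- `mᵢ ∧ mⱼ`. -/
def wedge (i j : Fin 5) : Matrix (Fin 5) (Fin 5) ℝ :=
  Matrix.single i j 1 - Matrix.single j i 1

/-- The base point
`w = (m₁∧m₄ - 3 m₂∧m₃) ⊗ l₀ + (-m₀∧m₄ + 2 m₁∧m₃) ⊗ l₁ + (m₀∧m₃ - 3 m₁∧m₂) ⊗ l₂`. -/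
def basePoint : altTensor :=
  ⟨![wedge 1 4 - (3 : ℝ) • wedge 2 3,
     -wedge 0 4 + (2 : ℝ) • wedge 1 3,
     wedge 0 3 - (3 : ℝ) • wedge 1 2], by
    intro k
    fin_cases k <;> simp [wedge, transpose_sub, transpose_add, transpose_smul] <;>
      module⟩

/-- The inclusion `H_ℝ → G_ℝ`. -/
def inclHG : HReal →* GReal :=
  MonoidHom.prodMap SpecialLinearGroup.toGL SpecialLinearGroup.toGL

/-- The stabilizer `H_{xℝ}` of `x` in `H_ℝ`. -/
def stabH (x : altTensor) : Subgroup HReal :=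
  (MulAction.stabilizer GReal x).comap inclHG

/-- `H_{x1}`, the projection of `H_x` to the first factor. -/
def stabH1 (x : altTensor) : Subgroup (SpecialLinearGroup (Fin 5) ℝ) :=
  (stabH x).map (MonoidHom.fst _ _)

/-- `H_{x2}`, the projection of `H_x` to the second factor. -/
def stabH2 (x : altTensor) : Subgroup (SpecialLinearGroup (Fin 3) ℝ) :=
  (stabH x).map (MonoidHom.snd _ _)

section EquivariantMaps

/-- The coefficient `x_{ij} ∈ V₂` in `x = ∑_{i<j} mᵢ ∧ mⱼ ⊗ x_{ij}`. -/
def coeffV2 (x : altTensor) (i j : Fin 5) : Fin 3 → ℝ := fun k => x.1 k i j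

/-- The product `a b ∈ Sym² V₂ ⊆ V₂ ⊗ V₂` of `a, b ∈ V₂`, as a symmetric matrix:
`a b = (a ⊗ b + b ⊗ a) / 2`. -/
noncomputable def symProd (a b : Fin 3 → ℝ) : Matrix (Fin 3) (Fin 3) ℝ :=
  (1 / 2 : ℝ) • (Matrix.vecMulVec a b + Matrix.vecMulVec b a)

/-- For four indices, the `4 × 4` Pfaffian `x_{ij} x_{kl} - x_{ik} x_{jl} + x_{il} x_{jk}`,
with values in `Sym² V₂`. -/
noncomputable def pfaffMinor (x : altTensor) (i j k l : Fin 5) : Matrix (Fin 3) (Fin 3) ℝ :=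
  symProd (coeffV2 x i j) (coeffV2 x k l) - symProd (coeffV2 x i k) (coeffV2 x j l)
    + symProd (coeffV2 x i l) (coeffV2 x j k)

/-- The five signed Pfaffians `Pfaff₀(x), …, Pfaff₄(x) ∈ Sym² V₂`. -/
noncomputable def pfaff (x : altTensor) : Fin 5 → Matrix (Fin 3) (Fin 3) ℝ :=
  ![pfaffMinor x 1 2 3 4, -pfaffMinor x 0 2 3 4, pfaffMinor x 0 1 3 4,
    -pfaffMinor x 0 1 2 4, pfaffMinor x 0 1 2 3]

/-- `φ₁(x) = ∑ᵢ mᵢ* ⊗ Pfaffᵢ(x) ∈ V₁* ⊗ Sym² V₂`, as a linear map `V₁ → Sym² V₂`. -/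
noncomputable def phi1 (x : altTensor) : (Fin 5 → ℝ) →ₗ[ℝ] Matrix (Fin 3) (Fin 3) ℝ :=
  ∑ i, (LinearMap.proj i : (Fin 5 → ℝ) →ₗ[ℝ] ℝ).smulRight (pfaff x i)

/-- Coordinates of an element of `Sym² V₂` (a symmetric matrix) with respect to the basis
`l₀², l₁², l₂², l₀l₁, l₁l₂, l₀l₂`. -/
def symCoords (q : Matrix (Fin 3) (Fin 3) ℝ) : Fin 6 → ℝ :=
  ![q 0 0, q 1 1, q 2 2, 2 * q 0 1, 2 * q 1 2, 2 * q 0 2]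

/-- `Φ₁(x) = 3⁻⁴ Pfaff₀(x) ∧ ⋯ ∧ Pfaff₄(x) ∈ ∧⁵ Sym² V₂ ≅ (Sym² V₂)* = Sym² V₂*`, the
isomorphism being given by `q ∧ -` and the volume element of the basis used in `symCoords`.
This is the Gram matrix of the corresponding symmetric bilinear form on `V₂`: the entry `(s, t)` is
the value of the functional at `q = l_s l_t`. -/
noncomputable def Phi1 (x : altTensor) : Matrix (Fin 3) (Fin 3) ℝ :=
  Matrix.of fun s t => (1 / 3 ^ 4 : ℝ) *
    Matrix.det (Matrix.of ![symCoords (symProd (Pi.single s 1) (Pi.single t 1)),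
      symCoords (pfaff x 0), symCoords (pfaff x 1), symCoords (pfaff x 2),
      symCoords (pfaff x 3), symCoords (pfaff x 4)])

/-- `φ₃(x) = φ₁(x) Φ₁(x)`, a `3 × 3` matrix with entries in `V₁*`, viewed as a linear map from
`V₁` to real `3 × 3` matrices. -/
noncomputable def phi3 (x : altTensor) : (Fin 5 → ℝ) →ₗ[ℝ] Matrix (Fin 3) (Fin 3) ℝ :=
  (LinearMap.mulRight ℝ (Phi1 x)).comp (phi1 x)

/-- The quadratic form `Φ₂(x) = tr (φ₃(x)²) ∈ Sym² V₁*`. -/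
noncomputable def Phi2 (x : altTensor) : QuadraticForm ℝ (Fin 5 → ℝ) :=
  LinearMap.BilinMap.toQuadraticMap
    (LinearMap.mk₂ ℝ (fun a b => Matrix.trace (phi3 x a * phi3 x b))
      (by intros; simp [add_mul]) (by intros; simp)
      (by intros; simp [mul_add]) (by intros; simp))

end EquivariantMaps

/-- The special orthogonal group of a quadratic form on `ℝⁿ`. -/
def specialOrthogonal {n : ℕ} (Q : QuadraticForm ℝ (Fin n → ℝ)) :
    Subgroup (SpecialLinearGroup (Fin n) ℝ) where
  carrier := {g | ∀ a, Q ((g : Matrix (Fin n) (Fin n) ℝ) *ᵥ a) = Q a}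
  one_mem' := by
    intro a
    simp
  mul_mem' := by
    intro g h hg hh a
    change Q (((g : Matrix (Fin n) (Fin n) ℝ) * (h : Matrix (Fin n) (Fin n) ℝ)) *ᵥ a) = Q a
    rw [← Matrix.mulVec_mulVec, hg, hh]
  inv_mem' := by
    intro g hg a
    have h : (g : Matrix (Fin n) (Fin n) ℝ) * ((g⁻¹ : SpecialLinearGroup (Fin n) ℝ) :
        Matrix (Fin n) (Fin n) ℝ) = 1 :=
      congrArg Subtype.val (mul_inv_cancel g)
    rw [← hg, Matrix.mulVec_mulVec, h, Matrix.one_mulVec]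

/-- `H_{x3} = SO(Φ₂(x))`. -/
noncomputable def stabH3 (x : altTensor) : Subgroup (SpecialLinearGroup (Fin 5) ℝ) :=
  specialOrthogonal (Phi2 x)

/-- The connected component of `1` of a subgroup `K` of a topological group, in the topology
induced on `K`. -/
def idComp {A : Type*} [Group A] [TopologicalSpace A] [IsTopologicalGroup A] (K : Subgroup A) :
    Subgroup A :=
  (Subgroup.connectedComponentOfOne K).map K.subtype

/-! ### Closed subgroups of a finite-dimensional algebra and their Lie algebras -/

section ClosedSubgroup

open NormedSpace Filter Topology

/-! A closed connected subgroup is generated by the exponentials of its Lie algebra, so the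
proposition reduces to a classification of Lie algebras. All constructions are equivariant under
`GL(5) × GL(3)`: Pfaffians, `Phi1` and `Phi2` change by linear substitutions and nonzero scalars.
Hence conjugation carries all the groups involved for `w` to those for any point of its orbit, and
it suffices to treat `w`.

At `w` the Lie algebra of the stabilizer is a copy of `sl₂`, embedded in `sl(5) × sl(3)` diagonally
by its irreducible representations of dimensions 5 and 3. Write V(k) for the irreducible module of
highest weight k. Under this `sl₂` one has sl(5) = V(2) + V(4) + V(6) + V(8) and sl(3) = V(2) +
V(4), where the V(2)'s are the two images of `sl₂` and V(2) + V(6) in sl(5) is the orthogonal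
algebra of `Phi2`. A subalgebra containing the diagonal is `sl₂`-stable, so the Casimir operator
splits it into isotypic parts, and a few explicit brackets of weight vectors show which parts force
which others. Exactly seven subalgebras survive (`eq_of_commutator_mem`). They are identified with
the Lie algebras of the seven groups by `idComp_stabH_basePoint`, `idComp_stabH1_basePoint`,
`idComp_stabH2_basePoint`, `idComp_stabH3_basePoint` and `expGroup_slAlg`. The passage between
groups and algebras is Cartan's closed subgroup theorem (`eventually_exists_exp_eq`). The
projections of the stabilizer are not known to be closed, so their closures are used to bound their
Lie algebras.

For (2), F also contains the identity component of the stabilizer, so it is on the first list. A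
factor of F that is an identity component contains, and therefore equals, the corresponding
projection of the stabilizer. The only exception is the identity component of SO(`Phi2`), which is
of type SO(3,2). That case does not occur: the stabilizer contains a diagonal sign matrix that
reverses the orientation of a maximal negative definite plane (`signElement_fst_notMem`). -/

lemma map_mul_map_inv {A G : Type*} [Group G] [Monoid A] (ι : G →* A) (g : G) :
    ι g * ι g⁻¹ = 1 := by rw [← map_mul, mul_inv_cancel, map_one]

lemma map_inv_mul_map {A G : Type*} [Group G] [Monoid A] (ι : G →* A) (g : G) :
    ι g⁻¹ * ι g = 1 := by rw [← map_mul, inv_mul_cancel, map_one]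

/-- The subgroup generated by the exponentials of `L`. -/
def expGroup {A G : Type*} [NormedRing A] [Group G] (ι : G →* A) (L : Set A) :
    Subgroup G := Subgroup.closure {g | ∃ X ∈ L, ι g = exp X}

lemma mem_expGroup {A G : Type*} [NormedRing A] [Group G] {ι : G →* A} {L : Set A}
    {g : G} {X : A} (hX : X ∈ L) (h : ι g = exp X) : g ∈ expGroup ι L :=
  Subgroup.subset_closure ⟨X, hX, h⟩

variable {A : Type*} [NormedRing A] [NormedAlgebra ℝ A] [CompleteSpace A]

lemma continuous_exp_of_real : Continuous (exp : A → A) := by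
  let := NormedAlgebra.restrictScalars ℚ ℝ A
  exact exp_continuous

lemma exp_add_smul (X : A) (s t : ℝ) : exp ((s + t) • X) = exp (s • X) * exp (t • X) := by
  let := NormedAlgebra.restrictScalars ℚ ℝ A
  rw [add_smul]
  exact exp_add_of_commute (((Commute.refl X).smul_left s).smul_right t)

lemma exp_mul_exp_neg (X : A) : exp X * exp (-X) = 1 := by
  have := exp_add_smul X 1 (-1)
  simpa using this.symm

lemma exp_neg_mul_exp (X : A) : exp (-X) * exp X = 1 := by
  simpa using exp_mul_exp_neg (-X)

lemma exp_nsmul_of_real (X : A) (n : ℕ) : exp ((n : ℝ) • X) = exp X ^ n := by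
  let := NormedAlgebra.restrictScalars ℚ ℝ A
  rw [← NormedSpace.exp_nsmul, Nat.cast_smul_eq_nsmul]

lemma exp_conj_of_real {g h : A} (hgh : g * h = 1) (hhg : h * g = 1) (X : A) :
    exp (g * X * h) = g * exp X * h := by
  let := NormedAlgebra.restrictScalars ℚ ℝ A
  exact exp_units_conj ⟨g, h, hgh, hhg⟩ X

lemma hasDerivAt_exp_smul_zero (X : A) : HasDerivAt (fun t : ℝ => exp (t • X)) X 0 := by
  simpa using hasDerivAt_exp_smul_const (𝕂 := ℝ) X 0

/-- A local inverse of the exponential map at `1`. -/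
lemma exists_local_log : ∃ log : A → A, log 1 = 0 ∧ (∀ᶠ y in 𝓝 (1 : A), exp (log y) = y) ∧
    HasFDerivAt log (ContinuousLinearMap.id ℝ A) 1 := by
  have h : HasStrictFDerivAt (exp : A → A)
      ((ContinuousLinearEquiv.refl ℝ A : A ≃L[ℝ] A) : A →L[ℝ] A) 0 :=
    hasStrictFDerivAt_exp_zero
  refine ⟨h.localInverse _ _ _, ?_, ?_, ?_⟩
  · simpa using h.localInverse_apply_image
  · simpa using h.eventually_right_inverse
  · simpa using h.to_localInverse.hasFDerivAt

variable {G : Type*} [Group G] (ι : G →* A)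

/-- The tangent directions `X` of all one-parameter groups `t ↦ exp (t X)` inside `K`. -/
def lieSet (K : Subgroup G) : Set A := {X | ∀ t : ℝ, ∃ g ∈ K, ι g = exp (t • X)}

variable {ι} {K : Subgroup G}

lemma map_inv_eq_exp_neg {g : G} {Y : A} (h : ι g = exp Y) : ι g⁻¹ = exp (-Y) := by
  have h1 := map_inv_mul_map ι g
  rw [h] at h1
  calc ι g⁻¹ = ι g⁻¹ * (exp Y * exp (-Y)) := by rw [exp_mul_exp_neg, mul_one]
    _ = exp (-Y) := by rw [← mul_assoc, h1, one_mul]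

lemma exists_map_eq_exp_int_smul {Y : A} (h : ∃ g ∈ K, ι g = exp Y) (n : ℤ) :
    ∃ g ∈ K, ι g = exp ((n : ℝ) • Y) := by
  obtain ⟨g, hg, e⟩ := h
  refine ⟨g ^ n, K.zpow_mem hg n, ?_⟩
  obtain ⟨m, rfl | rfl⟩ := n.eq_nat_or_neg
  · rw [zpow_natCast, map_pow, e, ← exp_nsmul_of_real]; norm_cast
  · rw [_root_.zpow_neg, zpow_natCast, ← inv_pow, map_pow, map_inv_eq_exp_neg e,
      ← exp_nsmul_of_real]
    congr 1
    push_cast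
    rw [smul_neg, neg_smul]

/-- Integer powers of exp(Yₙ) stay in K. Rounding t rₙ to an integer costs less than ‖Yₙ‖, which
tends to 0, so exp(tX) is a limit of elements of the closed set. -/
lemma mem_lieSet_of_tendsto (hK : IsClosed (ι '' (K : Set G))) {Y : ℕ → A} {r : ℕ → ℝ} {X : A}
    (hY : ∀ᶠ n in atTop, ∃ g ∈ K, ι g = exp (Y n)) (hY0 : Tendsto Y atTop (𝓝 0))
    (hr : Tendsto (fun n => r n • Y n) atTop (𝓝 X)) : X ∈ lieSet ι K := by
  intro t
  have key : Tendsto (fun n => exp (((⌊t * r n⌋ : ℤ) : ℝ) • Y n)) atTop (𝓝 (exp (t • X))) := by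
    refine (continuous_exp_of_real.tendsto _).comp ?_
    have h1 : Tendsto (fun n => Int.fract (t * r n) • Y n) atTop (𝓝 0) := by
      refine squeeze_zero_norm (a := fun n => ‖Y n‖) (fun n => ?_) (by simpa using hY0.norm)
      rw [norm_smul, Real.norm_of_nonneg (Int.fract_nonneg _)]
      exact mul_le_of_le_one_left (norm_nonneg _) (Int.fract_lt_one _).le
    have h2 := (hr.const_smul t).sub h1
    rw [sub_zero] at h2
    refine h2.congr fun n => ?_
    rw [smul_smul, ← sub_smul, Int.self_sub_fract]
  have := hK.mem_of_tendsto key (hY.mono fun n hn => exists_map_eq_exp_int_smul hn _)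
  exact this

/-- Apply the limit criterion to the logarithms of γ(1/(n+1)), rescaled by n+1. This shows that
velocities at 1 of curves in K are tangent to one-parameter subgroups, which gives closure under
addition. -/
lemma mem_lieSet_of_hasDerivAt (hK : IsClosed (ι '' (K : Set G))) {γ : ℝ → A} {X : A}
    (hγ : ∀ t, ∃ g ∈ K, ι g = γ t) (h0 : γ 0 = 1) (hd : HasDerivAt γ X 0) : X ∈ lieSet ι K := by
  obtain ⟨log, hlog1, hlog, hdlog⟩ := exists_local_log (A := A)
  have hd' : HasDerivAt (fun t => log (γ t)) X 0 := by
    rw [← h0] at hdlog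
    exact hdlog.comp_hasDerivAt 0 hd
  have hu : Tendsto (fun n : ℕ => ((n : ℝ) + 1)⁻¹) atTop (𝓝 0) := by
    simpa [one_div] using tendsto_one_div_add_atTop_nhds_zero_nat (𝕜 := ℝ)
  have hc : Tendsto (fun n : ℕ => log (γ ((n : ℝ) + 1)⁻¹)) atTop (𝓝 0) := by
    have := hd'.continuousAt.tendsto.comp hu
    simpa [h0, hlog1, Function.comp_def] using this
  refine mem_lieSet_of_tendsto hK (Y := fun n : ℕ => log (γ ((n : ℝ) + 1)⁻¹))
    (r := fun n => (n : ℝ) + 1) ?_ hc ?_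
  · have h1 : Tendsto (fun n : ℕ => γ ((n : ℝ) + 1)⁻¹) atTop (𝓝 1) := by
      have := hd.continuousAt.tendsto.comp hu
      simpa [h0, Function.comp_def] using this
    filter_upwards [h1.eventually hlog] with n hn
    rw [hn]
    exact hγ _
  · have hs := hasDerivAt_iff_tendsto_slope.1 hd'
    have hu' : Tendsto (fun n : ℕ => ((n : ℝ) + 1)⁻¹) atTop (𝓝[≠] 0) :=
      tendsto_nhdsWithin_iff.2 ⟨hu, Eventually.of_forall fun n => by
        simp only [Set.mem_compl_iff, Set.mem_singleton_iff, inv_eq_zero]; positivity⟩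
    refine (hs.comp hu').congr fun n => ?_
    simp [slope_def_module, h0, hlog1]

variable (ι K) in
/-- The Lie algebra of a closed subgroup, as a space of matrices. -/
def lieSubmodule (hK : IsClosed (ι '' (K : Set G))) : Submodule ℝ A where
  carrier := lieSet ι K
  zero_mem' := fun t => ⟨1, K.one_mem, by simp⟩
  smul_mem' := fun c X hX t => by simpa [smul_smul] using hX (t * c)
  add_mem' := by
    intro X Y hX hY
    refine mem_lieSet_of_hasDerivAt hK (γ := fun t => exp (t • X) * exp (t • Y)) (fun t => ?_)
      (by simp) ?_
    · obtain ⟨g, hg, e⟩ := hX t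
      obtain ⟨h, hh, e'⟩ := hY t
      exact ⟨g * h, K.mul_mem hg hh, by rw [map_mul, e, e']⟩
    · simpa [Pi.mul_def] using (hasDerivAt_exp_smul_zero X).mul (hasDerivAt_exp_smul_zero Y)

lemma conj_mem_lieSubmodule (hK : IsClosed (ι '' (K : Set G))) {g : G} (hg : g ∈ K) {X : A}
    (hX : X ∈ lieSubmodule ι K hK) : ι g * X * ι g⁻¹ ∈ lieSubmodule ι K hK := by
  intro t
  obtain ⟨h, hh, e⟩ := hX t
  refine ⟨g * h * g⁻¹, K.mul_mem (K.mul_mem hg hh) (K.inv_mem hg), ?_⟩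
  rw [map_mul, map_mul, e, ← exp_conj_of_real (map_mul_map_inv ι g) (map_inv_mul_map ι g)]
  simp

/-- Each generator exp X is joined to 1 inside K by the path t ↦ exp(tX). The path is continuous in
G because `ι` is an embedding. -/
lemma expGroup_le_idComp [TopologicalSpace G] [IsTopologicalGroup G] (hι : IsClosedEmbedding ι)
    {L : Set A} (hL : L ⊆ lieSet ι K) : expGroup ι L ≤ idComp K := by
  rw [expGroup, Subgroup.closure_le]
  rintro g ⟨X, hX, e⟩
  choose c hcK hc using hL hX
  have hcont : Continuous c := by
    rw [hι.isEmbedding.continuous_iff]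
    have : ι ∘ c = fun t : ℝ => exp (t • X) := funext hc
    rw [this]
    exact continuous_exp_of_real.comp (by fun_prop)
  have h0 : c 0 = 1 := hι.injective (by rw [hc]; simp)
  have h1 : c 1 = g := hι.injective (by rw [hc, e, one_smul])
  let c' : ℝ → K := fun t => ⟨c t, hcK t⟩
  have hc' : Continuous c' := hcont.subtype_mk _
  have hpre : IsPreconnected (Set.range c') := isPreconnected_range hc'
  have h01 : (1 : K) ∈ Set.range c' := ⟨0, Subtype.ext h0⟩
  exact ⟨c' 1, hpre.subset_connectedComponent h01 ⟨1, rfl⟩, h1⟩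

variable [FiniteDimensional ℝ A]

/-- The bracket is the derivative at 0 of the curve t ↦ exp(tX) Y exp(-tX). The curve lies in the
Lie algebra, a closed subspace, so its difference quotients and their limit do too. -/
lemma commutator_mem_lieSubmodule (hK : IsClosed (ι '' (K : Set G))) {X Y : A}
    (hX : X ∈ lieSubmodule ι K hK) (hY : Y ∈ lieSubmodule ι K hK) :
    X * Y - Y * X ∈ lieSubmodule ι K hK := by
  set L := lieSubmodule ι K hK
  have hmem : ∀ t : ℝ, exp (t • X) * Y * exp (-(t • X)) ∈ L := by
    intro t
    obtain ⟨g, hg, e⟩ := hX t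
    rw [← map_inv_eq_exp_neg e, ← e]
    exact conj_mem_lieSubmodule hK hg hY
  have hd : HasDerivAt (fun t : ℝ => exp (t • X) * Y * exp (-(t • X))) (X * Y - Y * X) 0 := by
    have h1 := ((hasDerivAt_exp_smul_zero X).mul_const Y).mul (hasDerivAt_exp_smul_zero (-X))
    simpa [sub_eq_add_neg, Pi.mul_def] using h1
  have hs := hasDerivAt_iff_tendsto_slope.1 hd
  refine (L.closed_of_finiteDimensional).mem_of_tendsto hs (Eventually.of_forall fun t => ?_)
  rw [slope_def_module]
  exact L.smul_mem _ (L.sub_mem (hmem t) (hmem 0))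

/-- Cartan's argument. With a complement W of L, the map (X, Y) ↦ exp X exp Y is onto a
neighbourhood of 1. If elements of K near 1 were not in exp L, their W-parts would give nonzero Yₙ →
0 with exp Yₙ in K. A limit of the directions of Yₙ is a unit vector of W that belongs to L, which
is absurd. -/
lemma eventually_exists_exp_eq (hK : IsClosed (ι '' (K : Set G))) :
    ∀ᶠ y in 𝓝 (1 : A), y ∈ ι '' (K : Set G) → ∃ X ∈ lieSubmodule ι K hK, y = exp X := by
  set L := lieSubmodule ι K hK with hL
  obtain ⟨W, hW⟩ := L.exists_isCompl
  let Φ : L × W → A := fun p => exp (p.1 : A) * exp (p.2 : A)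
  have hΦ : HasStrictFDerivAt Φ
      (L.subtypeL.comp (ContinuousLinearMap.fst ℝ L W) +
        W.subtypeL.comp (ContinuousLinearMap.snd ℝ L W)) 0 := by
    have e0 : HasStrictFDerivAt (exp : A → A) (1 : A →L[ℝ] A) 0 := hasStrictFDerivAt_exp_zero
    have h1 : HasStrictFDerivAt (fun p : L × W => exp (p.1 : A))
        (L.subtypeL.comp (ContinuousLinearMap.fst ℝ L W)) 0 :=
      HasStrictFDerivAt.comp (g := exp) (g' := 1) 0 e0
        (L.subtypeL.comp (ContinuousLinearMap.fst ℝ L W)).hasStrictFDerivAt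
    have h2 : HasStrictFDerivAt (fun p : L × W => exp (p.2 : A))
        (W.subtypeL.comp (ContinuousLinearMap.snd ℝ L W)) 0 :=
      HasStrictFDerivAt.comp (g := exp) (g' := 1) 0 e0
        (W.subtypeL.comp (ContinuousLinearMap.snd ℝ L W)).hasStrictFDerivAt
    refine (h1.mul' h2).congr_fderiv ?_
    ext <;> simp
  have hsurj : (L.subtypeL.comp (ContinuousLinearMap.fst ℝ L W) +
        W.subtypeL.comp (ContinuousLinearMap.snd ℝ L W)).range = ⊤ := by
    rw [LinearMap.range_eq_top]
    intro y
    obtain ⟨u, hu, v, hv, h⟩ := Submodule.mem_sup.1 (hW.sup_eq_top ▸ Submodule.mem_top : y ∈ L ⊔ W)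
    exact ⟨(⟨u, hu⟩, ⟨v, hv⟩), by simpa using h⟩
  have hmap := hΦ.map_nhds_eq_of_surj hsurj
  have hΦ0 : Φ 0 = 1 := by simp [Φ]
  rw [hΦ0] at hmap
  by_contra hcon
  have hfr : ∃ᶠ p in 𝓝 (0 : L × W),
      Φ p ∈ ι '' (K : Set G) ∧ ¬ ∃ X ∈ L, Φ p = exp X := by
    rw [← hmap] at hcon
    exact (Filter.not_eventually.1 hcon).mono fun p hp => Classical.not_imp.1 hp
  obtain ⟨p, hp0, hp⟩ := exists_seq_forall_of_frequently hfr
  have hY : ∀ n, ∃ g ∈ K, ι g = exp ((p n).2 : A) := by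
    intro n
    obtain ⟨g, hg, e⟩ := (hp n).1
    obtain ⟨h, hh, e'⟩ := (p n).1.2 1
    rw [one_smul] at e'
    refine ⟨h⁻¹ * g, K.mul_mem (K.inv_mem hh) hg, ?_⟩
    rw [map_mul, e, map_inv_eq_exp_neg e']
    simp only [Φ]
    rw [← mul_assoc, exp_neg_mul_exp, one_mul]
  have hY0 : ∀ n, (p n).2 ≠ 0 := by
    intro n h
    refine (hp n).2 ⟨(p n).1, (p n).1.2, ?_⟩
    simp [Φ, h]
  have hYt : Tendsto (fun n => (p n).2) atTop (𝓝 0) := by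
    exact (continuous_snd.tendsto (0 : L × W)).comp hp0
  -- Compactness of the unit sphere of W supplies the limiting direction. The rescaling factors
  -- 1/‖Yₙ‖ then fit the limit criterion.
  obtain ⟨y, hy, φ, hφ, hlim⟩ := (isCompact_sphere (0 : W) 1).tendsto_subseq
    (x := fun n => ‖(p n).2‖⁻¹ • (p n).2) (fun n => by
      simp [norm_smul, hY0 n])
  have hyL : (y : A) ∈ L := by
    refine mem_lieSet_of_tendsto hK (Y := fun n => ((p (φ n)).2 : A))
      (r := fun n => ‖(p (φ n)).2‖⁻¹) (Eventually.of_forall fun n => hY _) ?_ ?_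
    · have := (continuous_subtype_val.tendsto (0 : W)).comp (hYt.comp hφ.tendsto_atTop)
      simpa [Function.comp_def] using this
    · exact (continuous_subtype_val.tendsto y).comp hlim
  have : (y : A) = 0 := by
    have := hW.disjoint.le_bot ⟨hyL, y.2⟩
    simpa using this
  have hy0 : y = 0 := by ext; simpa using this
  simp [hy0] at hy

variable [TopologicalSpace G]

lemma exists_nhds_subset_of_exp_mem [IsTopologicalGroup G] (hι : IsClosedEmbedding ι)
    {K D : Subgroup G} {L : Set A} (hL : lieSet ι K.topologicalClosure ⊆ L)
    (hD : ∀ g : G, ∀ X ∈ L, ι g = exp X → g ∈ D) : ∀ᶠ g in 𝓝 (1 : G), g ∈ K → g ∈ D := by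
  have hK : IsClosed (ι '' (K.topologicalClosure : Set G)) :=
    hι.isClosedMap _ K.isClosed_topologicalClosure
  have h1 := eventually_exists_exp_eq hK
  have h2 : Tendsto ι (𝓝 1) (𝓝 1) := by simpa using hι.continuous.tendsto (1 : G)
  filter_upwards [h2.eventually h1] with g hg hgK
  obtain ⟨X, hX, e⟩ := hg ⟨g, K.le_topologicalClosure hgK, rfl⟩
  exact hD g X (hL hX) e

/-- D cuts out a subgroup of K that contains a neighbourhood of 1. It is therefore open, hence
clopen, and contains the component of 1. -/
lemma idComp_le_of_nhds [IsTopologicalGroup G] {K D : Subgroup G}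
    (h : ∀ᶠ g in 𝓝 (1 : G), g ∈ K → g ∈ D) : idComp K ≤ D := by
  rintro _ ⟨g, hg, rfl⟩
  have hopen : IsOpen ((D.comap K.subtype : Subgroup K) : Set K) := by
    refine Subgroup.isOpen_of_mem_nhds _ (g := 1) ?_
    have h2 : Tendsto K.subtype (𝓝 1) (𝓝 1) := by
      simpa using (continuous_subtype_val.tendsto (1 : K))
    filter_upwards [h2.eventually h] with k hk using hk k.2
  have hcl : IsClopen ((D.comap K.subtype : Subgroup K) : Set K) :=
    ⟨Subgroup.isClosed_of_isOpen _ hopen, hopen⟩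
  exact hcl.connectedComponent_subset (Subgroup.one_mem _) hg

lemma idComp_eq_self [IsTopologicalGroup G] {F : Subgroup G} (hF : IsConnected (F : Set G)) :
    idComp F = F := by
  have : ConnectedSpace F := Subtype.connectedSpace hF
  ext g
  constructor
  · rintro ⟨k, -, rfl⟩
    exact k.2
  · intro hg
    refine ⟨⟨g, hg⟩, ?_, rfl⟩
    change (⟨g, hg⟩ : F) ∈ connectedComponent (1 : F)
    rw [PreconnectedSpace.connectedComponent_eq_univ]
    trivial

/-- K need not be closed: L is bounded above by the Lie set of the closure, to which Cartan's
theorem applies, and below by that of K itself. -/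
lemma idComp_eq_expGroup [IsTopologicalGroup G] (hι : IsClosedEmbedding ι) {L : Set A}
    (hL : L ⊆ lieSet ι K) (hL' : lieSet ι K.topologicalClosure ⊆ L) :
    idComp K = expGroup ι L :=
  le_antisymm (idComp_le_of_nhds (exists_nhds_subset_of_exp_mem hι hL'
    fun _ _ hX e => mem_expGroup hX e)) (expGroup_le_idComp hι hL)

lemma eq_expGroup_of_isConnected [IsTopologicalGroup G] (hι : IsClosedEmbedding ι)
    {F : Subgroup G} (hF : IsClosed (F : Set G)) (hc : IsConnected (F : Set G)) :
    F = expGroup ι (lieSet ι F) := by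
  have h : F.topologicalClosure = F :=
    le_antisymm (F.topologicalClosure_minimal le_rfl hF) F.le_topologicalClosure
  conv_lhs => rw [← idComp_eq_self hc]
  exact idComp_eq_expGroup hι le_rfl (by rw [h])

end ClosedSubgroup

/-! ### Irreducible `sl₂`-modules in coordinates, and the Casimir operator -/

section Sl2Chains

variable {M : Type*} [Ring M] [Algebra ℝ M] {W : Type*} [AddCommGroup W] [Module ℝ W]

/-- The map `x ↦ X x - x X`. -/
def adMap (X : M) : M →ₗ[ℝ] M := LinearMap.mulLeft ℝ X - LinearMap.mulRight ℝ X

lemma adMap_apply (X x : M) : adMap X x = X * x - x * X := by simp [adMap]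

/-- The raising operator of the irreducible `sl₂`-module of highest weight `k` (with multiplicity
space `W`), in coordinates `a 0, …, a k`. -/
def sl2Up (k : ℕ) (a : ℕ → W) : ℕ → W := fun j => ((k : ℝ) - j) • a (j + 1)

/-- The lowering operator of the irreducible `sl₂`-modules. -/
def sl2Down (a : ℕ → W) : ℕ → W := fun j => (j : ℝ) • a (j - 1)

/-- `T` is a homomorphism from `W` copies of the irreducible `sl₂`-module of highest weight `k`
to `M`, on which `sl₂` acts by commutators with `E` and `F`. -/
structure IsSl2Chain (E F : M) (k : ℕ) (T : (ℕ → W) →ₗ[ℝ] M) : Prop where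
  up : ∀ a, adMap E (T a) = T (sl2Up k a)
  down : ∀ a, adMap F (T a) = T (sl2Down a)
  eq_zero : ∀ a, (∀ j ≤ k, a j = 0) → T a = 0

/-- The Casimir operator. -/
noncomputable def casimirMap (E F : M) : M →ₗ[ℝ] M :=
  adMap E ∘ₗ adMap F + adMap F ∘ₗ adMap E + (1 / 2 : ℝ) •
    ((adMap E ∘ₗ adMap F - adMap F ∘ₗ adMap E) ∘ₗ (adMap E ∘ₗ adMap F - adMap F ∘ₗ adMap E))

lemma casimirMap_mem {E F : M} {N : Submodule ℝ M} (hE : ∀ x ∈ N, adMap E x ∈ N)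
    (hF : ∀ x ∈ N, adMap F x ∈ N) {x : M} (hx : x ∈ N) : casimirMap E F x ∈ N := by
  have hH : ∀ y ∈ N, (adMap E ∘ₗ adMap F - adMap F ∘ₗ adMap E) y ∈ N := fun y hy =>
    N.sub_mem (hE _ (hF _ hy)) (hF _ (hE _ hy))
  exact N.add_mem (N.add_mem (hE _ (hF _ hx)) (hF _ (hE _ hx))) (N.smul_mem _ (hH _ (hH _ hx)))

namespace IsSl2Chain

variable {E F : M} {k : ℕ} {T : (ℕ → W) →ₗ[ℝ] M}

lemma congr (h : IsSl2Chain E F k T) {a b : ℕ → W} (hab : ∀ j ≤ k, a j = b j) : T a = T b := by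
  rw [← sub_eq_zero, ← map_sub]
  exact h.eq_zero _ fun j hj => by simp [hab j hj]

/-- The commutator of raising and lowering is the Cartan element: (k-j)(j+1) - j(k-j+1) = k-2j. The
truncated index `j - 1` at j = 0 does no harm, since its coefficient is 0; likewise the coefficient
of `a (k + 1)` in the raising operator vanishes. -/
lemma weight (h : IsSl2Chain E F k T) (a : ℕ → W) :
    (adMap E ∘ₗ adMap F - adMap F ∘ₗ adMap E) (T a) = T (fun j => ((k : ℝ) - 2 * j) • a j) := by
  simp only [LinearMap.sub_apply, LinearMap.comp_apply, h.up, h.down, ← map_sub]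
  congr 1
  funext j
  rcases j with _ | j
  · simp [sl2Up, sl2Down]
  · simp only [sl2Up, sl2Down, Pi.sub_apply, Nat.add_sub_cancel, smul_smul, ← sub_smul]
    congr 1
    push_cast
    ring

lemma casimir (h : IsSl2Chain E F k T) (a : ℕ → W) :
    casimirMap E F (T a) = ((k : ℝ) * (k + 2) / 2) • T a := by
  simp only [casimirMap, LinearMap.add_apply, LinearMap.smul_apply]
  rw [LinearMap.comp_apply (adMap E ∘ₗ adMap F - adMap F ∘ₗ adMap E), h.weight, h.weight]
  simp only [LinearMap.comp_apply, h.up, h.down, ← map_add, ← map_smul]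
  congr 1
  funext j
  rcases j with _ | j
  all_goals
    simp only [sl2Up, sl2Down, Pi.add_apply, Pi.smul_apply, Nat.add_sub_cancel]
    push_cast
    module

/-- If n is the last index with a nonzero coordinate, each application of E moves it down by one
with the nonzero factor k-(n-1). After n steps only the highest weight coordinate is left. -/
lemma exists_highest (h : IsSl2Chain E F k T) {N : Submodule ℝ M} (hE : ∀ x ∈ N, adMap E x ∈ N)
    {a : ℕ → W} (ha : T a ∈ N) (hne : ∃ j ≤ k, a j ≠ 0) :
    ∃ w ≠ 0, T (Pi.single 0 w) ∈ N := by
  have key : ∀ n ≤ k, ∀ a : ℕ → W, T a ∈ N → a n ≠ 0 → (∀ j ≤ k, n < j → a j = 0) →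
      ∃ w ≠ 0, T (Pi.single 0 w) ∈ N := by
    intro n
    induction n with
    | zero =>
      intro _ a ha h0 hz
      refine ⟨a 0, h0, ?_⟩
      rwa [h.congr (b := a)]
      intro j hj
      rcases Nat.eq_zero_or_pos j with rfl | hj0
      · simp
      · rw [hz j hj hj0, Pi.single_eq_of_ne hj0.ne']
    | succ n ih =>
      intro hn a ha h0 hz
      refine ih (by omega) (sl2Up k a) (h.up a ▸ hE _ ha) ?_ ?_
      · refine smul_ne_zero ?_ h0
        rw [sub_ne_zero]
        exact_mod_cast (by omega : k ≠ n)
      · intro j hj hnj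
        rcases hj.eq_or_lt with rfl | hlt
        · simp [sl2Up]
        · simp [sl2Up, hz (j + 1) hlt (by omega)]
  classical
  obtain ⟨j, hj, hj0⟩ := hne
  refine key (Nat.findGreatest (fun j => a j ≠ 0) k) (Nat.findGreatest_le k) a ha
    (Nat.findGreatest_spec (P := fun j => a j ≠ 0) hj hj0) fun i hi hlt => ?_
  exact not_not.1 (Nat.findGreatest_is_greatest hlt hi)

/-- Applying F to the n-th basis vector gives n+1 times the next one, so the highest weight vector
generates w ⊗ V(k). -/
lemma mem_of_highest (h : IsSl2Chain E F k T) {N : Submodule ℝ M} (hF : ∀ x ∈ N, adMap F x ∈ N)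
    {w : W} (hw : T (Pi.single 0 w) ∈ N) (c : ℕ → ℝ) : T (fun j => c j • w) ∈ N := by
  have key : ∀ n, T (Pi.single n w) ∈ N := by
    intro n
    induction n with
    | zero => exact hw
    | succ n ih =>
      have h1 := hF _ ih
      rw [h.down] at h1
      have h2 : sl2Down (Pi.single n w) = ((n : ℝ) + 1) • Pi.single (n + 1) w := by
        funext j
        rcases j with _ | j
        · simp [sl2Down]
        · by_cases hj : j = n
          · subst hj; simp [sl2Down]
          · simp [sl2Down, Pi.single_eq_of_ne hj, Pi.single_eq_of_ne (fun h => hj (Nat.succ.inj h))]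
      rw [h2, map_smul] at h1
      exact (N.smul_mem_iff (by positivity)).1 h1
  have hs : T (fun j => c j • w) = ∑ j ∈ Finset.range (k + 1), c j • T (Pi.single j w) := by
    simp only [← map_smul, ← map_sum]
    refine h.congr fun j hj => ?_
    rw [Finset.sum_apply, Finset.sum_eq_single j]
    · simp
    · intro i _ hi
      simp [Pi.single_eq_of_ne hi.symm]
    · intro hj'
      exact absurd (Finset.mem_range.2 (by omega)) hj'
  rw [hs]
  exact N.sum_mem fun j _ => N.smul_mem _ (key j)

lemma exists_forall_mem (h : IsSl2Chain E F k T) {N : Submodule ℝ M}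
    (hE : ∀ x ∈ N, adMap E x ∈ N) (hF : ∀ x ∈ N, adMap F x ∈ N)
    {a : ℕ → W} (ha : T a ∈ N) (hne : T a ≠ 0) :
    ∃ w ≠ 0, ∀ c : ℕ → ℝ, T (fun j => c j • w) ∈ N := by
  have hne' : ∃ j ≤ k, a j ≠ 0 := by
    by_contra! hcon
    exact hne (h.eq_zero a hcon)
  obtain ⟨w, hw, hwN⟩ := h.exists_highest hE ha hne'
  exact ⟨w, hw, h.mem_of_highest hF hwN⟩

/-- An `sl₂`-stable submodule that meets the image of an irreducible module contains it. -/
lemma mem_of_ne_zero {T : (ℕ → ℝ) →ₗ[ℝ] M} (h : IsSl2Chain E F k T) {N : Submodule ℝ M}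
    (hE : ∀ x ∈ N, adMap E x ∈ N) (hF : ∀ x ∈ N, adMap F x ∈ N)
    {a : ℕ → ℝ} (ha : T a ∈ N) (hne : T a ≠ 0) (b : ℕ → ℝ) : T b ∈ N := by
  obtain ⟨w, hw, hwN⟩ := h.exists_forall_mem hE hF ha hne
  have := hwN (fun j => b j * w⁻¹)
  simpa [hw] using this

end IsSl2Chain

/-- The operator C - c i₀ kills the i₀-th summand and rescales the others by nonzero factors, so one
eigenvalue at a time can be removed. -/
lemma mem_of_sum_mem_of_eigenvector {I M : Type*} [DecidableEq I] [AddCommGroup M] [Module ℝ M]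
    {N : Submodule ℝ M} {C : M →ₗ[ℝ] M} (hC : ∀ x ∈ N, C x ∈ N) {c : I → ℝ}
    (hc : Function.Injective c) (s : Finset I) : ∀ x : I → M, (∀ i, C (x i) = c i • x i) →
    ∑ i ∈ s, x i ∈ N → ∀ i ∈ s, x i ∈ N := by
  induction s using Finset.induction_on with
  | empty => simp
  | insert i₀ s hi₀ ih =>
    intro x hx hsum
    have h1 : ∀ i ∈ s, x i ∈ N := by
      intro i hi
      have h2 : ∑ i ∈ s, (c i - c i₀) • x i ∈ N := by
        have h3 := N.sub_mem (hC _ hsum) (N.smul_mem (c i₀) hsum)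
        rw [map_sum, Finset.smul_sum, ← Finset.sum_sub_distrib, Finset.sum_insert hi₀, hx,
          sub_self, zero_add] at h3
        simpa [hx, sub_smul] using h3
      have h4 := ih (fun i => (c i - c i₀) • x i)
        (fun i => by rw [map_smul, hx, smul_comm]) h2 i hi
      refine (N.smul_mem_iff ?_).1 h4
      rw [sub_ne_zero]
      exact fun h => hi₀ (hc h ▸ hi)
    rw [Finset.sum_insert hi₀] at hsum
    intro i hi
    rcases Finset.mem_insert.1 hi with rfl | hi
    · simpa using N.sub_mem hsum (N.sum_mem h1)
    · exact h1 i hi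

end Sl2Chains

/-! ### Explicit decomposition of sl(5) and sl(3) under `sl₂` -/

section Components

/-- The raising operator in `sl(5)`. -/
def raise5 : Matrix (Fin 5) (Fin 5) ℝ :=
  !![0, 1, 0, 0, 0; 0, 0, 2, 0, 0; 0, 0, 0, 3, 0; 0, 0, 0, 0, 4; 0, 0, 0, 0, 0]

/-- The lowering operator in `sl(5)`. -/
def lower5 : Matrix (Fin 5) (Fin 5) ℝ :=
  !![0, 0, 0, 0, 0; 4, 0, 0, 0, 0; 0, 3, 0, 0, 0; 0, 0, 2, 0, 0; 0, 0, 0, 1, 0]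

/-- The raising operator in `sl(3)`. -/
def raise3 : Matrix (Fin 3) (Fin 3) ℝ := !![0, 1, 0; 0, 0, 2; 0, 0, 0]

/-- The lowering operator in `sl(3)`. -/
def lower3 : Matrix (Fin 3) (Fin 3) ℝ := !![0, 0, 0; 2, 0, 0; 0, 1, 0]

lemma adMap_raise5 (A : Matrix (Fin 5) (Fin 5) ℝ) : adMap raise5 A =
    !![A 1 0, A 1 1 - A 0 0, A 1 2 - 2 * A 0 1, A 1 3 - 3 * A 0 2, A 1 4 - 4 * A 0 3;
    2 * A 2 0, 2 * A 2 1 - A 1 0, 2 * A 2 2 - 2 * A 1 1, 2 * A 2 3 - 3 * A 1 2, 2 * A 2 4 - 4 * A 1 3;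
    3 * A 3 0, 3 * A 3 1 - A 2 0, 3 * A 3 2 - 2 * A 2 1, 3 * A 3 3 - 3 * A 2 2, 3 * A 3 4 - 4 * A 2 3;
    4 * A 4 0, 4 * A 4 1 - A 3 0, 4 * A 4 2 - 2 * A 3 1, 4 * A 4 3 - 3 * A 3 2, 4 * A 4 4 - 4 * A 3 3;
    0, -A 4 0, -2 * A 4 1, -3 * A 4 2, -4 * A 4 3] := by
  rw [adMap_apply]
  ext i j
  rw [Matrix.sub_apply, Matrix.mul_apply, Matrix.mul_apply, Fin.sum_univ_five, Fin.sum_univ_five]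
  fin_cases i <;> fin_cases j <;> simp [raise5] <;> ring

lemma adMap_lower5 (A : Matrix (Fin 5) (Fin 5) ℝ) : adMap lower5 A =
    !![-4 * A 0 1, -3 * A 0 2, -2 * A 0 3, -A 0 4, 0;
    4 * A 0 0 - 4 * A 1 1, 4 * A 0 1 - 3 * A 1 2, 4 * A 0 2 - 2 * A 1 3, 4 * A 0 3 - A 1 4, 4 * A 0 4;
    3 * A 1 0 - 4 * A 2 1, 3 * A 1 1 - 3 * A 2 2, 3 * A 1 2 - 2 * A 2 3, 3 * A 1 3 - A 2 4, 3 * A 1 4;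
    2 * A 2 0 - 4 * A 3 1, 2 * A 2 1 - 3 * A 3 2, 2 * A 2 2 - 2 * A 3 3, 2 * A 2 3 - A 3 4, 2 * A 2 4;
    A 3 0 - 4 * A 4 1, A 3 1 - 3 * A 4 2, A 3 2 - 2 * A 4 3, A 3 3 - A 4 4, A 3 4] := by
  rw [adMap_apply]
  ext i j
  rw [Matrix.sub_apply, Matrix.mul_apply, Matrix.mul_apply, Fin.sum_univ_five, Fin.sum_univ_five]
  fin_cases i <;> fin_cases j <;> simp [lower5] <;> ring

lemma adMap_raise3 (A : Matrix (Fin 3) (Fin 3) ℝ) : adMap raise3 A =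
    !![A 1 0, A 1 1 - A 0 0, A 1 2 - 2 * A 0 1;
    2 * A 2 0, 2 * A 2 1 - A 1 0, 2 * A 2 2 - 2 * A 1 1;
    0, -A 2 0, -2 * A 2 1] := by
  rw [adMap_apply]
  ext i j
  rw [Matrix.sub_apply, Matrix.mul_apply, Matrix.mul_apply, Fin.sum_univ_three, Fin.sum_univ_three]
  fin_cases i <;> fin_cases j <;> simp [raise3] <;> ring

lemma adMap_lower3 (A : Matrix (Fin 3) (Fin 3) ℝ) : adMap lower3 A =
    !![-2 * A 0 1, -A 0 2, 0;
    2 * A 0 0 - 2 * A 1 1, 2 * A 0 1 - A 1 2, 2 * A 0 2;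
    A 1 0 - 2 * A 2 1, A 1 1 - A 2 2, A 1 2] := by
  rw [adMap_apply]
  ext i j
  rw [Matrix.sub_apply, Matrix.mul_apply, Matrix.mul_apply, Fin.sum_univ_three, Fin.sum_univ_three]
  fin_cases i <;> fin_cases j <;> simp [lower3] <;> ring

/-- The component of highest weight `2` of `sl(5)`. -/
def comp5V2 : (ℕ → ℝ) →ₗ[ℝ] Matrix (Fin 5) (Fin 5) ℝ where
  toFun a := !![-4 * a 1, a 0, 0, 0, 0;
    -4 * a 2, -2 * a 1, 2 * a 0, 0, 0;
    0, -3 * a 2, 0, 3 * a 0, 0;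
    0, 0, -2 * a 2, 2 * a 1, 4 * a 0;
    0, 0, 0, -a 2, 4 * a 1]
  map_add' a b := by
    ext i j
    fin_cases i <;> fin_cases j <;> simp <;> ring
  map_smul' c a := by
    ext i j
    fin_cases i <;> fin_cases j <;> simp <;> ring

lemma comp5V2_apply (a : ℕ → ℝ) : comp5V2 a =
    !![-4 * a 1, a 0, 0, 0, 0;
    -4 * a 2, -2 * a 1, 2 * a 0, 0, 0;
    0, -3 * a 2, 0, 3 * a 0, 0;
    0, 0, -2 * a 2, 2 * a 1, 4 * a 0;
    0, 0, 0, -a 2, 4 * a 1] := rfl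

/-- The component of highest weight `4` of `sl(5)`. -/
def comp5V4 : (ℕ → ℝ) →ₗ[ℝ] Matrix (Fin 5) (Fin 5) ℝ where
  toFun a := !![6 * a 2, -3 * a 1, a 0, 0, 0;
    12 * a 3, -3 * a 2, -2 * a 1, 3 * a 0, 0;
    6 * a 4, 3 * a 3, -6 * a 2, 3 * a 1, 6 * a 0;
    0, 3 * a 4, -2 * a 3, -3 * a 2, 12 * a 1;
    0, 0, a 4, -3 * a 3, 6 * a 2]
  map_add' a b := by
    ext i j
    fin_cases i <;> fin_cases j <;> simp <;> ring
  map_smul' c a := by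
    ext i j
    fin_cases i <;> fin_cases j <;> simp <;> ring

lemma comp5V4_apply (a : ℕ → ℝ) : comp5V4 a =
    !![6 * a 2, -3 * a 1, a 0, 0, 0;
    12 * a 3, -3 * a 2, -2 * a 1, 3 * a 0, 0;
    6 * a 4, 3 * a 3, -6 * a 2, 3 * a 1, 6 * a 0;
    0, 3 * a 4, -2 * a 3, -3 * a 2, 12 * a 1;
    0, 0, a 4, -3 * a 3, 6 * a 2] := rfl

/-- The component of highest weight `6` of `sl(5)`. -/
def comp5V6 : (ℕ → ℝ) →ₗ[ℝ] Matrix (Fin 5) (Fin 5) ℝ where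
  toFun a := !![-4 * a 3, 3 * a 2, -2 * a 1, a 0, 0;
    -12 * a 4, 8 * a 3, -4 * a 2, 0, 4 * a 0;
    -12 * a 5, 6 * a 4, 0, -6 * a 2, 12 * a 1;
    -4 * a 6, 0, 4 * a 4, -8 * a 3, 12 * a 2;
    0, -a 6, 2 * a 5, -3 * a 4, 4 * a 3]
  map_add' a b := by
    ext i j
    fin_cases i <;> fin_cases j <;> simp <;> ring
  map_smul' c a := by
    ext i j
    fin_cases i <;> fin_cases j <;> simp <;> ring

lemma comp5V6_apply (a : ℕ → ℝ) : comp5V6 a =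
    !![-4 * a 3, 3 * a 2, -2 * a 1, a 0, 0;
    -12 * a 4, 8 * a 3, -4 * a 2, 0, 4 * a 0;
    -12 * a 5, 6 * a 4, 0, -6 * a 2, 12 * a 1;
    -4 * a 6, 0, 4 * a 4, -8 * a 3, 12 * a 2;
    0, -a 6, 2 * a 5, -3 * a 4, 4 * a 3] := rfl

/-- The component of highest weight `8` of `sl(5)`. -/
def comp5V8 : (ℕ → ℝ) →ₗ[ℝ] Matrix (Fin 5) (Fin 5) ℝ where
  toFun a := !![a 4, -a 3, a 2, -a 1, a 0;
    4 * a 5, -4 * a 4, 4 * a 3, -4 * a 2, 4 * a 1;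
    6 * a 6, -6 * a 5, 6 * a 4, -6 * a 3, 6 * a 2;
    4 * a 7, -4 * a 6, 4 * a 5, -4 * a 4, 4 * a 3;
    a 8, -a 7, a 6, -a 5, a 4]
  map_add' a b := by
    ext i j
    fin_cases i <;> fin_cases j <;> simp <;> ring
  map_smul' c a := by
    ext i j
    fin_cases i <;> fin_cases j <;> simp <;> ring

lemma comp5V8_apply (a : ℕ → ℝ) : comp5V8 a =
    !![a 4, -a 3, a 2, -a 1, a 0;
    4 * a 5, -4 * a 4, 4 * a 3, -4 * a 2, 4 * a 1;
    6 * a 6, -6 * a 5, 6 * a 4, -6 * a 3, 6 * a 2;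
    4 * a 7, -4 * a 6, 4 * a 5, -4 * a 4, 4 * a 3;
    a 8, -a 7, a 6, -a 5, a 4] := rfl

/-- The component of highest weight `2` of `sl(3)`. -/
def comp3V2 : (ℕ → ℝ) →ₗ[ℝ] Matrix (Fin 3) (Fin 3) ℝ where
  toFun a := !![-2 * a 1, a 0, 0;
    -2 * a 2, 0, 2 * a 0;
    0, -a 2, 2 * a 1]
  map_add' a b := by
    ext i j
    fin_cases i <;> fin_cases j <;> simp <;> ring
  map_smul' c a := by
    ext i j
    fin_cases i <;> fin_cases j <;> simp <;> ring

lemma comp3V2_apply (a : ℕ → ℝ) : comp3V2 a =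
    !![-2 * a 1, a 0, 0;
    -2 * a 2, 0, 2 * a 0;
    0, -a 2, 2 * a 1] := rfl

/-- The component of highest weight `4` of `sl(3)`. -/
def comp3V4 : (ℕ → ℝ) →ₗ[ℝ] Matrix (Fin 3) (Fin 3) ℝ where
  toFun a := !![a 2, -a 1, a 0;
    2 * a 3, -2 * a 2, 2 * a 1;
    a 4, -a 3, a 2]
  map_add' a b := by
    ext i j
    fin_cases i <;> fin_cases j <;> simp <;> ring
  map_smul' c a := by
    ext i j
    fin_cases i <;> fin_cases j <;> simp <;> ring

lemma comp3V4_apply (a : ℕ → ℝ) : comp3V4 a =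
    !![a 2, -a 1, a 0;
    2 * a 3, -2 * a 2, 2 * a 1;
    a 4, -a 3, a 2] := rfl

lemma isSl2Chain_comp5V2 : IsSl2Chain raise5 lower5 2 comp5V2 where
  up a := by
    rw [adMap_raise5, comp5V2_apply, comp5V2_apply]
    ext i j
    fin_cases i <;> fin_cases j <;> simp [sl2Up] <;> ring
  down a := by
    rw [adMap_lower5, comp5V2_apply, comp5V2_apply]
    ext i j
    fin_cases i <;> fin_cases j <;> simp [sl2Down] <;> ring
  eq_zero a ha := by
    rw [comp5V2_apply]
    ext i j
    fin_cases i <;> fin_cases j <;> simp [ha]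

lemma isSl2Chain_comp5V4 : IsSl2Chain raise5 lower5 4 comp5V4 where
  up a := by
    rw [adMap_raise5, comp5V4_apply, comp5V4_apply]
    ext i j
    fin_cases i <;> fin_cases j <;> simp [sl2Up] <;> ring
  down a := by
    rw [adMap_lower5, comp5V4_apply, comp5V4_apply]
    ext i j
    fin_cases i <;> fin_cases j <;> simp [sl2Down] <;> ring
  eq_zero a ha := by
    rw [comp5V4_apply]
    ext i j
    fin_cases i <;> fin_cases j <;> simp [ha]

lemma isSl2Chain_comp5V6 : IsSl2Chain raise5 lower5 6 comp5V6 where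
  up a := by
    rw [adMap_raise5, comp5V6_apply, comp5V6_apply]
    ext i j
    fin_cases i <;> fin_cases j <;> simp [sl2Up] <;> ring_nf <;> simp
  down a := by
    rw [adMap_lower5, comp5V6_apply, comp5V6_apply]
    ext i j
    fin_cases i <;> fin_cases j <;> simp [sl2Down] <;> ring
  eq_zero a ha := by
    rw [comp5V6_apply]
    ext i j
    fin_cases i <;> fin_cases j <;> simp [ha]

lemma isSl2Chain_comp5V8 : IsSl2Chain raise5 lower5 8 comp5V8 where
  up a := by
    rw [adMap_raise5, comp5V8_apply, comp5V8_apply]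
    ext i j
    fin_cases i <;> fin_cases j <;> simp [sl2Up] <;> ring_nf <;> simp
  down a := by
    rw [adMap_lower5, comp5V8_apply, comp5V8_apply]
    ext i j
    fin_cases i <;> fin_cases j <;> simp [sl2Down] <;> ring
  eq_zero a ha := by
    rw [comp5V8_apply]
    ext i j
    fin_cases i <;> fin_cases j <;> simp [ha]

lemma isSl2Chain_comp3V2 : IsSl2Chain raise3 lower3 2 comp3V2 where
  up a := by
    rw [adMap_raise3, comp3V2_apply, comp3V2_apply]
    ext i j
    fin_cases i <;> fin_cases j <;> simp [sl2Up] <;> ring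
  down a := by
    rw [adMap_lower3, comp3V2_apply, comp3V2_apply]
    ext i j
    fin_cases i <;> fin_cases j <;> simp [sl2Down]
  eq_zero a ha := by
    rw [comp3V2_apply]
    ext i j
    fin_cases i <;> fin_cases j <;> simp [ha]

lemma isSl2Chain_comp3V4 : IsSl2Chain raise3 lower3 4 comp3V4 where
  up a := by
    rw [adMap_raise3, comp3V4_apply, comp3V4_apply]
    ext i j
    fin_cases i <;> fin_cases j <;> simp [sl2Up] <;> ring_nf <;> simp
  down a := by
    rw [adMap_lower3, comp3V4_apply, comp3V4_apply]
    ext i j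
    fin_cases i <;> fin_cases j <;> simp [sl2Down] <;> ring
  eq_zero a ha := by
    rw [comp3V4_apply]
    ext i j
    fin_cases i <;> fin_cases j <;> simp [ha]

set_option maxHeartbeats 1000000 in
lemma exists_eq_sum_comp5 {A : Matrix (Fin 5) (Fin 5) ℝ} (hA : A.trace = 0) :
    ∃ a2 a4 a6 a8, A = comp5V2 a2 + comp5V4 a4 + comp5V6 a6 + comp5V8 a8 := by
  -- The coordinates solve the linear system diagonal by diagonal, since the entries on one diagonal
  -- have one weight. Values beyond the highest weight are irrelevant and set to 0.
  refine ⟨(fun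
      | 0 => 1/5 * A 0 1 + 3/20 * A 1 2 + 1/10 * A 2 3 + 1/20 * A 3 4
      | 1 => -1/10 * A 0 0 - 1/20 * A 1 1 + 1/20 * A 3 3 + 1/10 * A 4 4
      | 2 => -1/20 * A 1 0 - 1/10 * A 2 1 - 3/20 * A 3 2 - 1/5 * A 4 3
      | _ => 0), (fun
      | 0 => 2/7 * A 0 2 + 1/7 * A 1 3 + 1/21 * A 2 4
      | 1 => -1/7 * A 0 1 - 1/28 * A 1 2 + 1/42 * A 2 3 + 1/28 * A 3 4
      | 2 => 1/21 * A 0 0 - 1/42 * A 1 1 - 1/21 * A 2 2 - 1/42 * A 3 3 + 1/21 * A 4 4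
      | 3 => 1/28 * A 1 0 + 1/42 * A 2 1 - 1/28 * A 3 2 - 1/7 * A 4 3
      | 4 => 1/21 * A 2 0 + 1/7 * A 3 1 + 2/7 * A 4 2
      | _ => 0), (fun
      | 0 => 1/2 * A 0 3 + 1/8 * A 1 4
      | 1 => -1/4 * A 0 2 + 1/24 * A 2 4
      | 2 => 1/10 * A 0 1 - 1/20 * A 1 2 - 1/30 * A 2 3 + 1/40 * A 3 4
      | 3 => -1/40 * A 0 0 + 1/20 * A 1 1 - 1/20 * A 3 3 + 1/40 * A 4 4
      | 4 => -1/40 * A 1 0 + 1/30 * A 2 1 + 1/20 * A 3 2 - 1/10 * A 4 3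
      | 5 => -1/24 * A 2 0 + 1/4 * A 4 2
      | 6 => -1/8 * A 3 0 - 1/2 * A 4 1
      | _ => 0), (fun
      | 0 => A 0 4
      | 1 => -1/2 * A 0 3 + 1/8 * A 1 4
      | 2 => 3/14 * A 0 2 - 1/7 * A 1 3 + 1/28 * A 2 4
      | 3 => -1/14 * A 0 1 + 3/28 * A 1 2 - 1/14 * A 2 3 + 1/56 * A 3 4
      | 4 => 1/70 * A 0 0 - 2/35 * A 1 1 + 3/35 * A 2 2 - 2/35 * A 3 3 + 1/70 * A 4 4
      | 5 => 1/56 * A 1 0 - 1/14 * A 2 1 + 3/28 * A 3 2 - 1/14 * A 4 3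
      | 6 => 1/28 * A 2 0 - 1/7 * A 3 1 + 3/14 * A 4 2
      | 7 => 1/8 * A 3 0 - 1/2 * A 4 1
      | 8 => A 4 0
      | _ => 0), ?_⟩
  have h : A 4 4 = -A 0 0 - A 1 1 - A 2 2 - A 3 3 := by
    simp only [Matrix.trace, Matrix.diag, Fin.sum_univ_five] at hA
    linarith
  simp only [comp5V2_apply, comp5V4_apply, comp5V6_apply, comp5V8_apply]
  ext i j
  fin_cases i <;> fin_cases j <;> simp [h] <;> ring

lemma exists_eq_sum_comp3 {A : Matrix (Fin 3) (Fin 3) ℝ} (hA : A.trace = 0) :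
    ∃ a2 a4, A = comp3V2 a2 + comp3V4 a4 := by
  refine ⟨(fun
      | 0 => 1/2 * A 0 1 + 1/4 * A 1 2
      | 1 => -1/4 * A 0 0 + 1/4 * A 2 2
      | 2 => -1/4 * A 1 0 - 1/2 * A 2 1
      | _ => 0), (fun
      | 0 => A 0 2
      | 1 => -1/2 * A 0 1 + 1/4 * A 1 2
      | 2 => 1/6 * A 0 0 - 1/3 * A 1 1 + 1/6 * A 2 2
      | 3 => 1/4 * A 1 0 - 1/2 * A 2 1
      | 4 => A 2 0
      | _ => 0), ?_⟩
  have h : A 2 2 = -A 0 0 - A 1 1 := by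
    simp only [Matrix.trace, Matrix.diag, Fin.sum_univ_three] at hA
    linarith
  simp only [comp3V2_apply, comp3V4_apply]
  ext i j
  fin_cases i <;> fin_cases j <;> simp [h] <;> ring

lemma trace_comp5V2 (a : ℕ → ℝ) : (comp5V2 a).trace = 0 := by
  rw [comp5V2_apply, Matrix.trace, Fin.sum_univ_five]
  simp

lemma trace_comp5V4 (a : ℕ → ℝ) : (comp5V4 a).trace = 0 := by
  rw [comp5V4_apply, Matrix.trace, Fin.sum_univ_five]
  simp
  ring

lemma trace_comp5V6 (a : ℕ → ℝ) : (comp5V6 a).trace = 0 := by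
  rw [comp5V6_apply, Matrix.trace, Fin.sum_univ_five]
  simp

lemma trace_comp3V2 (a : ℕ → ℝ) : (comp3V2 a).trace = 0 := by
  rw [comp3V2_apply, Matrix.trace, Fin.sum_univ_three]
  simp

lemma trace_comp3V4 (a : ℕ → ℝ) : (comp3V4 a).trace = 0 := by
  rw [comp3V4_apply, Matrix.trace, Fin.sum_univ_three]
  simp
  ring

end Components

/-! ### Subalgebras of sl(5) × sl(3) that contain the diagonal `sl₂` -/

section Classification

/-- The algebra in which `sl(5) × sl(3)` lives. -/
abbrev MatPair : Type := Matrix (Fin 5) (Fin 5) ℝ × Matrix (Fin 3) (Fin 3) ℝ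

lemma adMap_prod {M M' : Type*} [Ring M] [Algebra ℝ M] [Ring M'] [Algebra ℝ M'] (X : M × M')
    (x : M × M') : adMap X x = (adMap X.1 x.1, adMap X.2 x.2) := by
  simp only [adMap_apply]
  rfl

lemma IsSl2Chain.inl {M M' W : Type*} [Ring M] [Algebra ℝ M] [Ring M'] [Algebra ℝ M']
    [AddCommGroup W] [Module ℝ W] {E F : M} {k : ℕ} {T : (ℕ → W) →ₗ[ℝ] M}
    (h : IsSl2Chain E F k T) (E' F' : M') :
    IsSl2Chain (E, E') (F, F') k (LinearMap.inl ℝ M M' ∘ₗ T) where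
  up a := by simp [adMap_prod, h.up]
  down a := by simp [adMap_prod, h.down]
  eq_zero a ha := by simp [h.eq_zero a ha]

lemma IsSl2Chain.inr {M M' W : Type*} [Ring M] [Algebra ℝ M] [Ring M'] [Algebra ℝ M']
    [AddCommGroup W] [Module ℝ W] {E F : M} {k : ℕ} {T : (ℕ → W) →ₗ[ℝ] M}
    (h : IsSl2Chain E F k T) (E' F' : M') :
    IsSl2Chain (E', E) (F', F) k (LinearMap.inr ℝ M' M ∘ₗ T) where
  up a := by simp [adMap_prod, h.up]
  down a := by simp [adMap_prod, h.down]
  eq_zero a ha := by simp [h.eq_zero a ha]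

/-- Two chains of the same highest weight, in the two factors of a product. -/
def chainProd {M M' : Type*} [Ring M] [Algebra ℝ M] [Ring M'] [Algebra ℝ M']
    (T : (ℕ → ℝ) →ₗ[ℝ] M) (T' : (ℕ → ℝ) →ₗ[ℝ] M') : (ℕ → ℝ × ℝ) →ₗ[ℝ] M × M' :=
  (T ∘ₗ (LinearMap.fst ℝ ℝ ℝ).compLeft ℕ).prod (T' ∘ₗ (LinearMap.snd ℝ ℝ ℝ).compLeft ℕ)

lemma chainProd_apply {M M' : Type*} [Ring M] [Algebra ℝ M] [Ring M'] [Algebra ℝ M']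
    (T : (ℕ → ℝ) →ₗ[ℝ] M) (T' : (ℕ → ℝ) →ₗ[ℝ] M') (a : ℕ → ℝ × ℝ) :
    chainProd T T' a = (T fun j => (a j).1, T' fun j => (a j).2) := rfl

lemma IsSl2Chain.prod {M M' : Type*} [Ring M] [Algebra ℝ M] [Ring M'] [Algebra ℝ M']
    {E F : M} {E' F' : M'} {k : ℕ} {T : (ℕ → ℝ) →ₗ[ℝ] M} {T' : (ℕ → ℝ) →ₗ[ℝ] M'}
    (h : IsSl2Chain E F k T) (h' : IsSl2Chain E' F' k T') :
    IsSl2Chain (E, E') (F, F') k (chainProd T T') where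
  up a := by
    simp only [adMap_prod, chainProd_apply, h.up, h'.up]
    rfl
  down a := by
    simp only [adMap_prod, chainProd_apply, h.down, h'.down]
    rfl
  eq_zero a ha := by
    rw [chainProd_apply, h.eq_zero _ fun j hj => by rw [ha j hj]; rfl,
      h'.eq_zero _ fun j hj => by rw [ha j hj]; rfl]
    rfl

lemma raise5_eq : raise5 = comp5V2 (Pi.single 0 1) := by
  rw [raise5, comp5V2_apply]
  ext i j
  fin_cases i <;> fin_cases j <;> simp

/-- The chain that starts at the raising operator E continues with [F, E] = -H and [F, -H]/2 = -F,
whence the sign. -/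
lemma lower5_eq : lower5 = comp5V2 (Pi.single 2 (-1)) := by
  rw [lower5, comp5V2_apply]
  ext i j
  fin_cases i <;> fin_cases j <;> simp

lemma raise3_eq : raise3 = comp3V2 (Pi.single 0 1) := by
  rw [raise3, comp3V2_apply]
  ext i j
  fin_cases i <;> fin_cases j <;> simp

lemma lower3_eq : lower3 = comp3V2 (Pi.single 2 (-1)) := by
  rw [lower3, comp3V2_apply]
  ext i j
  fin_cases i <;> fin_cases j <;> simp

/-- Bracketing a highest with a lowest weight vector gives weight 0. The exterior square of V(8)
meets sl(5) only in V(2) and V(6), and what matters here is that both coefficients are nonzero. -/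
lemma commutator_comp5V8 : comp5V8 (Pi.single 0 1) * comp5V8 (Pi.single 8 1) -
    comp5V8 (Pi.single 8 1) * comp5V8 (Pi.single 0 1) =
    comp5V2 (Pi.single 1 (-1 / 5)) + comp5V6 (Pi.single 3 (-1 / 20)) := by
  simp only [comp5V8_apply, comp5V2_apply, comp5V6_apply]
  ext i j
  rw [Matrix.sub_apply, Matrix.mul_apply, Matrix.mul_apply, Fin.sum_univ_five, Fin.sum_univ_five]
  fin_cases i <;> fin_cases j <;> simp <;> norm_num

lemma commutator_comp5V6 : comp5V6 (Pi.single 0 1) * comp5V6 (Pi.single 6 1) -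
    comp5V6 (Pi.single 6 1) * comp5V6 (Pi.single 0 1) =
    comp5V2 (Pi.single 1 (6 / 5)) + comp5V6 (Pi.single 3 (-1 / 5)) := by
  simp only [comp5V2_apply, comp5V6_apply]
  ext i j
  rw [Matrix.sub_apply, Matrix.mul_apply, Matrix.mul_apply, Fin.sum_univ_five, Fin.sum_univ_five]
  fin_cases i <;> fin_cases j <;> simp <;> norm_num

lemma commutator_comp5V4 : comp5V4 (Pi.single 0 1) * comp5V4 (Pi.single 4 1) -
    comp5V4 (Pi.single 4 1) * comp5V4 (Pi.single 0 1) =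
    comp5V2 (Pi.single 1 (-21 / 10)) + comp5V6 (Pi.single 3 (3 / 5)) := by
  simp only [comp5V2_apply, comp5V4_apply, comp5V6_apply]
  ext i j
  rw [Matrix.sub_apply, Matrix.mul_apply, Matrix.mul_apply, Fin.sum_univ_five, Fin.sum_univ_five]
  fin_cases i <;> fin_cases j <;> simp <;> norm_num

/-- The weights 6 and -2 add up to 4. The nonzero component in V(4) shows that V(6) and V(8)
together force V(4). -/
lemma commutator_comp5V6_comp5V8 : comp5V6 (Pi.single 0 1) * comp5V8 (Pi.single 5 1) -
    comp5V8 (Pi.single 5 1) * comp5V6 (Pi.single 0 1) =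
    comp5V4 (Pi.single 0 (8 / 7)) + comp5V8 (Pi.single 2 (20 / 7)) := by
  simp only [comp5V8_apply, comp5V4_apply, comp5V6_apply]
  ext i j
  rw [Matrix.sub_apply, Matrix.mul_apply, Matrix.mul_apply, Fin.sum_univ_five, Fin.sum_univ_five]
  fin_cases i <;> fin_cases j <;> simp <;> norm_num

/-- The weights 4 and 4 add up to 8, which occurs in sl(5) only as the highest weight of V(8). -/
lemma commutator_comp5V4_comp5V6 : comp5V4 (Pi.single 0 1) * comp5V6 (Pi.single 1 1) -
    comp5V6 (Pi.single 1 1) * comp5V4 (Pi.single 0 1) = comp5V8 (Pi.single 0 24) := by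
  simp only [comp5V8_apply, comp5V4_apply, comp5V6_apply]
  ext i j
  rw [Matrix.sub_apply, Matrix.mul_apply, Matrix.mul_apply, Fin.sum_univ_five, Fin.sum_univ_five]
  fin_cases i <;> fin_cases j <;> simp
  norm_num

lemma commutator_comp3V4 : comp3V4 (Pi.single 0 1) * comp3V4 (Pi.single 4 1) -
    comp3V4 (Pi.single 4 1) * comp3V4 (Pi.single 0 1) = comp3V2 (Pi.single 1 (-1 / 2)) := by
  simp only [comp3V2_apply, comp3V4_apply]
  ext i j
  rw [Matrix.sub_apply, Matrix.mul_apply, Matrix.mul_apply, Fin.sum_univ_three,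
    Fin.sum_univ_three]
  fin_cases i <;> fin_cases j <;> simp <;> norm_num

lemma comp5V2_single_one_ne_zero {c : ℝ} (hc : c ≠ 0) : comp5V2 (Pi.single 1 c) ≠ 0 := fun h => by
  simpa [comp5V2_apply, hc] using congrFun (congrFun h 0) 0

lemma comp5V4_single_zero_ne_zero {c : ℝ} (hc : c ≠ 0) : comp5V4 (Pi.single 0 c) ≠ 0 := fun h => by
  simpa [comp5V4_apply, hc] using congrFun (congrFun h 0) 2

lemma comp5V6_single_three_ne_zero {c : ℝ} (hc : c ≠ 0) : comp5V6 (Pi.single 3 c) ≠ 0 :=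
  fun h => by
  simpa [comp5V6_apply, hc] using congrFun (congrFun h 0) 0

lemma comp5V8_single_zero_ne_zero {c : ℝ} (hc : c ≠ 0) : comp5V8 (Pi.single 0 c) ≠ 0 := fun h => by
  simpa [comp5V8_apply, hc] using congrFun (congrFun h 0) 4

lemma comp3V2_single_one_ne_zero {c : ℝ} (hc : c ≠ 0) : comp3V2 (Pi.single 1 c) ≠ 0 := fun h => by
  simpa [comp3V2_apply, hc] using congrFun (congrFun h 0) 0

/-- The Lie algebra `sl(n)`. -/
def slAlg (n : ℕ) : Submodule ℝ (Matrix (Fin n) (Fin n) ℝ) :=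
  LinearMap.ker (Matrix.traceLinearMap (Fin n) ℝ ℝ)

lemma mem_slAlg {n : ℕ} {A : Matrix (Fin n) (Fin n) ℝ} : A ∈ slAlg n ↔ A.trace = 0 := Iff.rfl

/-- The image of `sl₂` in `sl(5)`. -/
def sl2In5 : Submodule ℝ (Matrix (Fin 5) (Fin 5) ℝ) := comp5V2.range

/-- The image of `sl₂` in `sl(3)`. -/
def sl2In3 : Submodule ℝ (Matrix (Fin 3) (Fin 3) ℝ) := comp3V2.range

/-- The orthogonal Lie algebra in `sl(5)` that contains the image of `sl₂`. -/
def soIn5 : Submodule ℝ (Matrix (Fin 5) (Fin 5) ℝ) := comp5V2.range ⊔ comp5V6.range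

/-- The image of `sl₂` in `sl(5) × sl(3)`. -/
def sl2Diag : Submodule ℝ MatPair := (comp5V2.prod comp3V2).range

/-- The four isotypic parts have distinct Casimir eigenvalues 4, 12, 24, 40. V(2) and V(4) occur in
both factors and cannot be separated by the diagonal `sl₂`, so their two copies stay paired. -/
lemma comp_mem_of_sum_mem {N : Submodule ℝ MatPair}
    (hE : ∀ x ∈ N, adMap ((raise5, raise3) : MatPair) x ∈ N)
    (hF : ∀ x ∈ N, adMap ((lower5, lower3) : MatPair) x ∈ N) {a b c d a' b' : ℕ → ℝ}
    (h : (comp5V2 a + comp5V4 b + comp5V6 c + comp5V8 d, comp3V2 a' + comp3V4 b') ∈ N) :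
    (comp5V2 a, comp3V2 a') ∈ N ∧ (comp5V4 b, comp3V4 b') ∈ N ∧ (comp5V6 c, 0) ∈ N ∧
      (comp5V8 d, 0) ∈ N := by
  have key := mem_of_sum_mem_of_eigenvector (fun x hx => casimirMap_mem hE hF hx)
    -- The i-th part has highest weight k = 2i+2 and eigenvalue k(k+2)/2. The difference of two of
    -- these is 2(i-j)(i+j+3).
    (c := fun i : Fin 4 => ((2 * i + 2 : ℝ) * ((2 * i + 2 : ℝ) + 2)) / 2) (fun i j hij => by
      have h1 : ((i : ℝ) - j) * (i + j + 3) = 0 := by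
        simp only at hij
        linarith
      rcases mul_eq_zero.1 h1 with h2 | h2
      · exact Fin.ext (by exact_mod_cast sub_eq_zero.1 h2)
      · have : (0 : ℝ) ≤ (i : ℝ) := by positivity
        have : (0 : ℝ) ≤ (j : ℝ) := by positivity
        linarith) Finset.univ
    ![(comp5V2 a, comp3V2 a'), (comp5V4 b, comp3V4 b'), (comp5V6 c, 0), (comp5V8 d, 0)]
    (fun i => by
      fin_cases i
      · have := (isSl2Chain_comp5V2.prod isSl2Chain_comp3V2).casimir fun j => (a j, a' j)
        rw [chainProd_apply] at this
        norm_num at this ⊢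
        exact this
      · have := (isSl2Chain_comp5V4.prod isSl2Chain_comp3V4).casimir fun j => (b j, b' j)
        rw [chainProd_apply] at this
        norm_num at this ⊢
        exact this
      · have := (isSl2Chain_comp5V6.inl raise3 lower3).casimir c
        norm_num at this ⊢
        exact this
      · have := (isSl2Chain_comp5V8.inl raise3 lower3).casimir d
        norm_num at this ⊢
        exact this)
    (by
      simp only [Fin.sum_univ_four]
      convert h using 1
      simp)
  exact ⟨key 0 (Finset.mem_univ _), key 1 (Finset.mem_univ _), key 2 (Finset.mem_univ _),
    key 3 (Finset.mem_univ _)⟩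

lemma casimirMap_prod_zero {M M' : Type*} [Ring M] [Algebra ℝ M] [Ring M'] [Algebra ℝ M']
    (E F : M) (x : M × M') :
    casimirMap ((E, 0) : M × M') (F, 0) x = (casimirMap E F x.1, 0) := by
  ext <;> simp [casimirMap, adMap]

lemma eq_prod_of_mem {M M' : Type*} [AddCommGroup M] [Module ℝ M] [AddCommGroup M'] [Module ℝ M']
    {N : Submodule ℝ (M × M')} {P : Submodule ℝ M} {Q : Submodule ℝ M'}
    (hP : ∀ A ∈ P, (A, 0) ∈ N) (hQ : ∀ B ∈ Q, (0, B) ∈ N)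
    (hN : ∀ x ∈ N, x.1 ∈ P ∧ x.2 ∈ Q) : N = P.prod Q := by
  refine le_antisymm (fun x hx => hN x hx) fun x hx => ?_
  have := N.add_mem (hP _ hx.1) (hQ _ hx.2)
  simpa using this

/-- Unless N is the diagonal, it contains both copies of V(2) separately. Then `sl₂ × 0` acts on N
and separates the two factors, so N is a product. In sl(3) the only choice is whether V(4) occurs.
In sl(5), V(8) forces everything and V(4) forces V(6), hence V(8), so short of sl(5) only V(2) or
V(2) + V(6) remain. -/
lemma eq_of_commutator_mem {N : Submodule ℝ MatPair} (hdiag : sl2Diag ≤ N)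
    (hsl : N ≤ (slAlg 5).prod (slAlg 3)) (hbr : ∀ x ∈ N, ∀ y ∈ N, x * y - y * x ∈ N) :
    N = sl2Diag ∨ N = sl2In5.prod sl2In3 ∨ N = sl2In5.prod (slAlg 3) ∨ N = soIn5.prod sl2In3 ∨
      N = soIn5.prod (slAlg 3) ∨ N = (slAlg 5).prod sl2In3 ∨ N = (slAlg 5).prod (slAlg 3) := by
  have hE : ∀ x ∈ N, adMap ((raise5, raise3) : MatPair) x ∈ N := fun x hx => by
    rw [adMap_apply]
    exact hbr _ (hdiag ⟨Pi.single 0 1, by simp [raise5_eq, raise3_eq]⟩) _ hx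
  have hF : ∀ x ∈ N, adMap ((lower5, lower3) : MatPair) x ∈ N := fun x hx => by
    rw [adMap_apply]
    exact hbr _ (hdiag ⟨Pi.single 2 (-1), by simp [lower5_eq, lower3_eq]⟩) _ hx
  have hsep : ∀ {a b c d a' b' : ℕ → ℝ}, (comp5V2 a + comp5V4 b + comp5V6 c + comp5V8 d,
      comp3V2 a' + comp3V4 b') ∈ N → _ := fun h => comp_mem_of_sum_mem hE hF h
  have irr5 : ∀ {k : ℕ} {T : (ℕ → ℝ) →ₗ[ℝ] Matrix (Fin 5) (Fin 5) ℝ},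
      IsSl2Chain raise5 lower5 k T → ∀ {a}, (T a, 0) ∈ N → T a ≠ 0 → ∀ b, (T b, 0) ∈ N := by
    intro k T hT a ha hne b
    exact (hT.inl raise3 lower3).mem_of_ne_zero hE hF (a := a) ha
      (fun h => hne (congrArg Prod.fst h)) b
  have irr3 : ∀ {k : ℕ} {T : (ℕ → ℝ) →ₗ[ℝ] Matrix (Fin 3) (Fin 3) ℝ},
      IsSl2Chain raise3 lower3 k T → ∀ {a}, (0, T a) ∈ N → T a ≠ 0 → ∀ b, (0, T b) ∈ N := by
    intro k T hT a ha hne b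
    exact (hT.inr raise5 lower5).mem_of_ne_zero hE hF (a := a) ha
      (fun h => hne (congrArg Prod.snd h)) b
  have br5 : ∀ {A B : Matrix (Fin 5) (Fin 5) ℝ}, (A, 0) ∈ N → (B, 0) ∈ N →
      (A * B - B * A, 0) ∈ N := fun hA hB => by simpa using hbr _ hA _ hB
  have h2 : ∀ a, (comp5V2 a, comp3V2 a) ∈ N := fun a => hdiag ⟨a, rfl⟩
  have h82 : (∀ a, (comp5V8 a, 0) ∈ N) → (∀ a, (comp5V2 a, 0) ∈ N) ∧ ∀ a, (comp5V6 a, 0) ∈ N := by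
    intro h
    have := br5 (h (Pi.single 0 1)) (h (Pi.single 8 1))
    rw [commutator_comp5V8] at this
    obtain ⟨k2, -, k6, -⟩ := hsep (b := 0) (d := 0) (a' := 0) (b' := 0) (by simpa using this)
    exact ⟨irr5 isSl2Chain_comp5V2 (by simpa using k2) (comp5V2_single_one_ne_zero (by norm_num)),
      irr5 isSl2Chain_comp5V6 k6 (comp5V6_single_three_ne_zero (by norm_num))⟩
  have h62 : (∀ a, (comp5V6 a, 0) ∈ N) → ∀ a, (comp5V2 a, 0) ∈ N := by
    intro h
    have := br5 (h (Pi.single 0 1)) (h (Pi.single 6 1))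
    rw [commutator_comp5V6] at this
    obtain ⟨k2, -, k6, -⟩ := hsep (b := 0) (d := 0) (a' := 0) (b' := 0) (by simpa using this)
    exact irr5 isSl2Chain_comp5V2 (by simpa using k2) (comp5V2_single_one_ne_zero (by norm_num))
  have h46 : (∀ a, (comp5V4 a, 0) ∈ N) → ∀ a, (comp5V6 a, 0) ∈ N := by
    intro h
    have := br5 (h (Pi.single 0 1)) (h (Pi.single 4 1))
    rw [commutator_comp5V4] at this
    obtain ⟨-, -, k6, -⟩ := hsep (b := 0) (d := 0) (a' := 0) (b' := 0) (by simpa using this)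
    exact irr5 isSl2Chain_comp5V6 k6 (comp5V6_single_three_ne_zero (by norm_num))
  have h468 : (∀ a, (comp5V4 a, 0) ∈ N) → (∀ a, (comp5V6 a, 0) ∈ N) →
      ∀ a, (comp5V8 a, 0) ∈ N := by
    intro h h'
    have := br5 (h (Pi.single 0 1)) (h' (Pi.single 1 1))
    rw [commutator_comp5V4_comp5V6] at this
    exact irr5 isSl2Chain_comp5V8 this (comp5V8_single_zero_ne_zero (by norm_num))
  have h684 : (∀ a, (comp5V6 a, 0) ∈ N) → (∀ a, (comp5V8 a, 0) ∈ N) →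
      ∀ a, (comp5V4 a, 0) ∈ N := by
    intro h h'
    have := br5 (h (Pi.single 0 1)) (h' (Pi.single 5 1))
    rw [commutator_comp5V6_comp5V8] at this
    obtain ⟨-, k4, -, -⟩ := hsep (a := 0) (c := 0) (a' := 0) (b' := 0) (by simpa using this)
    exact irr5 isSl2Chain_comp5V4 (by simpa using k4) (comp5V4_single_zero_ne_zero (by norm_num))
  have hprod : (∀ a, (0, comp3V2 a) ∈ N) → ∀ a, (comp5V2 a, 0) ∈ N := fun h a => by
    simpa using N.sub_mem (h2 a) (h a)
  have hdec : ∀ x ∈ N, ∃ a b c d a' b', x = (comp5V2 a + comp5V4 b + comp5V6 c + comp5V8 d,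
      comp3V2 a' + comp3V4 b') := by
    intro x hx
    obtain ⟨a, b, c, d, e⟩ := exists_eq_sum_comp5 (hsl hx).1
    obtain ⟨a', b', e'⟩ := exists_eq_sum_comp3 (hsl hx).2
    exact ⟨a, b, c, d, a', b', Prod.ext e e'⟩
  rcases eq_or_ne N sl2Diag with h | hne
  · exact Or.inl h
  right
  -- An element outside the diagonal has a nonzero part in V(8), in V(6), in the doubled V(4), or a
  -- V(2) part off the diagonal. Each possibility produces V(2) in sl(5).
  have s1 : ∀ a, (comp5V2 a, 0) ∈ N := by
    obtain ⟨x, hx, hxd⟩ := SetLike.exists_of_lt (lt_of_le_of_ne hdiag hne.symm)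
    obtain ⟨a, b, c, d, a', b', rfl⟩ := hdec x hx
    obtain ⟨k2, k4, k6, k8⟩ := hsep hx
    by_cases e8 : comp5V8 d = 0
    swap
    · exact (h82 (irr5 isSl2Chain_comp5V8 k8 e8)).1
    by_cases e6 : comp5V6 c = 0
    swap
    · exact h62 (irr5 isSl2Chain_comp5V6 k6 e6)
    by_cases e4 : ((comp5V4 b, comp3V4 b') : MatPair) = 0
    swap
    -- The doubled V(4) contributes some copy (u, v) ⊗ V(4), possibly a skew one. The bracket of its
    -- extreme weight vectors has parts proportional to u² in sl(5) and v² in sl(3).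
    · obtain ⟨⟨u, v⟩, hw, hwN⟩ := (isSl2Chain_comp5V4.prod isSl2Chain_comp3V4).exists_forall_mem
        hE hF (a := fun j => (b j, b' j)) k4 e4
      have hmem : ∀ n, (u • comp5V4 (Pi.single n 1), v • comp3V4 (Pi.single n 1)) ∈ N := by
        intro n
        have := hwN (Pi.single n 1)
        rw [chainProd_apply] at this
        convert this using 2 <;> rw [← map_smul] <;> congr 1 <;> funext j <;> simp [mul_comm]
      have hb := hbr _ (hmem 0) _ (hmem 4)
      have e : ((u • comp5V4 (Pi.single 0 1), v • comp3V4 (Pi.single 0 1)) : MatPair) *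
          (u • comp5V4 (Pi.single 4 1), v • comp3V4 (Pi.single 4 1)) -
          (u • comp5V4 (Pi.single 4 1), v • comp3V4 (Pi.single 4 1)) *
          (u • comp5V4 (Pi.single 0 1), v • comp3V4 (Pi.single 0 1)) =
          (comp5V2 ((u * u) • Pi.single 1 (-21 / 10)) + comp5V4 0 +
            comp5V6 ((u * u) • Pi.single 3 (3 / 5)) + comp5V8 0,
            comp3V2 ((v * v) • Pi.single 1 (-1 / 2)) + comp3V4 0) := by
        ext1
        · simp only [Prod.fst_sub, Prod.fst_mul, smul_mul_smul_comm, ← smul_sub,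
            commutator_comp5V4, map_smul, map_zero, smul_add, add_zero]
        · simp only [Prod.snd_sub, Prod.snd_mul, smul_mul_smul_comm, ← smul_sub,
            commutator_comp3V4, map_smul, map_zero, add_zero]
      rw [e] at hb
      obtain ⟨l2, -, l6, -⟩ := hsep hb
      -- If u ≠ 0, the V(6) part is nonzero and lies in sl(5) alone. If u = 0, the bracket lies in
      -- V(2) of sl(3), and subtracting from the diagonal gives V(2) in sl(5).
      by_cases hu : u = 0
      · have hv : v ≠ 0 := fun hv => hw (by rw [hu, hv]; rfl)
        refine hprod (irr3 isSl2Chain_comp3V2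
          (a := (v * v) • Pi.single 1 (-1 / 2)) (by simpa [hu] using l2) ?_)
        rw [map_smul]
        exact smul_ne_zero (mul_ne_zero hv hv) (comp3V2_single_one_ne_zero (by norm_num))
      · refine h62 (irr5 isSl2Chain_comp5V6 l6 ?_)
        rw [map_smul]
        exact smul_ne_zero (mul_ne_zero hu hu) (comp5V6_single_three_ne_zero (by norm_num))
    rw [Prod.mk_eq_zero] at e4
    have l2 : (0, comp3V2 (a' - a)) ∈ N := by simpa using N.sub_mem k2 (h2 a)
    refine hprod (irr3 isSl2Chain_comp3V2 l2 fun e2 => hxd ⟨a, ?_⟩)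
    rw [map_sub, sub_eq_zero] at e2
    simp [e8, e6, e4.1, e4.2, e2]
  have s2 : ∀ a, (0, comp3V2 a) ∈ N := fun a => by simpa using N.sub_mem (h2 a) (s1 a)
  have hE1 : ∀ x ∈ N, adMap ((raise5, 0) : MatPair) x ∈ N := fun x hx => by
    rw [adMap_apply, raise5_eq]
    exact hbr _ (s1 _) _ hx
  have hF1 : ∀ x ∈ N, adMap ((lower5, 0) : MatPair) x ∈ N := fun x hx => by
    rw [adMap_apply, lower5_eq]
    exact hbr _ (s1 _) _ hx
  -- The Casimir operator of `sl₂ × 0` is 12 on V(4) in sl(5) and 0 on sl(3), so it separates the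
  -- two copies of V(4).
  have hsplit : ∀ {a b c d a' b' : ℕ → ℝ}, (comp5V2 a + comp5V4 b + comp5V6 c + comp5V8 d,
      comp3V2 a' + comp3V4 b') ∈ N →
      (comp5V4 b, 0) ∈ N ∧ (comp5V6 c, 0) ∈ N ∧ (comp5V8 d, 0) ∈ N ∧ (0, comp3V4 b') ∈ N := by
    intro a b c d a' b' h
    obtain ⟨-, k4, k6, k8⟩ := hsep h
    have l4 : (comp5V4 b, 0) ∈ N := by
      have := casimirMap_mem hE1 hF1 k4
      rw [casimirMap_prod_zero, isSl2Chain_comp5V4.casimir,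
        show ((((4 : ℕ) : ℝ) * ((4 : ℕ) + 2) / 2) • comp5V4 b, (0 : Matrix (Fin 3) (Fin 3) ℝ)) =
          (((4 : ℕ) : ℝ) * ((4 : ℕ) + 2) / 2) • (comp5V4 b, (0 : Matrix (Fin 3) (Fin 3) ℝ)) by
        simp] at this
      exact (N.smul_mem_iff (by norm_num)).1 this
    exact ⟨l4, k6, k8, by simpa using N.sub_mem k4 l4⟩
  have right_cases : (∀ B ∈ slAlg 3, (0, B) ∈ N) ∨
      ((∀ B ∈ sl2In3, (0, B) ∈ N) ∧ ∀ x ∈ N, x.2 ∈ sl2In3) := by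
    by_cases h : ∀ a, (0, comp3V4 a) ∈ N
    · left
      intro B hB
      obtain ⟨a', b', rfl⟩ := exists_eq_sum_comp3 hB
      simpa using N.add_mem (s2 a') (h b')
    · right
      refine ⟨?_, fun x hx => ?_⟩
      · rintro _ ⟨a, rfl⟩
        exact s2 a
      · obtain ⟨a, b, c, d, a', b', rfl⟩ := hdec x hx
        have e : comp3V4 b' = 0 := by
          by_contra hne
          exact h (irr3 isSl2Chain_comp3V4 (hsplit hx).2.2.2 hne)
        exact ⟨a', by simp [e]⟩
  have left_cases : (∀ A ∈ slAlg 5, (A, 0) ∈ N) ∨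
      ((∀ A ∈ soIn5, (A, 0) ∈ N) ∧ ∀ x ∈ N, x.1 ∈ soIn5) ∨
      ((∀ A ∈ sl2In5, (A, 0) ∈ N) ∧ ∀ x ∈ N, x.1 ∈ sl2In5) := by
    by_cases h8 : ∀ a, (comp5V8 a, 0) ∈ N
    · left
      have h6 := (h82 h8).2
      have h4 := h684 h6 h8
      intro A hA
      obtain ⟨a, b, c, d, rfl⟩ := exists_eq_sum_comp5 hA
      simpa using N.add_mem (N.add_mem (N.add_mem (s1 a) (h4 b)) (h6 c)) (h8 d)
    right
    have e8 : ∀ {a b c d a' b' : ℕ → ℝ}, (comp5V2 a + comp5V4 b + comp5V6 c + comp5V8 d,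
        comp3V2 a' + comp3V4 b') ∈ N → comp5V8 d = 0 ∧ comp5V4 b = 0 := by
      intro a b c d a' b' h
      obtain ⟨k4, -, k8, -⟩ := hsplit h
      constructor
      · by_contra hne
        exact h8 (irr5 isSl2Chain_comp5V8 k8 hne)
      · by_contra hne
        have h4 := irr5 isSl2Chain_comp5V4 k4 hne
        exact h8 (h468 h4 (h46 h4))
    by_cases h6 : ∀ a, (comp5V6 a, 0) ∈ N
    · left
      refine ⟨fun A hA => ?_, fun x hx => ?_⟩
      · obtain ⟨_, ⟨a, rfl⟩, _, ⟨c, rfl⟩, rfl⟩ := Submodule.mem_sup.1 hA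
        simpa using N.add_mem (s1 a) (h6 c)
      · obtain ⟨a, b, c, d, a', b', rfl⟩ := hdec x hx
        obtain ⟨e, e'⟩ := e8 hx
        exact Submodule.mem_sup.2 ⟨_, ⟨a, rfl⟩, _, ⟨c, rfl⟩, by simp [e, e']⟩
    · right
      refine ⟨?_, fun x hx => ?_⟩
      · rintro _ ⟨a, rfl⟩
        exact s1 a
      · obtain ⟨a, b, c, d, a', b', rfl⟩ := hdec x hx
        obtain ⟨e, e'⟩ := e8 hx
        have e6 : comp5V6 c = 0 := by
          by_contra hne
          exact h6 (irr5 isSl2Chain_comp5V6 (hsplit hx).2.1 hne)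
        exact ⟨a, by simp [e, e', e6]⟩
  rcases left_cases with l | ⟨l, l'⟩ | ⟨l, l'⟩ <;> rcases right_cases with r | ⟨r, r'⟩
  · exact Or.inr (Or.inr (Or.inr (Or.inr (Or.inr (eq_prod_of_mem l r fun x hx => hsl hx)))))
  · exact Or.inr (Or.inr (Or.inr (Or.inr (Or.inl
      (eq_prod_of_mem l r fun x hx => ⟨(hsl hx).1, r' x hx⟩)))))
  · exact Or.inr (Or.inr (Or.inr (Or.inl
      (eq_prod_of_mem l r fun x hx => ⟨l' x hx, (hsl hx).2⟩))))
  · exact Or.inr (Or.inr (Or.inl (eq_prod_of_mem l r fun x hx => ⟨l' x hx, r' x hx⟩)))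
  · exact Or.inr (Or.inl (eq_prod_of_mem l r fun x hx => ⟨l' x hx, (hsl hx).2⟩))
  · exact Or.inl (eq_prod_of_mem l r fun x hx => ⟨l' x hx, r' x hx⟩)

end Classification

/-! ### The exponential map and SL(n) -/

section SpecialLinear

open NormedSpace Filter Topology

attribute [local instance] Matrix.linftyOpNormedRing Matrix.linftyOpNormedAlgebra

lemma differentiable_det (n : ℕ) :
    Differentiable ℝ (Matrix.det : Matrix (Fin n) (Fin n) ℝ → ℝ) := by
  have h : ∀ i j, Differentiable ℝ fun A : Matrix (Fin n) (Fin n) ℝ => A i j := fun i j =>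
    (LinearMap.toContinuousLinearMap (Matrix.entryLinearMap ℝ ℝ i j)).differentiable
  have e : (Matrix.det : Matrix (Fin n) (Fin n) ℝ → ℝ) =
      fun A => ∑ σ : Equiv.Perm (Fin n), (Equiv.Perm.sign σ : ℝ) * ∏ i, A (σ i) i := by
    funext A
    rw [Matrix.det_apply']
  rw [e]
  fun_prop

lemma fderiv_det_one {n : ℕ} (X : Matrix (Fin n) (Fin n) ℝ) :
    fderiv ℝ (Matrix.det : Matrix (Fin n) (Fin n) ℝ → ℝ) 1 X = X.trace := by
  have h1 : HasDerivAt (fun t : ℝ => (1 : Matrix (Fin n) (Fin n) ℝ) + t • X) X 0 := by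
    have := ((hasDerivAt_id (0 : ℝ)).smul_const X).const_add (1 : Matrix (Fin n) (Fin n) ℝ)
    rwa [one_smul] at this
  have h2 : HasFDerivAt (Matrix.det : Matrix (Fin n) (Fin n) ℝ → ℝ) (fderiv ℝ Matrix.det 1)
      (1 + (0 : ℝ) • X) := by
    simpa using (differentiable_det n 1).hasFDerivAt
  have h3 := h2.comp_hasDerivAt 0 h1
  -- The expansion det(1 + tX) = 1 + t tr X + t² q(t), with q a polynomial: the last term has
  -- derivative 0 at 0.
  have h4 : HasDerivAt (fun t : ℝ => (1 + t • X).det) X.trace 0 := by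
    have h5 := ((hasDerivAt_id (0 : ℝ)).const_mul X.trace).const_add 1
    have h6 := (((Matrix.det (1 + (Polynomial.X : Polynomial ℝ) •
      X.map Polynomial.C)).divX.divX.hasDerivAt 0)).mul ((hasDerivAt_id (0 : ℝ)).pow 2)
    have h7 := h5.add h6
    simp only [id_eq, mul_one, mul_zero, add_zero, Nat.cast_ofNat, Nat.add_one_sub_one, pow_one,
      Pi.pow_apply, zero_pow two_ne_zero] at h7
    refine h7.congr_of_eventuallyEq (Eventually.of_forall fun t => ?_)
    exact Matrix.det_one_add_smul t X
  exact h3.unique h4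

lemma hasDerivAt_det_exp_zero {n : ℕ} (X : Matrix (Fin n) (Fin n) ℝ) :
    HasDerivAt (fun t : ℝ => (exp (t • X)).det) X.trace 0 := by
  have h2 : HasFDerivAt (Matrix.det : Matrix (Fin n) (Fin n) ℝ → ℝ) (fderiv ℝ Matrix.det 1)
      (exp ((0 : ℝ) • X)) := by
    simpa using (differentiable_det n 1).hasFDerivAt
  have := h2.comp_hasDerivAt 0 (hasDerivAt_exp_smul_zero X)
  exact (fderiv_det_one X).symm ▸ this

/-- The function det exp(tX) is multiplicative in t, so its derivative at any point is a multiple of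
its derivative tr X = 0 at the origin. It is therefore constant. -/
lemma det_exp_eq_one {n : ℕ} {X : Matrix (Fin n) (Fin n) ℝ} (hX : X.trace = 0) :
    (exp X).det = 1 := by
  have hd : ∀ s : ℝ, HasDerivAt (fun t : ℝ => (exp (t • X)).det) 0 s := by
    intro s
    have h0 := hasDerivAt_det_exp_zero X
    rw [hX] at h0
    have h0' : HasDerivAt (fun t : ℝ => (exp (t • X)).det) 0 (s - s) := by rwa [sub_self]
    have h1 := (h0'.comp_sub_const s s).const_mul (exp (s • X)).det
    rw [mul_zero] at h1
    refine h1.congr_of_eventuallyEq (Eventually.of_forall fun t => ?_)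
    simp only
    have h2 : exp (t • X) = exp (s • X) * exp ((t - s) • X) := by
      have := exp_add_smul X s (t - s)
      rwa [add_sub_cancel] at this
    rw [h2, Matrix.det_mul]
  have := is_const_of_deriv_eq_zero (fun s => (hd s).differentiableAt) (fun s => (hd s).deriv) 1 0
  simpa using this

lemma lieSet_top_eq (n : ℕ) : lieSet
    (SpecialLinearGroup.coeMonoidHom : SpecialLinearGroup (Fin n) ℝ →* Matrix (Fin n) (Fin n) ℝ) ⊤ =
    slAlg n := by
  ext X
  constructor
  · intro h
    have h1 : HasDerivAt (fun t : ℝ => (exp (t • X)).det) 0 0 := by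
      refine (hasDerivAt_const (0 : ℝ) (1 : ℝ)).congr_of_eventuallyEq
        (Eventually.of_forall fun t => ?_)
      obtain ⟨g, -, hg⟩ := h t
      exact (congrArg Matrix.det hg).symm.trans g.2
    exact (hasDerivAt_det_exp_zero X).unique h1
  · intro h t
    exact ⟨⟨exp (t • X), det_exp_eq_one (by rw [trace_smul, mem_slAlg.1 h, smul_zero])⟩,
      trivial, rfl⟩

lemma exp_eq_one_add_of_sq_eq_zero {A : Type*} [NormedRing A] [NormedAlgebra ℝ A] [CompleteSpace A]
    {X : A} (hX : X * X = 0) : exp X = 1 + X := by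
  rw [exp_eq_tsum ℝ]
  simp only
  rw [tsum_eq_sum (s := Finset.range 2)]
  · simp [Finset.sum_range_succ]
  · intro n hn
    obtain ⟨m, rfl⟩ : ∃ m, n = m + 2 := ⟨n - 2, by simp at hn; omega⟩
    rw [pow_add, pow_two, hX, mul_zero, smul_zero]

/-- A transvection is the exponential of a matrix of square zero, and transvections generate SL(n).
This makes the whole group available as a group generated by exponentials without a separate
connectedness argument. -/
lemma expGroup_slAlg (n : ℕ) [Nontrivial (Fin n)] : expGroup
    (SpecialLinearGroup.coeMonoidHom : SpecialLinearGroup (Fin n) ℝ →* Matrix (Fin n) (Fin n) ℝ)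
    (slAlg n : Set (Matrix (Fin n) (Fin n) ℝ)) = ⊤ := by
  set P := expGroup (SpecialLinearGroup.coeMonoidHom :
    SpecialLinearGroup (Fin n) ℝ →* Matrix (Fin n) (Fin n) ℝ)
    (slAlg n : Set (Matrix (Fin n) (Fin n) ℝ))
  have htr : ∀ (i j : Fin n) (hij : i ≠ j) (c : ℝ),
      SpecialLinearGroup.transvection hij c ∈ P := by
    intro i j hij c
    refine mem_expGroup (X := Matrix.single i j c) ?_ ?_
    · exact mem_slAlg.2 (Matrix.trace_single_eq_of_ne i j c hij)
    · rw [exp_eq_one_add_of_sq_eq_zero (Matrix.single_mul_single_of_ne _ _ _ _ hij.symm _)]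
      rfl
  rw [eq_top_iff]
  intro g _
  refine SpecialLinearGroup.diagonal_transvection_induction' (fun g => g ∈ P) g ?_ htr
    (fun _ _ => P.mul_mem)
  intro i j hij c hc
  -- Whitehead's identity: diag(c, c⁻¹) = w(c) w(-1) with w(c) = e₁₂(c) e₂₁(-c⁻¹) e₁₂(c).
  have e : SpecialLinearGroup.diag2n hij c hc =
      SpecialLinearGroup.transvection hij c * (SpecialLinearGroup.transvection hij.symm (-c⁻¹) *
      (SpecialLinearGroup.transvection hij c * (SpecialLinearGroup.transvection hij (-1) *
      (SpecialLinearGroup.transvection hij.symm 1 *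
      (SpecialLinearGroup.transvection hij (-1) * 1))))) := by
    apply Subtype.ext
    rw [SpecialLinearGroup.diag2n_coe]
    change _ = Matrix.transvection i j c * (Matrix.transvection j i (-c⁻¹) *
      (Matrix.transvection i j c * (Matrix.transvection i j (-1) *
      (Matrix.transvection j i 1 * (Matrix.transvection i j (-1) * 1)))))
    ext a b
    by_cases hi : a = i
    · subst hi
      simp [hij, hij.symm]
      simp only [Matrix.transvection, Matrix.add_apply, one_apply, single_apply, diagonal_apply]
      grind
    by_cases hj : a = j
    · subst hj
      simp [hij, hij.symm]
      simp only [Matrix.transvection, Matrix.add_apply, one_apply, single_apply, diagonal_apply]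
      grind
    · simp [hi, hj]
      simp only [Matrix.transvection, Matrix.add_apply, one_apply, single_apply, diagonal_apply]
      grind
  rw [e]
  exact P.mul_mem (htr _ _ _ _) (P.mul_mem (htr _ _ _ _) (P.mul_mem (htr _ _ _ _)
    (P.mul_mem (htr _ _ _ _) (P.mul_mem (htr _ _ _ _) (P.mul_mem (htr _ _ _ _) P.one_mem)))))

/-- The inclusion of `SL(5) × SL(3)` into pairs of matrices. -/
def pairHom : HReal →* MatPair :=
  MonoidHom.prodMap SpecialLinearGroup.coeMonoidHom SpecialLinearGroup.coeMonoidHom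

lemma isClosedEmbedding_pairHom : IsClosedEmbedding pairHom :=
  SpecialLinearGroup.isClosedEmbedding_val.prodMap SpecialLinearGroup.isClosedEmbedding_val

lemma exp_pair (X : MatPair) : exp X = (exp X.1, exp X.2) := by
  let := NormedAlgebra.restrictScalars ℚ ℝ (Matrix (Fin 5) (Fin 5) ℝ)
  let := NormedAlgebra.restrictScalars ℚ ℝ (Matrix (Fin 3) (Fin 3) ℝ)
  exact Prod.ext (Prod.fst_exp X) (Prod.snd_exp X)

lemma expGroup_prod (L₁ : Submodule ℝ (Matrix (Fin 5) (Fin 5) ℝ))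
    (L₂ : Submodule ℝ (Matrix (Fin 3) (Fin 3) ℝ)) :
    expGroup pairHom (L₁.prod L₂ : Set MatPair) =
      (expGroup SpecialLinearGroup.coeMonoidHom (L₁ : Set (Matrix (Fin 5) (Fin 5) ℝ))).prod
      (expGroup SpecialLinearGroup.coeMonoidHom (L₂ : Set (Matrix (Fin 3) (Fin 3) ℝ))) := by
  apply le_antisymm
  · rw [expGroup, Subgroup.closure_le]
    rintro ⟨g₁, g₂⟩ ⟨X, hX, e⟩
    replace e := e.trans (exp_pair X)
    exact ⟨mem_expGroup hX.1 (congrArg Prod.fst e), mem_expGroup hX.2 (congrArg Prod.snd e)⟩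
  · rintro ⟨g₁, g₂⟩ ⟨h₁, h₂⟩
    have k₁ : expGroup SpecialLinearGroup.coeMonoidHom (L₁ : Set (Matrix (Fin 5) (Fin 5) ℝ)) ≤
        (expGroup pairHom (L₁.prod L₂ : Set MatPair)).comap (MonoidHom.inl _ _) := by
      rw [expGroup, Subgroup.closure_le]
      rintro g ⟨X, hX, e⟩
      refine mem_expGroup (X := (X, 0)) ⟨hX, L₂.zero_mem⟩ ?_
      exact (Prod.ext e exp_zero.symm).trans (exp_pair (X, 0)).symm
    have k₂ : expGroup SpecialLinearGroup.coeMonoidHom (L₂ : Set (Matrix (Fin 3) (Fin 3) ℝ)) ≤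
        (expGroup pairHom (L₁.prod L₂ : Set MatPair)).comap (MonoidHom.inr _ _) := by
      rw [expGroup, Subgroup.closure_le]
      rintro g ⟨X, hX, e⟩
      refine mem_expGroup (X := (0, X)) ⟨L₁.zero_mem, hX⟩ ?_
      exact (Prod.ext exp_zero.symm e).trans (exp_pair (0, X)).symm
    simpa using Subgroup.mul_mem _ (Subgroup.mem_comap.1 (k₁ h₁)) (Subgroup.mem_comap.1 (k₂ h₂))

end SpecialLinear

/-! ### Equivariance of the Pfaffians -/

section Equivariance

/-- The polarized signed `4 × 4` Pfaffians of two alternating matrices. -/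
def pfaffPolar (u v : Matrix (Fin 5) (Fin 5) ℝ) : Fin 5 → ℝ :=
  ![u 1 2 * v 3 4 + u 3 4 * v 1 2 - u 1 3 * v 2 4 - u 2 4 * v 1 3 + u 1 4 * v 2 3 + u 2 3 * v 1 4,
    -(u 0 2 * v 3 4 + u 3 4 * v 0 2 - u 0 3 * v 2 4 - u 2 4 * v 0 3 + u 0 4 * v 2 3 +
      u 2 3 * v 0 4),
    u 0 1 * v 3 4 + u 3 4 * v 0 1 - u 0 3 * v 1 4 - u 1 4 * v 0 3 + u 0 4 * v 1 3 + u 1 3 * v 0 4,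
    -(u 0 1 * v 2 4 + u 2 4 * v 0 1 - u 0 2 * v 1 4 - u 1 4 * v 0 2 + u 0 4 * v 1 2 +
      u 1 2 * v 0 4),
    u 0 1 * v 2 3 + u 2 3 * v 0 1 - u 0 2 * v 1 3 - u 1 3 * v 0 2 + u 0 3 * v 1 2 + u 1 2 * v 0 3]

lemma pfaff_apply (x : altTensor) (m : Fin 5) (s t : Fin 3) :
    pfaff x m s t = (1 / 2) * pfaffPolar (x.1 s) (x.1 t) m := by
  fin_cases m <;> simp [pfaff, pfaffMinor, symProd, coeffV2, vecMulVec_apply, pfaffPolar] <;> ring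

lemma phi1_apply (x : altTensor) (a : Fin 5 → ℝ) (s t : Fin 3) :
    phi1 x a s t = (1 / 2) * (a ⬝ᵥ pfaffPolar (x.1 s) (x.1 t)) := by
  simp only [phi1, LinearMap.sum_apply, LinearMap.smulRight_apply, LinearMap.proj_apply,
    Matrix.sum_apply, Matrix.smul_apply, pfaff_apply, dotProduct, Finset.mul_sum, smul_eq_mul]
  exact Finset.sum_congr rfl fun i _ => by ring

lemma transvection_conj_apply {i j : Fin 5} (c : ℝ) (u : Matrix (Fin 5) (Fin 5) ℝ) (p q : Fin 5) :
    (Matrix.transvection i j c * u * (Matrix.transvection i j c)ᵀ) p q =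
      u p q + (if p = i then c * u j q else 0) + (if q = i then c * u p j else 0) +
        (if p = i then if q = i then c * (c * u j j) else 0 else 0) := by
  have h : (Matrix.transvection i j c)ᵀ = Matrix.transvection j i c := by
    simp [Matrix.transvection]
  rw [h]
  by_cases hq : q = i
  · subst hq
    rw [mul_transvection_apply_same]
    by_cases hp : p = q
    · subst hp
      simp
      ring
    · simp [hp]
  · rw [mul_transvection_apply_of_ne _ _ _ _ hq]
    by_cases hp : p = i
    · subst hp
      simp [hq]
    · simp [hp, hq]

lemma dotProduct_pfaffPolar_transvection (t : TransvectionStruct (Fin 5) ℝ)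
    {u v : Matrix (Fin 5) (Fin 5) ℝ} (hu : uᵀ = -u) (hv : vᵀ = -v) (a : Fin 5 → ℝ) :
    (t.toMatrix *ᵥ a) ⬝ᵥ pfaffPolar (t.toMatrix * u * t.toMatrixᵀ) (t.toMatrix * v * t.toMatrixᵀ) =
      a ⬝ᵥ pfaffPolar u v := by
  obtain ⟨i, j, hij, c⟩ := t
  have anti : ∀ {u : Matrix (Fin 5) (Fin 5) ℝ}, uᵀ = -u → ∀ p q, u q p = -u p q :=
    fun h p q => congrFun (congrFun h p) q
  have diag : ∀ {u : Matrix (Fin 5) (Fin 5) ℝ}, uᵀ = -u → ∀ p, u p p = 0 :=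
    fun h p => by linarith [anti h p p]
  have e : ∀ p, (Matrix.transvection i j c *ᵥ a) p = a p + if p = i then c * a j else 0 := by
    intro p
    rw [Matrix.transvection, Matrix.add_mulVec, one_mulVec, Pi.add_apply, single_mulVec_eq]
    by_cases hp : p = i
    · subst hp; simp
    · simp [hp]
  rw [TransvectionStruct.toMatrix_mk]
  simp only [dotProduct, Fin.sum_univ_five, e, pfaffPolar, transvection_conj_apply]
  have u10 := anti hu 0 1
  have u20 := anti hu 0 2
  have u30 := anti hu 0 3
  have u21 := anti hu 1 2
  have u31 := anti hu 1 3
  have u41 := anti hu 1 4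
  have u32 := anti hu 2 3
  have u42 := anti hu 2 4
  have u43 := anti hu 3 4
  have v10 := anti hv 0 1
  have v20 := anti hv 0 2
  have v30 := anti hv 0 3
  have v21 := anti hv 1 2
  have v31 := anti hv 1 3
  have v41 := anti hv 1 4
  have v32 := anti hv 2 3
  have v42 := anti hv 2 4
  have v43 := anti hv 3 4
  fin_cases i <;> fin_cases j <;> first
    | exact absurd rfl hij
    | (simp only [Matrix.cons_val, Fin.reduceFinMk, Fin.reduceEq, Fin.isValue, if_true, if_false,
        u10, u20, u30, u21, u31, u41, u32, u42, u43, v10, v20, v30, v21, v31, v41, v32,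
        v42, v43, diag hu, diag hv]
       ring)

lemma dotProduct_pfaffPolar_diagonal (D : Fin 5 → ℝ) (u v : Matrix (Fin 5) (Fin 5) ℝ)
    (a : Fin 5 → ℝ) : (diagonal D *ᵥ a) ⬝ᵥ pfaffPolar (diagonal D * u * (diagonal D)ᵀ)
      (diagonal D * v * (diagonal D)ᵀ) = (diagonal D).det * (a ⬝ᵥ pfaffPolar u v) := by
  simp only [diagonal_transpose, pfaffPolar, Matrix.mul_diagonal, Matrix.diagonal_mul,
    Matrix.mulVec_diagonal, dotProduct, Fin.sum_univ_five, Matrix.det_diagonal,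
    Fin.prod_univ_five, Matrix.cons_val]
  ring

/-- The pairing of a with the polarized Pfaffians is the coefficient of a ∧ u ∧ v in the top
exterior power, so it scales by the determinant. The identity is multiplicative in A and is
therefore checked only on diagonal matrices and transvections. -/
lemma dotProduct_pfaffPolar (A : Matrix (Fin 5) (Fin 5) ℝ) (hA : A.det ≠ 0) :
    ∀ {u v : Matrix (Fin 5) (Fin 5) ℝ}, uᵀ = -u → vᵀ = -v → ∀ a : Fin 5 → ℝ,
    (A *ᵥ a) ⬝ᵥ pfaffPolar (A * u * Aᵀ) (A * v * Aᵀ) = A.det * (a ⬝ᵥ pfaffPolar u v) := by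
  refine diagonal_transvection_induction_of_det_ne_zero (fun A => ∀ {u v}, uᵀ = -u → vᵀ = -v →
    ∀ a : Fin 5 → ℝ, (A *ᵥ a) ⬝ᵥ pfaffPolar (A * u * Aᵀ) (A * v * Aᵀ) =
      A.det * (a ⬝ᵥ pfaffPolar u v)) A hA ?_ ?_ ?_
  · intro D _ u v _ _ a
    exact dotProduct_pfaffPolar_diagonal D u v a
  · intro t u v hu hv a
    rw [dotProduct_pfaffPolar_transvection t hu hv, TransvectionStruct.det, one_mul]
  · intro A B _ _ hA hB u v hu hv a
    have hc : ∀ {u : Matrix (Fin 5) (Fin 5) ℝ}, uᵀ = -u → (B * u * Bᵀ)ᵀ = -(B * u * Bᵀ) := by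
      intro u hu
      simp [hu, Matrix.mul_assoc]
    have e : ∀ u, A * B * u * (A * B)ᵀ = A * (B * u * Bᵀ) * Aᵀ := by
      intro u
      simp [Matrix.mul_assoc]
    rw [e, e, ← Matrix.mulVec_mulVec, hA (hc hu) (hc hv), hB hu hv, Matrix.det_mul, mul_assoc]

lemma smul_altTensor_apply (g : GReal) (x : altTensor) (k : Fin 3) :
    (g • x).1 k = ∑ j, (g.2 : Matrix (Fin 3) (Fin 3) ℝ) k j •
      ((g.1 : Matrix (Fin 5) (Fin 5) ℝ) * x.1 j * (g.1 : Matrix (Fin 5) (Fin 5) ℝ)ᵀ) := rfl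

lemma pfaffPolar_sum_smul (c d : Fin 3 → ℝ) (y : Fin 3 → Matrix (Fin 5) (Fin 5) ℝ) (m : Fin 5) :
    pfaffPolar (∑ j, c j • y j) (∑ k, d k • y k) m =
      ∑ k, (∑ j, c j * pfaffPolar (y j) (y k) m) * d k := by
  fin_cases m <;> simp [pfaffPolar, Fin.sum_univ_three] <;> ring

lemma phi1_smul (g : GReal) (x : altTensor) (a : Fin 5 → ℝ) :
    phi1 (g • x) ((g.1 : Matrix (Fin 5) (Fin 5) ℝ) *ᵥ a) =
      (g.1 : Matrix (Fin 5) (Fin 5) ℝ).det •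
        ((g.2 : Matrix (Fin 3) (Fin 3) ℝ) * phi1 x a * (g.2 : Matrix (Fin 3) (Fin 3) ℝ)ᵀ) := by
  have hdet : (g.1 : Matrix (Fin 5) (Fin 5) ℝ).det ≠ 0 :=
    ((Matrix.isUnit_iff_isUnit_det _).1 g.1.isUnit).ne_zero
  ext s t
  simp only [phi1_apply, smul_altTensor_apply, Matrix.smul_apply, Matrix.mul_apply,
    Matrix.transpose_apply, smul_eq_mul]
  simp only [dotProduct, pfaffPolar_sum_smul]
  have key := fun j k => dotProduct_pfaffPolar _ hdet (x.2 j) (x.2 k) a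
  simp only [dotProduct] at key
  simp only [mul_comm (1 / 2 : ℝ), ← mul_assoc]
  calc _ = (∑ k, (∑ j, (g.2 : Matrix (Fin 3) (Fin 3) ℝ) s j *
        ∑ i, ((g.1 : Matrix (Fin 5) (Fin 5) ℝ) *ᵥ a) i *
          pfaffPolar ((g.1 : Matrix (Fin 5) (Fin 5) ℝ) * x.1 j *
            (g.1 : Matrix (Fin 5) (Fin 5) ℝ)ᵀ)
          ((g.1 : Matrix (Fin 5) (Fin 5) ℝ) * x.1 k * (g.1 : Matrix (Fin 5) (Fin 5) ℝ)ᵀ) i) *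
          (g.2 : Matrix (Fin 3) (Fin 3) ℝ) t k) * (1 / 2) := by
        congr 1
        simp only [Finset.mul_sum, Finset.sum_mul]
        rw [Finset.sum_comm]
        refine Finset.sum_congr rfl fun k _ => ?_
        rw [Finset.sum_comm]
        exact Finset.sum_congr rfl fun j _ => Finset.sum_congr rfl fun i _ => by ring
    _ = _ := by
        simp only [key, Finset.mul_sum, Finset.sum_mul]
        exact Finset.sum_congr rfl fun k _ => Finset.sum_congr rfl fun j _ =>
          Finset.sum_congr rfl fun i _ => by ring

end Equivariance

/-! ### Equivariance of `Phi1` and `Phi2` -/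

section EquivariantForms

/-- The functional on `Sym² V₂` given by the wedge product with the five Pfaffians. -/
noncomputable def pfaffFunctional (x : altTensor) (q : Matrix (Fin 3) (Fin 3) ℝ) : ℝ :=
  Matrix.det (Matrix.of ![symCoords q, symCoords (pfaff x 0), symCoords (pfaff x 1),
    symCoords (pfaff x 2), symCoords (pfaff x 3), symCoords (pfaff x 4)])

lemma Phi1_apply (x : altTensor) (s t : Fin 3) :
    Phi1 x s t = (1 / 3 ^ 4 : ℝ) * pfaffFunctional x (symProd (Pi.single s 1) (Pi.single t 1)) :=
  rfl

/-- `symCoords` as a linear map. -/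
def symCoordsLin : Matrix (Fin 3) (Fin 3) ℝ →ₗ[ℝ] Fin 6 → ℝ where
  toFun := symCoords
  map_add' p q := by
    ext i
    fin_cases i <;> simp [symCoords] <;> ring
  map_smul' c p := by
    ext i
    fin_cases i <;> simp [symCoords] <;> ring

lemma pfaffFunctional_eq (x : altTensor) (q : Matrix (Fin 3) (Fin 3) ℝ) :
    pfaffFunctional x q =
      Matrix.det (Matrix.of (Fin.cons (symCoordsLin q) fun m => symCoordsLin (pfaff x m))) := by
  rw [pfaffFunctional]
  congr 2
  funext i
  fin_cases i <;> rfl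

lemma of_cons_eq_updateRow {n : ℕ} (r : Fin (n + 1) → ℝ) (R : Fin n → Fin (n + 1) → ℝ) :
    Matrix.of (Fin.cons r R : Fin (n + 1) → Fin (n + 1) → ℝ) =
      updateRow (Matrix.of (Fin.cons 0 R)) 0 r := by
  ext i k
  refine Fin.cases ?_ (fun i => ?_) i <;> simp

/-- `pfaffFunctional` as a linear functional. -/
noncomputable def pfaffFunctionalLin (x : altTensor) : Matrix (Fin 3) (Fin 3) ℝ →ₗ[ℝ] ℝ where
  toFun := pfaffFunctional x
  map_add' p q := by
    rw [pfaffFunctional_eq, pfaffFunctional_eq, pfaffFunctional_eq, map_add,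
      of_cons_eq_updateRow (symCoordsLin p), of_cons_eq_updateRow (symCoordsLin q),
      of_cons_eq_updateRow (symCoordsLin p + symCoordsLin q)]
    exact Matrix.det_updateRow_add _ _ _ _
  map_smul' c p := by
    rw [pfaffFunctional_eq, pfaffFunctional_eq, map_smul,
      of_cons_eq_updateRow (symCoordsLin p), of_cons_eq_updateRow (c • symCoordsLin p)]
    exact Matrix.det_updateRow_smul _ _ _ _

/-- Replacing the last n factors of a top wedge product by the combinations given by B multiplies it
by det B. In matrices this is multiplication by the block matrix 1 ⊕ B. -/
lemma det_cons_mul {n : ℕ} (B : Matrix (Fin n) (Fin n) ℝ) (r : Fin (n + 1) → ℝ)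
    (R : Fin n → Fin (n + 1) → ℝ) :
    Matrix.det (Matrix.of (Fin.cons r fun i => ∑ j, B i j • R j)) =
      B.det * Matrix.det (Matrix.of (Fin.cons r R : Fin (n + 1) → Fin (n + 1) → ℝ)) := by
  let C : Matrix (Fin (n + 1)) (Fin (n + 1)) ℝ :=
    Matrix.of (Fin.cons (Pi.single 0 1) fun i => Fin.cons 0 (B i))
  have hC : C.det = B.det := by
    rw [Matrix.det_succ_row_zero, Finset.sum_eq_single 0]
    · simp only [C, of_apply, Fin.cons_zero, Pi.single_eq_same]
      simp only [Fin.val_zero, pow_zero, one_mul]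
      congr 1
    · intro j _ hj
      simp [C, hj]
    · simp
  rw [← hC, ← Matrix.det_mul]
  congr 1
  ext i k
  rw [Matrix.mul_apply, Fin.sum_univ_succ]
  refine Fin.cases ?_ (fun i => ?_) i
  · simp [C]
  · simp [C, Finset.sum_apply]

lemma det_of_linearMap {n : ℕ} (f : (Fin n → ℝ) →ₗ[ℝ] Fin n → ℝ) (R : Fin n → Fin n → ℝ) :
    Matrix.det (Matrix.of fun i => f (R i)) = LinearMap.det f * Matrix.det (Matrix.of R) := by
  rw [← LinearMap.det_toMatrix', ← Matrix.det_transpose (LinearMap.toMatrix' f), mul_comm,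
    ← Matrix.det_mul]
  congr 1
  ext i k
  have := congrFun (LinearMap.toMatrix'_mulVec f (R i)) k
  rw [of_apply, ← this, Matrix.mul_apply, mulVec, dotProduct]
  exact Finset.sum_congr rfl fun j _ => by simp [mul_comm]

/-- The inverse of `symCoords`. -/
noncomputable def symOfCoords : (Fin 6 → ℝ) →ₗ[ℝ] Matrix (Fin 3) (Fin 3) ℝ where
  toFun v := !![v 0, v 3 / 2, v 5 / 2; v 3 / 2, v 1, v 4 / 2; v 5 / 2, v 4 / 2, v 2]
  map_add' p q := by
    ext i j
    fin_cases i <;> fin_cases j <;> simp <;> ring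
  map_smul' c p := by
    ext i j
    fin_cases i <;> fin_cases j <;> simp <;> ring

lemma symOfCoords_symCoordsLin {q : Matrix (Fin 3) (Fin 3) ℝ} (hq : qᵀ = q) :
    symOfCoords (symCoordsLin q) = q := by
  have h : ∀ i j, q i j = q j i := fun i j => congrFun (congrFun hq j) i
  have h10 := h 1 0
  have h20 := h 2 0
  have h21 := h 2 1
  ext i j
  fin_cases i <;> fin_cases j <;> simp [symOfCoords, symCoordsLin, symCoords, h10, h20, h21]

lemma symCoordsLin_symOfCoords (v : Fin 6 → ℝ) : symCoordsLin (symOfCoords v) = v := by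
  ext i
  fin_cases i <;> simp [symOfCoords, symCoordsLin, symCoords] <;> ring

lemma transpose_symOfCoords (v : Fin 6 → ℝ) : (symOfCoords v)ᵀ = symOfCoords v := by
  ext i j
  fin_cases i <;> fin_cases j <;> simp [symOfCoords]

/-- The map `q ↦ B q Bᵀ`. -/
def conjTrans (B : Matrix (Fin 3) (Fin 3) ℝ) :
    Matrix (Fin 3) (Fin 3) ℝ →ₗ[ℝ] Matrix (Fin 3) (Fin 3) ℝ :=
  LinearMap.mulRight ℝ Bᵀ ∘ₗ LinearMap.mulLeft ℝ B

lemma conjTrans_apply (B q : Matrix (Fin 3) (Fin 3) ℝ) : conjTrans B q = B * q * Bᵀ := rfl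

lemma transpose_conjTrans (B : Matrix (Fin 3) (Fin 3) ℝ) {q : Matrix (Fin 3) (Fin 3) ℝ}
    (hq : qᵀ = q) : (conjTrans B q)ᵀ = conjTrans B q := by
  simp [conjTrans_apply, hq, Matrix.mul_assoc]

/-- The action of `GL(V₂)` on `Sym² V₂` in coordinates. -/
noncomputable def symSquare (B : Matrix (Fin 3) (Fin 3) ℝ) : (Fin 6 → ℝ) →ₗ[ℝ] Fin 6 → ℝ :=
  symCoordsLin ∘ₗ conjTrans B ∘ₗ symOfCoords

lemma symSquare_symCoordsLin (B : Matrix (Fin 3) (Fin 3) ℝ) {q : Matrix (Fin 3) (Fin 3) ℝ}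
    (hq : qᵀ = q) : symSquare B (symCoordsLin q) = symCoordsLin (B * q * Bᵀ) := by
  simp [symSquare, symOfCoords_symCoordsLin hq, conjTrans_apply]

/-- The symmetric square of C is a right inverse of that of B, provided the coordinates are applied
to symmetric matrices. -/
lemma det_symSquare_ne_zero {B C : Matrix (Fin 3) (Fin 3) ℝ} (h : B * C = 1) :
    LinearMap.det (symSquare B) ≠ 0 := by
  have hcomp : symSquare B ∘ₗ symSquare C = LinearMap.id := by
    ext1 i
    ext1
    simp only [LinearMap.comp_apply, LinearMap.id_apply]
    set v : Fin 6 → ℝ := LinearMap.single ℝ (fun _ => ℝ) i 1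
    have h1 : symSquare C v = symCoordsLin (C * symOfCoords v * Cᵀ) := rfl
    have h2 : (C * symOfCoords v * Cᵀ)ᵀ = C * symOfCoords v * Cᵀ :=
      transpose_conjTrans C (transpose_symOfCoords v)
    rw [h1, symSquare_symCoordsLin B h2]
    have h3 : B * (C * symOfCoords v * Cᵀ) * Bᵀ = symOfCoords v := by
      calc _ = (B * C) * symOfCoords v * (B * C)ᵀ := by
            rw [transpose_mul]; simp only [Matrix.mul_assoc]
        _ = _ := by rw [h]; simp
    rw [h3, symCoordsLin_symOfCoords]
  intro h0
  have := congrArg LinearMap.det hcomp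
  rw [LinearMap.det_comp, h0, zero_mul, LinearMap.det_id] at this
  exact zero_ne_one this

lemma transpose_pfaff (x : altTensor) (m : Fin 5) : (pfaff x m)ᵀ = pfaff x m := by
  ext s t
  rw [transpose_apply, pfaff_apply, pfaff_apply]
  fin_cases m <;> simp [pfaffPolar] <;> ring

lemma transpose_symProd (a b : Fin 3 → ℝ) : (symProd a b)ᵀ = symProd a b := by
  simp [symProd, transpose_vecMulVec, add_comm]

lemma phi1_single (x : altTensor) (m : Fin 5) : phi1 x (Pi.single m 1) = pfaff x m := by
  ext s t
  rw [phi1_apply, pfaff_apply, single_one_dotProduct]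

lemma sum_smul_pfaff_smul (g : GReal) (x : altTensor) (m : Fin 5) :
    ∑ p, (g.1 : Matrix (Fin 5) (Fin 5) ℝ)ᵀ m p • pfaff (g • x) p =
      (g.1 : Matrix (Fin 5) (Fin 5) ℝ).det •
        ((g.2 : Matrix (Fin 3) (Fin 3) ℝ) * pfaff x m * (g.2 : Matrix (Fin 3) (Fin 3) ℝ)ᵀ) := by
  have := phi1_smul g x (Pi.single m 1)
  rw [phi1_single] at this
  rw [← this]
  simp [phi1]

/-- The pfaffian functional is equivariant up to a nonzero scalar. -/
lemma exists_pfaffFunctional_smul (g : GReal) (x : altTensor) : ∃ c : ℝ, c ≠ 0 ∧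
    ∀ q : Matrix (Fin 3) (Fin 3) ℝ, qᵀ = q → pfaffFunctional (g • x)
      ((g.2 : Matrix (Fin 3) (Fin 3) ℝ) * q * (g.2 : Matrix (Fin 3) (Fin 3) ℝ)ᵀ) =
        c * pfaffFunctional x q := by
  set A := (g.1 : Matrix (Fin 5) (Fin 5) ℝ)
  set B := (g.2 : Matrix (Fin 3) (Fin 3) ℝ)
  have hA : A.det ≠ 0 := ((Matrix.isUnit_iff_isUnit_det _).1 g.1.isUnit).ne_zero
  have hB : B * ((g.2⁻¹ : GL (Fin 3) ℝ) : Matrix (Fin 3) (Fin 3) ℝ) = 1 := g.2.mul_inv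
  -- Transforming the five Pfaffians by Aᵀ multiplies the wedge by det A. The result is also det A
  -- times the transformed Pfaffians in each of five slots, which gives (det A)⁵ det(Sym² B).
  -- Cancelling one det A leaves this constant.
  refine ⟨A.det ^ 4 * LinearMap.det (symSquare B),
    mul_ne_zero (pow_ne_zero _ hA) (det_symSquare_ne_zero hB), fun q hq => ?_⟩
  have h1 := det_cons_mul Aᵀ (symCoordsLin (B * q * Bᵀ)) fun m => symCoordsLin (pfaff (g • x) m)
  rw [← pfaffFunctional_eq, Matrix.det_transpose] at h1
  have h2 : (fun m => ∑ p, Aᵀ m p • symCoordsLin (pfaff (g • x) p)) =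
      fun m => ∑ p, (diagonal fun _ : Fin 5 => A.det) m p •
        symSquare B (symCoordsLin (pfaff x p)) := by
    funext m
    simp only [← map_smul, ← map_sum]
    rw [sum_smul_pfaff_smul, map_smul, ← symSquare_symCoordsLin _ (transpose_pfaff x m)]
    rw [Finset.sum_eq_single m]
    · simp [A, B]
    · intro p _ hp
      simp [diagonal_apply_ne _ hp.symm]
    · simp
  rw [h2, det_cons_mul, ← symSquare_symCoordsLin B hq] at h1
  have h3 : (Fin.cons (symSquare B (symCoordsLin q)) fun m =>
      symSquare B (symCoordsLin (pfaff x m)) : Fin 6 → Fin 6 → ℝ) =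
      fun i => symSquare B ((Fin.cons (symCoordsLin q) fun m => symCoordsLin (pfaff x m) :
        Fin 6 → Fin 6 → ℝ) i) := by
    funext i
    refine Fin.cases ?_ (fun i => ?_) i <;> simp
  rw [h3, det_of_linearMap, ← pfaffFunctional_eq, det_diagonal] at h1
  simp only [Finset.prod_const, Finset.card_univ, Fintype.card_fin] at h1
  refine mul_left_cancel₀ hA (h1.symm.trans ?_)
  ring

lemma conj_symProd_single (B : Matrix (Fin 3) (Fin 3) ℝ) (s t : Fin 3) :
    B * symProd (Pi.single s 1) (Pi.single t 1) * Bᵀ =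
      ∑ p, ∑ r, (B p s * B r t) • symProd (Pi.single p 1) (Pi.single r 1) := by
  ext i j
  simp only [symProd, vecMulVec_apply, Matrix.sum_apply, Matrix.smul_apply, Matrix.add_apply,
    smul_eq_mul, Matrix.mul_apply, Fin.sum_univ_three, transpose_apply]
  fin_cases s <;> fin_cases t <;> fin_cases i <;> fin_cases j <;> simp <;> ring

lemma exists_Phi1_smul (g : GReal) (x : altTensor) : ∃ c : ℝ, c ≠ 0 ∧
    (g.2 : Matrix (Fin 3) (Fin 3) ℝ)ᵀ * Phi1 (g • x) * (g.2 : Matrix (Fin 3) (Fin 3) ℝ) =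
      c • Phi1 x := by
  obtain ⟨c, hc, h⟩ := exists_pfaffFunctional_smul g x
  refine ⟨c, hc, ?_⟩
  ext s t
  have h1 := h _ (transpose_symProd (Pi.single s 1) (Pi.single t 1))
  rw [conj_symProd_single] at h1
  change pfaffFunctionalLin (g • x) _ = _ at h1
  simp only [map_sum, map_smul, smul_eq_mul] at h1
  rw [Matrix.smul_apply, Phi1_apply, smul_eq_mul, mul_left_comm, ← h1]
  simp only [Matrix.mul_apply, transpose_apply, Phi1_apply, Finset.mul_sum, Finset.sum_mul]
  rw [Finset.sum_comm]
  exact Finset.sum_congr rfl fun p _ => Finset.sum_congr rfl fun r _ => by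
    change _ = _ * (_ * pfaffFunctional (g • x) _)
    ring

lemma Phi2_apply (x : altTensor) (a : Fin 5 → ℝ) :
    Phi2 x a = ((phi1 x a * Phi1 x) * (phi1 x a * Phi1 x)).trace := rfl

/-- The matrix φ₁Φ₁ changes by conjugation with B and the scalar det A · c, since B acts on
quadratic forms and on the dual ones contragrediently. The trace of the square only sees the square
of the scalar. -/
lemma exists_Phi2_smul (g : GReal) (x : altTensor) : ∃ c : ℝ, c ≠ 0 ∧ ∀ a : Fin 5 → ℝ,
    Phi2 (g • x) ((g.1 : Matrix (Fin 5) (Fin 5) ℝ) *ᵥ a) = c * Phi2 x a := by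
  obtain ⟨c, hc, h⟩ := exists_Phi1_smul g x
  have hA : (g.1 : Matrix (Fin 5) (Fin 5) ℝ).det ≠ 0 :=
    ((Matrix.isUnit_iff_isUnit_det _).1 g.1.isUnit).ne_zero
  refine ⟨((g.1 : Matrix (Fin 5) (Fin 5) ℝ).det * c) ^ 2, pow_ne_zero _ (mul_ne_zero hA hc),
    fun a => ?_⟩
  rw [Phi2_apply, Phi2_apply, phi1_smul]
  set d := (g.1 : Matrix (Fin 5) (Fin 5) ℝ).det
  set B := (g.2 : Matrix (Fin 3) (Fin 3) ℝ)
  set B' := ((g.2⁻¹ : GL (Fin 3) ℝ) : Matrix (Fin 3) (Fin 3) ℝ)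
  have hB : B * B' = 1 := g.2.mul_inv
  have hB' : B' * B = 1 := g.2.inv_mul
  have e : d • (B * phi1 x a * Bᵀ) * Phi1 (g • x) = (d * c) • (B * (phi1 x a * Phi1 x) * B') := by
    calc _ = d • (B * phi1 x a * (Bᵀ * Phi1 (g • x) * B) * B') := by
          rw [smul_mul_assoc]
          congr 1
          simp only [Matrix.mul_assoc, hB, Matrix.mul_one]
      _ = _ := by
          rw [h]
          simp only [Matrix.mul_smul, Matrix.smul_mul, smul_smul, Matrix.mul_assoc]
  rw [e, smul_mul_smul_comm, trace_smul, smul_eq_mul, ← pow_two]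
  congr 1
  calc _ = (B * ((phi1 x a * Phi1 x) * (phi1 x a * Phi1 x)) * B').trace := by
        congr 1
        calc _ = B * (phi1 x a * Phi1 x) * (B' * B) * (phi1 x a * Phi1 x) * B' := by
              simp only [Matrix.mul_assoc]
          _ = _ := by rw [hB']; simp only [Matrix.mul_assoc, Matrix.mul_one]
    _ = _ := by rw [Matrix.trace_mul_comm, ← Matrix.mul_assoc, hB', Matrix.one_mul]

end EquivariantForms

/-! ### Subalgebras of a single factor, and Lie algebras of closed subgroups -/

section LieAlgebras

open NormedSpace Filter Topology

attribute [local instance] Matrix.linftyOpNormedRing Matrix.linftyOpNormedAlgebra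

lemma sl2In5_le_soIn5 : sl2In5 ≤ soIn5 := le_sup_left

lemma soIn5_le_slAlg : soIn5 ≤ slAlg 5 := by
  refine sup_le ?_ ?_
  · rintro _ ⟨a, rfl⟩
    exact trace_comp5V2 a
  · rintro _ ⟨a, rfl⟩
    exact trace_comp5V6 a

lemma sl2In3_le_slAlg : sl2In3 ≤ slAlg 3 := by
  rintro _ ⟨a, rfl⟩
  exact trace_comp3V2 a

lemma trace_commutator {n : ℕ} (A B : Matrix (Fin n) (Fin n) ℝ) : A * B - B * A ∈ slAlg n := by
  rw [mem_slAlg, trace_sub, trace_mul_comm, sub_self]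

lemma zero_raise3_notMem_sl2Diag : ((0, raise3) : MatPair) ∉ sl2Diag := by
  rintro ⟨a, ha⟩
  have h1 : comp5V2 a = 0 := congrArg Prod.fst ha
  have h2 : comp3V2 a = raise3 := congrArg Prod.snd ha
  have h3 := congrFun (congrFun h1 0) 1
  have h4 := congrFun (congrFun h2 0) 1
  simp [comp5V2_apply] at h3
  simp [comp3V2_apply, raise3, h3] at h4

lemma raise5_zero_notMem_sl2Diag : ((raise5, 0) : MatPair) ∉ sl2Diag := by
  rintro ⟨a, ha⟩
  have h1 : comp5V2 a = raise5 := congrArg Prod.fst ha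
  have h2 : comp3V2 a = 0 := congrArg Prod.snd ha
  have h3 := congrFun (congrFun h1 0) 1
  have h4 := congrFun (congrFun h2 0) 1
  simp [comp3V2_apply] at h4
  simp [comp5V2_apply, raise5, h4] at h3

lemma raise5_mem : raise5 ∈ sl2In5 := ⟨Pi.single 0 1, raise5_eq.symm⟩

lemma raise3_mem : raise3 ∈ sl2In3 := ⟨Pi.single 0 1, raise3_eq.symm⟩

lemma left_eq_of_prod_eq {M M' : Type*} [AddCommGroup M] [Module ℝ M] [AddCommGroup M']
    [Module ℝ M'] {P P' : Submodule ℝ M} {Q Q' : Submodule ℝ M'} (h : P.prod Q = P'.prod Q') :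
    P = P' := by
  ext A
  have := SetLike.ext_iff.1 h (A, 0)
  simpa using this

lemma right_eq_of_prod_eq {M M' : Type*} [AddCommGroup M] [Module ℝ M] [AddCommGroup M']
    [Module ℝ M'] {P P' : Submodule ℝ M} {Q Q' : Submodule ℝ M'} (h : P.prod Q = P'.prod Q') :
    Q = Q' := by
  ext A
  have := SetLike.ext_iff.1 h (0, A)
  simpa using this

/-- The subalgebras of `sl(5)` that contain the image of `sl₂`. -/
lemma eq_of_commutator_mem_five {N : Submodule ℝ (Matrix (Fin 5) (Fin 5) ℝ)} (h2 : sl2In5 ≤ N)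
    (hsl : N ≤ slAlg 5) (hbr : ∀ x ∈ N, ∀ y ∈ N, x * y - y * x ∈ N) :
    N = sl2In5 ∨ N = soIn5 ∨ N = slAlg 5 := by
  -- The case of one factor follows from the classification in the product, applied to N × sl(3).
  have hd : sl2Diag ≤ N.prod (slAlg 3) := by
    rintro _ ⟨a, rfl⟩
    exact ⟨h2 ⟨a, rfl⟩, trace_comp3V2 a⟩
  rcases eq_of_commutator_mem hd (Submodule.prod_mono hsl le_rfl)
    (fun x hx y hy => ⟨hbr _ hx.1 _ hy.1, trace_commutator _ _⟩) with
    h | h | h | h | h | h | h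
  · refine absurd ?_ zero_raise3_notMem_sl2Diag
    rw [← h]
    exact ⟨N.zero_mem, sl2In3_le_slAlg raise3_mem⟩
  · exact Or.inl (left_eq_of_prod_eq h)
  · exact Or.inl (left_eq_of_prod_eq h)
  · exact Or.inr (Or.inl (left_eq_of_prod_eq h))
  · exact Or.inr (Or.inl (left_eq_of_prod_eq h))
  · exact Or.inr (Or.inr (left_eq_of_prod_eq h))
  · exact Or.inr (Or.inr (left_eq_of_prod_eq h))

/-- The subalgebras of `sl(3)` that contain the image of `sl₂`. -/
lemma eq_of_commutator_mem_three {N : Submodule ℝ (Matrix (Fin 3) (Fin 3) ℝ)} (h2 : sl2In3 ≤ N)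
    (hsl : N ≤ slAlg 3) (hbr : ∀ x ∈ N, ∀ y ∈ N, x * y - y * x ∈ N) :
    N = sl2In3 ∨ N = slAlg 3 := by
  have hd : sl2Diag ≤ (slAlg 5).prod N := by
    rintro _ ⟨a, rfl⟩
    exact ⟨trace_comp5V2 a, h2 ⟨a, rfl⟩⟩
  rcases eq_of_commutator_mem hd (Submodule.prod_mono le_rfl hsl)
    (fun x hx y hy => ⟨trace_commutator _ _, hbr _ hx.2 _ hy.2⟩) with
    h | h | h | h | h | h | h
  · refine absurd ?_ raise5_zero_notMem_sl2Diag
    rw [← h]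
    exact ⟨soIn5_le_slAlg (sl2In5_le_soIn5 raise5_mem), N.zero_mem⟩
  · exact Or.inl (right_eq_of_prod_eq h)
  · exact Or.inr (right_eq_of_prod_eq h)
  · exact Or.inl (right_eq_of_prod_eq h)
  · exact Or.inr (right_eq_of_prod_eq h)
  · exact Or.inl (right_eq_of_prod_eq h)
  · exact Or.inr (right_eq_of_prod_eq h)

/-- This supplies a single test vector: to show that an algebra is the diagonal one, it suffices to
exclude (`raise5`, 0). -/
lemma eq_sl2Diag_or_mem {N : Submodule ℝ MatPair} (hdiag : sl2Diag ≤ N)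
    (hsl : N ≤ (slAlg 5).prod (slAlg 3)) (hbr : ∀ x ∈ N, ∀ y ∈ N, x * y - y * x ∈ N) :
    N = sl2Diag ∨ ((raise5, 0) : MatPair) ∈ N := by
  have hso := sl2In5_le_soIn5 raise5_mem
  have hsl5 := soIn5_le_slAlg hso
  rcases eq_of_commutator_mem hdiag hsl hbr with h | h | h | h | h | h | h
  · exact Or.inl h
  all_goals
    right
    rw [h]
  · exact ⟨raise5_mem, sl2In3.zero_mem⟩
  · exact ⟨raise5_mem, (slAlg 3).zero_mem⟩
  · exact ⟨hso, sl2In3.zero_mem⟩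
  · exact ⟨hso, (slAlg 3).zero_mem⟩
  · exact ⟨hsl5, sl2In3.zero_mem⟩
  · exact ⟨hsl5, (slAlg 3).zero_mem⟩

lemma lieSet_subset_slAlg {n : ℕ} (K : Subgroup (SpecialLinearGroup (Fin n) ℝ)) :
    lieSet SpecialLinearGroup.coeMonoidHom K ⊆ (slAlg n : Set (Matrix (Fin n) (Fin n) ℝ)) := by
  rw [← lieSet_top_eq]
  intro X hX t
  obtain ⟨g, -, hg⟩ := hX t
  exact ⟨g, trivial, hg⟩

lemma lieSet_pairHom_subset (K : Subgroup HReal) :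
    lieSet pairHom K ⊆ ((slAlg 5).prod (slAlg 3) : Set MatPair) := by
  intro X hX
  constructor
  · refine lieSet_subset_slAlg ⊤ fun t => ?_
    obtain ⟨g, -, hg⟩ := hX t
    exact ⟨g.1, trivial, congrArg Prod.fst (hg.trans (exp_pair (t • X)))⟩
  · refine lieSet_subset_slAlg ⊤ fun t => ?_
    obtain ⟨g, -, hg⟩ := hX t
    exact ⟨g.2, trivial, congrArg Prod.snd (hg.trans (exp_pair (t • X)))⟩

lemma exists_submodule_eq_lieSet {n : ℕ} {K : Subgroup (SpecialLinearGroup (Fin n) ℝ)}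
    (hK : IsClosed (K : Set (SpecialLinearGroup (Fin n) ℝ))) :
    ∃ N : Submodule ℝ (Matrix (Fin n) (Fin n) ℝ), (N : Set (Matrix (Fin n) (Fin n) ℝ)) =
      lieSet SpecialLinearGroup.coeMonoidHom K ∧ ∀ x ∈ N, ∀ y ∈ N, x * y - y * x ∈ N := by
  have hK' : IsClosed ((SpecialLinearGroup.coeMonoidHom :
      SpecialLinearGroup (Fin n) ℝ →* Matrix (Fin n) (Fin n) ℝ) '' (K : Set _)) :=
    SpecialLinearGroup.isClosedEmbedding_val.isClosedMap _ hK
  exact ⟨lieSubmodule SpecialLinearGroup.coeMonoidHom K hK', rfl,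
    fun x hx y hy => commutator_mem_lieSubmodule hK' hx hy⟩

lemma exists_submodule_eq_lieSet_pair {K : Subgroup HReal} (hK : IsClosed (K : Set HReal)) :
    ∃ N : Submodule ℝ MatPair, (N : Set MatPair) = lieSet pairHom K ∧
      ∀ x ∈ N, ∀ y ∈ N, x * y - y * x ∈ N := by
  have hK' : IsClosed (pairHom '' (K : Set HReal)) := isClosedEmbedding_pairHom.isClosedMap _ hK
  exact ⟨lieSubmodule pairHom K hK', rfl,
    fun x hx y hy => commutator_mem_lieSubmodule hK' hx hy⟩

lemma lieSet_five_cases {K : Subgroup (SpecialLinearGroup (Fin 5) ℝ)}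
    (hK : IsClosed (K : Set (SpecialLinearGroup (Fin 5) ℝ)))
    (h : (sl2In5 : Set (Matrix (Fin 5) (Fin 5) ℝ)) ⊆ lieSet SpecialLinearGroup.coeMonoidHom K) :
    lieSet SpecialLinearGroup.coeMonoidHom K = (sl2In5 : Set (Matrix (Fin 5) (Fin 5) ℝ)) ∨
    lieSet SpecialLinearGroup.coeMonoidHom K = (soIn5 : Set (Matrix (Fin 5) (Fin 5) ℝ)) ∨
    lieSet SpecialLinearGroup.coeMonoidHom K = (slAlg 5 : Set (Matrix (Fin 5) (Fin 5) ℝ)) := by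
  obtain ⟨N, hN, hbr⟩ := exists_submodule_eq_lieSet hK
  have hsl := lieSet_subset_slAlg K
  rw [← hN] at h hsl ⊢
  simpa only [SetLike.coe_set_eq] using eq_of_commutator_mem_five h hsl hbr

lemma lieSet_three_cases {K : Subgroup (SpecialLinearGroup (Fin 3) ℝ)}
    (hK : IsClosed (K : Set (SpecialLinearGroup (Fin 3) ℝ)))
    (h : (sl2In3 : Set (Matrix (Fin 3) (Fin 3) ℝ)) ⊆ lieSet SpecialLinearGroup.coeMonoidHom K) :
    lieSet SpecialLinearGroup.coeMonoidHom K = (sl2In3 : Set (Matrix (Fin 3) (Fin 3) ℝ)) ∨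
    lieSet SpecialLinearGroup.coeMonoidHom K = (slAlg 3 : Set (Matrix (Fin 3) (Fin 3) ℝ)) := by
  obtain ⟨N, hN, hbr⟩ := exists_submodule_eq_lieSet hK
  have hsl := lieSet_subset_slAlg K
  rw [← hN] at h hsl ⊢
  simpa only [SetLike.coe_set_eq] using eq_of_commutator_mem_three h hsl hbr

end LieAlgebras

/-! ### The covariants of the base point -/

section BasePoint

lemma basePoint_zero : basePoint.1 0 = !![0, 0, 0, 0, 0; 0, 0, 0, 0, 1; 0, 0, 0, -3, 0;
    0, 0, 3, 0, 0; 0, -1, 0, 0, 0] := by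
  ext i j
  fin_cases i <;> fin_cases j <;> simp [basePoint, wedge]

lemma basePoint_one : basePoint.1 1 = !![0, 0, 0, 0, -1; 0, 0, 0, 2, 0; 0, 0, 0, 0, 0;
    0, -2, 0, 0, 0; 1, 0, 0, 0, 0] := by
  ext i j
  fin_cases i <;> fin_cases j <;> simp [basePoint, wedge]

lemma basePoint_two : basePoint.1 2 = !![0, 0, 0, 1, 0; 0, 0, -3, 0, 0; 0, 3, 0, 0, 0;
    -1, 0, 0, 0, 0; 0, 0, 0, 0, 0] := by
  ext i j
  fin_cases i <;> fin_cases j <;> simp [basePoint, wedge]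

set_option maxHeartbeats 800000 in
lemma pfaff_basePoint : pfaff basePoint = ![!![-3, 0, 0; 0, 0, 0; 0, 0, 0],
    !![0, -3 / 2, 0; -3 / 2, 0, 0; 0, 0, 0], !![0, 0, -1 / 2; 0, -2, 0; -1 / 2, 0, 0],
    !![0, 0, 0; 0, 0, -3 / 2; 0, -3 / 2, 0], !![0, 0, 0; 0, 0, 0; 0, 0, -3]] := by
  have h : ∀ i j, coeffV2 basePoint i j =
      ![basePoint.1 0 i j, basePoint.1 1 i j, basePoint.1 2 i j] := by
    intro i j
    ext k
    fin_cases k <;> rfl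
  funext m
  ext s t
  fin_cases m <;> fin_cases s <;> fin_cases t <;>
    simp [pfaff, pfaffMinor, symProd, h, basePoint_zero, basePoint_one, basePoint_two] <;> norm_num

/-- The symmetric matrix that is the value of `Phi1` at the base point. -/
def baseForm3 : Matrix (Fin 3) (Fin 3) ℝ := !![0, 0, -2; 0, 1, 0; -2, 0, 0]

lemma pfaffFunctional_basePoint (q : Matrix (Fin 3) (Fin 3) ℝ) :
    pfaffFunctional basePoint q = 81 * q 1 1 - 324 * q 0 2 := by
  have h : Matrix.of ![symCoords q,
      symCoords (pfaff basePoint 0), symCoords (pfaff basePoint 1), symCoords (pfaff basePoint 2),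
      symCoords (pfaff basePoint 3), symCoords (pfaff basePoint 4)] =
      !![q 0 0, q 1 1, q 2 2, 2 * q 0 1, 2 * q 1 2, 2 * q 0 2; -3, 0, 0, 0, 0, 0;
      0, 0, 0, -3, 0, 0; 0, -2, 0, 0, 0, -1; 0, 0, 0, 0, -3, 0; 0, 0, -3, 0, 0, 0] := by
    rw [pfaff_basePoint]
    ext i j
    fin_cases i <;> fin_cases j <;> simp [symCoords] <;> norm_num
  rw [pfaffFunctional, h]
  simp [Matrix.det_succ_row _ (1 : Fin _), Fin.sum_univ_succ, Fin.succAbove]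
  ring

lemma Phi1_basePoint : Phi1 basePoint = baseForm3 := by
  ext s t
  rw [Phi1_apply, pfaffFunctional_basePoint, baseForm3]
  fin_cases s <;> fin_cases t <;> simp [symProd, Matrix.vecMulVec_apply] <;> norm_num

lemma phi1_basePoint (a : Fin 5 → ℝ) : phi1 basePoint a =
    !![-3 * a 0, -3 / 2 * a 1, -1 / 2 * a 2; -3 / 2 * a 1, -2 * a 2, -3 / 2 * a 3;
      -1 / 2 * a 2, -3 / 2 * a 3, -3 * a 4] := by
  have h : phi1 basePoint a = ∑ i, a i • pfaff basePoint i := by simp [phi1]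
  rw [h, pfaff_basePoint]
  ext s t
  fin_cases s <;> fin_cases t <;> simp [Fin.sum_univ_five] <;> ring

/-- The Gram matrix of the value of `Phi2` at the base point. -/
def baseForm5 : Matrix (Fin 5) (Fin 5) ℝ :=
  !![0, 0, 0, 0, 36; 0, 0, 0, -9, 0; 0, 0, 6, 0, 0; 0, -9, 0, 0, 0; 36, 0, 0, 0, 0]

lemma Phi2_basePoint (a : Fin 5 → ℝ) : Phi2 basePoint a = a ⬝ᵥ baseForm5 *ᵥ a := by
  rw [Phi2_apply, Phi1_basePoint, phi1_basePoint, baseForm3, baseForm5]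
  simp [Matrix.trace, Fin.sum_univ_three, dotProduct, Matrix.mulVec,
    Fin.sum_univ_five]
  ring

lemma transpose_baseForm5 : baseForm5ᵀ = baseForm5 := by
  rw [baseForm5]
  ext i j
  fin_cases i <;> fin_cases j <;> rfl

lemma eq_of_dotProduct_mulVec_eq {n : ℕ} {M N : Matrix (Fin n) (Fin n) ℝ} (hM : Mᵀ = M)
    (hN : Nᵀ = N) (h : ∀ a : Fin n → ℝ, a ⬝ᵥ M *ᵥ a = a ⬝ᵥ N *ᵥ a) : M = N := by
  ext i j
  have h1 := h (Pi.single i 1)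
  have h2 := h (Pi.single j 1)
  have h3 := h (Pi.single i 1 + Pi.single j 1)
  have h4 := congrFun (congrFun hM i) j
  have h5 := congrFun (congrFun hN i) j
  simp only [add_dotProduct, Matrix.mulVec_add, dotProduct_add, Matrix.mulVec_single_one,
    single_one_dotProduct, Matrix.col_apply, Matrix.transpose_apply] at h1 h2 h3 h4 h5
  linarith

lemma mem_stabH3_basePoint {g : SpecialLinearGroup (Fin 5) ℝ} :
    g ∈ stabH3 basePoint ↔ g.1ᵀ * baseForm5 * g.1 = baseForm5 := by
  have key : ∀ a, Phi2 basePoint (g.1 *ᵥ a) = a ⬝ᵥ (g.1ᵀ * baseForm5 * g.1) *ᵥ a := by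
    intro a
    rw [Phi2_basePoint, ← Matrix.mulVec_mulVec, ← Matrix.mulVec_mulVec,
      Matrix.dotProduct_mulVec a, Matrix.vecMul_transpose]
  constructor
  · intro h
    refine eq_of_dotProduct_mulVec_eq ?_ transpose_baseForm5 fun a => ?_
    · rw [transpose_mul, transpose_mul, transpose_transpose, transpose_baseForm5,
        Matrix.mul_assoc]
    · rw [← key, ← Phi2_basePoint]
      exact h a
  · intro h a
    rw [key, h, Phi2_basePoint]

lemma mem_stabH {x : altTensor} {g : HReal} : g ∈ stabH x ↔ inclHG g • x = x := Iff.rfl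

lemma inclHG_smul_apply (g : HReal) (x : altTensor) (k : Fin 3) :
    (inclHG g • x).1 k = ∑ j, g.2.1 k j • (g.1.1 * x.1 j * g.1.1ᵀ) := rfl

/-- Equivariance gives invariance of the form up to a scalar c. Comparing determinants in SL(3)
yields c³ = 1, and c is real. -/
lemma transpose_mul_baseForm3_mul {g : SpecialLinearGroup (Fin 3) ℝ} (hg : g ∈ stabH2 basePoint) :
    g.1ᵀ * baseForm3 * g.1 = baseForm3 := by
  obtain ⟨h, hh, rfl⟩ := hg
  obtain ⟨c, -, hc⟩ := exists_Phi1_smul (inclHG h) basePoint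
  rw [mem_stabH.1 hh, Phi1_basePoint] at hc
  change h.2.1ᵀ * baseForm3 * h.2.1 = c • baseForm3 at hc
  have hd := congrArg Matrix.det hc
  have hne : baseForm3.det ≠ 0 := by
    rw [baseForm3, Matrix.det_fin_three]
    simp
  rw [Matrix.det_mul, Matrix.det_mul, Matrix.det_transpose, h.2.2, one_mul, mul_one,
    Matrix.det_smul, Fintype.card_fin] at hd
  have h3 : c ^ 3 = 1 := mul_right_cancel₀ hne (by rw [← hd, one_mul])
  have h1 : c = 1 := by
    have : (c - 1) * ((c + 1 / 2) ^ 2 + 3 / 4) = 0 := by linear_combination h3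
    rcases mul_eq_zero.1 this with h | h
    · linarith
    · nlinarith [sq_nonneg (c + 1 / 2)]
  change h.2.1ᵀ * baseForm3 * h.2.1 = baseForm3
  rw [hc, h1, one_smul]

/-- If (g, h) fixes `w`, then g maps each of the three components of `w` into their span, and all
three have entry 0 in position (0, 2). This is a closed condition on g, so it passes to the closure
of the projection. -/
lemma mul_basePoint_mul_apply {g : SpecialLinearGroup (Fin 5) ℝ} (hg : g ∈ stabH1 basePoint) :
    (g.1 * basePoint.1 0 * g.1ᵀ) 0 2 = 0 := by
  obtain ⟨h, hh, rfl⟩ := hg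
  have e : inclHG (h.1, 1) • basePoint = inclHG (1, h.2⁻¹) • basePoint := by
    have h1 : ((h.1, 1) : HReal) = (1, h.2⁻¹) * h := Prod.ext (by simp) (by simp)
    rw [h1, map_mul, mul_smul, mem_stabH.1 hh]
  have e0 := congrArg (fun x : altTensor => x.1 0 0 2) e
  simp only [inclHG_smul_apply] at e0
  have e1 : (∑ j, (1 : SpecialLinearGroup (Fin 3) ℝ).1 0 j •
      (h.1.1 * basePoint.1 j * h.1.1ᵀ)) = h.1.1 * basePoint.1 0 * h.1.1ᵀ := by
    change (∑ j, (1 : Matrix (Fin 3) (Fin 3) ℝ) 0 j • _) = _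
    simp [Matrix.one_apply]
  rw [e1] at e0
  change (h.1.1 * basePoint.1 0 * h.1.1ᵀ) 0 2 = 0
  rw [e0]
  change (∑ j, _ • ((1 : Matrix (Fin 5) (Fin 5) ℝ) * basePoint.1 j *
    (1 : Matrix (Fin 5) (Fin 5) ℝ)ᵀ)) 0 2 = 0
  simp [Fin.sum_univ_three, basePoint_zero, basePoint_one, basePoint_two]

end BasePoint

/-! ### Lie algebras of the stabilizer, its projections and SO(`Phi2`) -/

section BasePointLie

open NormedSpace Filter Topology

attribute [local instance] Matrix.linftyOpNormedRing Matrix.linftyOpNormedAlgebra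

lemma HasDerivAt.matrix_transpose {n : ℕ} {f : ℝ → Matrix (Fin n) (Fin n) ℝ}
    {f' : Matrix (Fin n) (Fin n) ℝ} {t : ℝ} (h : HasDerivAt f f' t) :
    HasDerivAt (fun s => (f s)ᵀ) f'ᵀ t :=
  (LinearMap.toContinuousLinearMap
    (Matrix.transposeLinearEquiv (Fin n) (Fin n) ℝ ℝ).toLinearMap).hasFDerivAt.comp_hasDerivAt t h

lemma HasDerivAt.matrix_apply {n : ℕ} {f : ℝ → Matrix (Fin n) (Fin n) ℝ}
    {f' : Matrix (Fin n) (Fin n) ℝ} {t : ℝ} (h : HasDerivAt f f' t) (i j : Fin n) :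
    HasDerivAt (fun s => f s i j) (f' i j) t :=
  (LinearMap.toContinuousLinearMap
    (Matrix.entryLinearMap ℝ ℝ i j)).hasFDerivAt.comp_hasDerivAt t h

lemma hasDerivAt_exp_mul_mul_transpose {n : ℕ} (X M : Matrix (Fin n) (Fin n) ℝ) :
    HasDerivAt (fun t : ℝ => exp (t • X) * M * (exp (t • X))ᵀ) (X * M + M * Xᵀ) 0 := by
  have h := hasDerivAt_exp_smul_zero X
  have := (h.mul_const M).mul h.matrix_transpose
  simp only [Pi.mul_def, zero_smul, NormedSpace.exp_zero, one_mul, mul_one, transpose_one] at this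
  exact this

lemma hasDerivAt_exp_transpose_mul_mul {n : ℕ} (X M : Matrix (Fin n) (Fin n) ℝ) :
    HasDerivAt (fun t : ℝ => (exp (t • X))ᵀ * M * exp (t • X)) (Xᵀ * M + M * X) 0 := by
  have h := hasDerivAt_exp_smul_zero X
  have := (h.matrix_transpose.mul_const M).mul h
  simp only [Pi.mul_def, zero_smul, NormedSpace.exp_zero, one_mul, mul_one, transpose_one] at this
  exact this

/-- A curve whose derivative vanishes at every point, by the flow property. -/
lemma exp_transpose_mul_mul_eq {n : ℕ} {X M : Matrix (Fin n) (Fin n) ℝ}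
    (h : Xᵀ * M + M * X = 0) (t : ℝ) : (exp (t • X))ᵀ * M * exp (t • X) = M := by
  have hd : ∀ s : ℝ, HasDerivAt (fun t : ℝ => (exp (t • X))ᵀ * M * exp (t • X)) 0 s := by
    intro s
    have h0 := hasDerivAt_exp_transpose_mul_mul X M
    rw [h] at h0
    have h0' : HasDerivAt (fun t : ℝ => (exp (t • X))ᵀ * M * exp (t • X)) 0 (s - s) := by
      rwa [sub_self]
    have h1 := ((h0'.comp_sub_const s s).const_mul (exp (s • X))ᵀ).mul_const (exp (s • X))
    rw [mul_zero, zero_mul] at h1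
    refine h1.congr_of_eventuallyEq (Eventually.of_forall fun t => ?_)
    have h2 : exp (t • X) = exp ((t - s) • X) * exp (s • X) := by
      have := exp_add_smul X (t - s) s
      rwa [sub_add_cancel] at this
    simp only
    rw [h2, transpose_mul]
    simp only [Matrix.mul_assoc]
  have := is_const_of_deriv_eq_zero (fun s => (hd s).differentiableAt) (fun s => (hd s).deriv) t 0
  simpa using this

/-- The infinitesimal action on the triples of alternating matrices. -/
def infAct (X : MatPair) (w : Fin 3 → Matrix (Fin 5) (Fin 5) ℝ) (k : Fin 3) :
    Matrix (Fin 5) (Fin 5) ℝ :=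
  X.1 * w k + w k * X.1ᵀ + ∑ j, X.2 k j • w j

lemma hasDerivAt_action (X : MatPair) (w : Fin 3 → Matrix (Fin 5) (Fin 5) ℝ) (k : Fin 3) :
    HasDerivAt (fun t : ℝ => ∑ j, (exp (t • X.2)) k j •
      (exp (t • X.1) * w j * (exp (t • X.1))ᵀ)) (infAct X w k) 0 := by
  have h : ∀ j, HasDerivAt (fun t : ℝ => (exp (t • X.2)) k j •
      (exp (t • X.1) * w j * (exp (t • X.1))ᵀ))
      ((1 : Matrix (Fin 3) (Fin 3) ℝ) k j • (X.1 * w j + w j * X.1ᵀ) + X.2 k j • w j) 0 := by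
    intro j
    have := ((hasDerivAt_exp_smul_zero X.2).matrix_apply k j).smul
      (hasDerivAt_exp_mul_mul_transpose X.1 (w j))
    simp only [Pi.smul_def', zero_smul, NormedSpace.exp_zero, one_mul, mul_one,
      transpose_one] at this
    exact this
  have := HasDerivAt.fun_sum (u := Finset.univ) fun j _ => h j
  refine this.congr_deriv ?_
  rw [Finset.sum_add_distrib, infAct]
  simp only [Matrix.one_apply, ite_smul, one_smul, zero_smul, Finset.sum_ite_eq, Finset.mem_univ,
    if_true]

/-- The orbit curve t ↦ exp(tX) • x has derivative 0 at the origin. Translating by the flow, its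
derivative vanishes everywhere, so the curve is constant. -/
lemma mem_lieSet_stabH_of_infAct_eq_zero {x : altTensor} {X : MatPair} (h1 : X.1 ∈ slAlg 5)
    (h2 : X.2 ∈ slAlg 3) (h : ∀ k, infAct X x.1 k = 0) : X ∈ lieSet pairHom (stabH x) := by
  let c : ℝ → HReal := fun t =>
    (⟨exp (t • X.1), det_exp_eq_one (by rw [trace_smul, mem_slAlg.1 h1, smul_zero])⟩,
      ⟨exp (t • X.2), det_exp_eq_one (by rw [trace_smul, mem_slAlg.1 h2, smul_zero])⟩)
  have hadd : ∀ s t, c (s + t) = c s * c t := fun s t =>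
    Prod.ext (Subtype.ext (exp_add_smul X.1 s t)) (Subtype.ext (exp_add_smul X.2 s t))
  intro t
  refine ⟨c t, ?_, (exp_pair (t • X)).symm⟩
  rw [mem_stabH]
  apply Subtype.ext
  funext k
  have hd0 : ∀ k, HasDerivAt (fun t => (inclHG (c t) • x).1 k) 0 0 := by
    intro k
    have := hasDerivAt_action X x.1 k
    rw [h k] at this
    exact this
  have hd : ∀ s, HasDerivAt (fun t => (inclHG (c t) • x).1 k) 0 s := by
    intro s
    have h3 : ∀ j, HasDerivAt (fun t => (c s).2.1 k j •
        ((c s).1.1 * (inclHG (c (t - s)) • x).1 j * (c s).1.1ᵀ)) 0 s := by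
      intro j
      have h0 : HasDerivAt (fun t => (inclHG (c t) • x).1 j) 0 (s - s) := by
        rw [sub_self]
        exact hd0 j
      have := (((h0.comp_sub_const s s).const_mul (c s).1.1).mul_const (c s).1.1ᵀ).const_smul
        ((c s).2.1 k j)
      rwa [mul_zero, zero_mul, smul_zero] at this
    have h4 := HasDerivAt.fun_sum (u := Finset.univ) fun j _ => h3 j
    rw [Finset.sum_const_zero] at h4
    refine h4.congr_of_eventuallyEq (Eventually.of_forall fun t => ?_)
    have e : c t = c s * c (t - s) := by rw [← hadd, add_sub_cancel]
    simp only
    rw [e, map_mul, mul_smul]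
    rfl
  have h0 : c 0 = 1 := Prod.ext (Subtype.ext (by simp [c])) (Subtype.ext (by simp [c]))
  have := is_const_of_deriv_eq_zero (fun s => (hd s).differentiableAt) (fun s => (hd s).deriv) t 0
  simpa [h0] using this

lemma infAct_eq_zero_of_mem_lieSet {x : altTensor} {X : MatPair}
    (h : X ∈ lieSet pairHom (stabH x)) (k : Fin 3) : infAct X x.1 k = 0 := by
  have h1 : HasDerivAt (fun t : ℝ => ∑ j, (exp (t • X.2)) k j •
      (exp (t • X.1) * x.1 j * (exp (t • X.1))ᵀ)) 0 0 := by
    refine (hasDerivAt_const (0 : ℝ) (x.1 k)).congr_of_eventuallyEq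
      (Eventually.of_forall fun t => ?_)
    obtain ⟨g, hg, e⟩ := h t
    have e' := e.trans (exp_pair (t • X))
    have e1 : g.1.1 = exp (t • X.1) := congrArg Prod.fst e'
    have e2 : g.2.1 = exp (t • X.2) := congrArg Prod.snd e'
    simp only
    rw [← e1, ← e2, ← inclHG_smul_apply, mem_stabH.1 hg]
  exact (hasDerivAt_action X x.1 k).unique h1

lemma transpose_mul_add_mul_eq_zero {n : ℕ} {X M : Matrix (Fin n) (Fin n) ℝ}
    (h : ∀ t : ℝ, (exp (t • X))ᵀ * M * exp (t • X) = M) : Xᵀ * M + M * X = 0 :=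
  (hasDerivAt_exp_transpose_mul_mul X M).unique ((hasDerivAt_const (0 : ℝ) M).congr_of_eventuallyEq
    (Eventually.of_forall h))

lemma infAct_apply (X : MatPair) (w : Fin 3 → Matrix (Fin 5) (Fin 5) ℝ) (k : Fin 3)
    (i j : Fin 5) : infAct X w k i j = (X.1 i 0 * w k 0 j + X.1 i 1 * w k 1 j + X.1 i 2 * w k 2 j +
      X.1 i 3 * w k 3 j + X.1 i 4 * w k 4 j) + (w k i 0 * X.1 j 0 + w k i 1 * X.1 j 1 +
      w k i 2 * X.1 j 2 + w k i 3 * X.1 j 3 + w k i 4 * X.1 j 4) +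
      (X.2 k 0 * w 0 i j + X.2 k 1 * w 1 i j + X.2 k 2 * w 2 i j) := by
  rw [infAct, Fin.sum_univ_three, Matrix.add_apply, Matrix.add_apply, Matrix.mul_apply,
    Matrix.mul_apply, Fin.sum_univ_five, Fin.sum_univ_five]
  rfl

set_option maxHeartbeats 1000000 in
-- The exterior square of V(4) contains V(2) once, and `w` is the invariant vector in V(2) ⊗ V(2).
-- The basis vectors are normalized accordingly.
lemma infAct_basePoint (a : ℕ → ℝ) (k : Fin 3) :
    infAct (comp5V2 a, comp3V2 a) basePoint.1 k = 0 := by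
  ext i j
  rw [infAct_apply, comp5V2_apply, comp3V2_apply]
  fin_cases k <;> fin_cases i <;> fin_cases j <;>
    simp [basePoint_zero, basePoint_one, basePoint_two] <;> ring

lemma isClosed_stabH (x : altTensor) : IsClosed (stabH x : Set HReal) := by
  have : (stabH x : Set HReal) = ⋂ k, {g | ∑ j, g.2.1 k j • (g.1.1 * x.1 j * g.1.1ᵀ) = x.1 k} := by
    ext g
    simp only [Set.mem_iInter, Set.mem_ofPred_eq, SetLike.mem_coe, mem_stabH, Subtype.ext_iff,
      funext_iff, inclHG_smul_apply]
  rw [this]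
  refine isClosed_iInter fun k => isClosed_eq ?_ continuous_const
  have h1 : Continuous fun g : HReal => g.1.1 := continuous_subtype_val.comp continuous_fst
  have h2 : Continuous fun g : HReal => g.2.1 := continuous_subtype_val.comp continuous_snd
  exact continuous_finsetSum _ fun j _ => (h2.matrix_elem k j).smul
    ((h1.matrix_mul continuous_const).matrix_mul h1.matrix_transpose)

lemma isClosed_stabH3_basePoint :
    IsClosed (stabH3 basePoint : Set (SpecialLinearGroup (Fin 5) ℝ)) := by
  have : (stabH3 basePoint : Set (SpecialLinearGroup (Fin 5) ℝ)) =
      {g | g.1ᵀ * baseForm5 * g.1 = baseForm5} := Set.ext fun g => mem_stabH3_basePoint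
  rw [this]
  have h : Continuous fun g : SpecialLinearGroup (Fin 5) ℝ => g.1 := continuous_subtype_val
  exact isClosed_eq ((h.matrix_transpose.matrix_mul continuous_const).matrix_mul h)
    continuous_const

lemma sl2Diag_subset_lieSet : (sl2Diag : Set MatPair) ⊆ lieSet pairHom (stabH basePoint) := by
  rintro _ ⟨a, rfl⟩
  exact mem_lieSet_stabH_of_infAct_eq_zero (trace_comp5V2 a) (trace_comp3V2 a)
    (infAct_basePoint a)

lemma lieSet_stabH_basePoint : lieSet pairHom (stabH basePoint) = (sl2Diag : Set MatPair) := by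
  obtain ⟨N, hN, hbr⟩ := exists_submodule_eq_lieSet_pair (isClosed_stabH basePoint)
  have h1 := sl2Diag_subset_lieSet
  have h2 := lieSet_pairHom_subset (stabH basePoint)
  -- The test vector for being strictly larger than the diagonal: it moves the `l₀` component of
  -- `w`, already in position (0, 4).
  have h3 : ((raise5, 0) : MatPair) ∉ lieSet pairHom (stabH basePoint) := by
    intro h
    have := congrFun (congrFun (infAct_eq_zero_of_mem_lieSet h 0) 0) 4
    rw [infAct_apply] at this
    simp [basePoint_zero, raise5] at this
  rw [← hN] at h1 h2 h3 ⊢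
  rcases eq_sl2Diag_or_mem h1 h2 hbr with h | h
  · rw [h]
  · exact absurd h h3

lemma sl2In5_subset_lieSet : (sl2In5 : Set (Matrix (Fin 5) (Fin 5) ℝ)) ⊆
    lieSet SpecialLinearGroup.coeMonoidHom (stabH1 basePoint) := by
  rintro _ ⟨a, rfl⟩ t
  obtain ⟨g, hg, e⟩ := sl2Diag_subset_lieSet ⟨a, rfl⟩ t
  exact ⟨g.1, ⟨g, hg, rfl⟩, congrArg Prod.fst (e.trans (exp_pair _))⟩

lemma sl2In3_subset_lieSet : (sl2In3 : Set (Matrix (Fin 3) (Fin 3) ℝ)) ⊆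
    lieSet SpecialLinearGroup.coeMonoidHom (stabH2 basePoint) := by
  rintro _ ⟨a, rfl⟩ t
  obtain ⟨g, hg, e⟩ := sl2Diag_subset_lieSet ⟨a, rfl⟩ t
  exact ⟨g.2, ⟨g, hg, rfl⟩, congrArg Prod.snd (e.trans (exp_pair _))⟩

lemma lieSet_mono {A G : Type*} [NormedRing A] [NormedAlgebra ℝ A] [Group G] {ι : G →* A}
    {K K' : Subgroup G} (h : K ≤ K') : lieSet ι K ⊆ lieSet ι K' := fun _ hX t =>
  let ⟨g, hg, e⟩ := hX t
  ⟨g, h hg, e⟩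

lemma idComp_stabH_basePoint :
    idComp (stabH basePoint) = expGroup pairHom (sl2Diag : Set MatPair) := by
  refine idComp_eq_expGroup isClosedEmbedding_pairHom sl2Diag_subset_lieSet ?_
  rw [← lieSet_stabH_basePoint]
  exact lieSet_mono ((stabH basePoint).topologicalClosure_minimal le_rfl (isClosed_stabH _))

lemma idComp_stabH1_basePoint : idComp (stabH1 basePoint) =
    expGroup SpecialLinearGroup.coeMonoidHom (sl2In5 : Set (Matrix (Fin 5) (Fin 5) ℝ)) := by
  refine idComp_eq_expGroup SpecialLinearGroup.isClosedEmbedding_val sl2In5_subset_lieSet ?_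
  set K := (stabH1 basePoint).topologicalClosure with hK
  have hcl : IsClosed {g : SpecialLinearGroup (Fin 5) ℝ |
      (g.1 * basePoint.1 0 * g.1ᵀ) 0 2 = 0} := by
    have h : Continuous fun g : SpecialLinearGroup (Fin 5) ℝ => g.1 := continuous_subtype_val
    exact isClosed_eq (((h.matrix_mul continuous_const).matrix_mul h.matrix_transpose).matrix_elem
      0 2) continuous_const
  have hsub : (K : Set (SpecialLinearGroup (Fin 5) ℝ)) ⊆ {g |
      (g.1 * basePoint.1 0 * g.1ᵀ) 0 2 = 0} :=
    closure_minimal (fun g hg => mul_basePoint_mul_apply hg) hcl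
  -- Differentiating the vanishing (0, 2) entry along this direction would give 3 = 0. This excludes
  -- both larger subalgebras, as each contains V(6).
  have hn : comp5V6 (Pi.single 0 1) ∉ lieSet SpecialLinearGroup.coeMonoidHom K := by
    intro h
    have h1 := (hasDerivAt_exp_mul_mul_transpose (comp5V6 (Pi.single 0 1))
      (basePoint.1 0)).matrix_apply 0 2
    have h2 := h1.unique ((hasDerivAt_const (0 : ℝ) (0 : ℝ)).congr_of_eventuallyEq
      (Eventually.of_forall fun t => by
        obtain ⟨g, hg, e⟩ := h t
        have e1 : g.1 = exp (t • comp5V6 (Pi.single 0 1)) := e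
        have := hsub hg
        rw [Set.mem_ofPred_eq, e1] at this
        exact this))
    rw [Matrix.add_apply, Matrix.mul_apply, Matrix.mul_apply, Fin.sum_univ_five,
      Fin.sum_univ_five] at h2
    simp [basePoint_zero, comp5V6_apply] at h2
  rcases lieSet_five_cases (K := K) (Subgroup.isClosed_topologicalClosure _)
    (sl2In5_subset_lieSet.trans (lieSet_mono (Subgroup.le_topologicalClosure _))) with h | h | h
  · exact h.subset
  · exact absurd (h ▸ (le_sup_right : _ ≤ soIn5) ⟨_, rfl⟩) hn
  · exact absurd (h ▸ trace_comp5V6 _) hn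

lemma idComp_stabH2_basePoint : idComp (stabH2 basePoint) =
    expGroup SpecialLinearGroup.coeMonoidHom (sl2In3 : Set (Matrix (Fin 3) (Fin 3) ℝ)) := by
  refine idComp_eq_expGroup SpecialLinearGroup.isClosedEmbedding_val sl2In3_subset_lieSet ?_
  set K := (stabH2 basePoint).topologicalClosure with hK
  have hcl : IsClosed {g : SpecialLinearGroup (Fin 3) ℝ |
      g.1ᵀ * baseForm3 * g.1 = baseForm3} := by
    have h : Continuous fun g : SpecialLinearGroup (Fin 3) ℝ => g.1 := continuous_subtype_val
    exact isClosed_eq ((h.matrix_transpose.matrix_mul continuous_const).matrix_mul h)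
      continuous_const
  have hsub : (K : Set (SpecialLinearGroup (Fin 3) ℝ)) ⊆ {g |
      g.1ᵀ * baseForm3 * g.1 = baseForm3} :=
    closure_minimal (fun g hg => transpose_mul_baseForm3_mul hg) hcl
  have hn : comp3V4 (Pi.single 0 1) ∉ lieSet SpecialLinearGroup.coeMonoidHom K := by
    intro h
    have h1 := transpose_mul_add_mul_eq_zero (X := comp3V4 (Pi.single 0 1)) (M := baseForm3)
      fun t => by
        obtain ⟨g, hg, e⟩ := h t
        have e1 : g.1 = exp (t • comp3V4 (Pi.single 0 1)) := e
        have := hsub hg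
        rw [Set.mem_ofPred_eq, e1] at this
        exact this
    have h2 := congrFun (congrFun h1 2) 2
    simp [baseForm3, comp3V4_apply, Matrix.mul_apply, Fin.sum_univ_three] at h2
  rcases lieSet_three_cases (K := K) (Subgroup.isClosed_topologicalClosure _)
    (sl2In3_subset_lieSet.trans (lieSet_mono (Subgroup.le_topologicalClosure _))) with h | h
  · exact h.subset
  · exact absurd (h ▸ trace_comp3V4 _) hn

/-- The form is the `sl₂`-invariant symmetric form on V(4), and the matrices skew for it form the
exterior square of V(4), which is V(2) + V(6). -/
lemma transpose_mul_baseForm5_add_eq_zero {X : Matrix (Fin 5) (Fin 5) ℝ} (hX : X ∈ soIn5) :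
    Xᵀ * baseForm5 + baseForm5 * X = 0 := by
  obtain ⟨_, ⟨a, rfl⟩, _, ⟨b, rfl⟩, rfl⟩ := Submodule.mem_sup.1 hX
  rw [comp5V2_apply, comp5V6_apply, baseForm5]
  ext i j
  fin_cases i <;> fin_cases j <;> simp [Matrix.mul_apply, Fin.sum_univ_five] <;> ring

lemma soIn5_subset_lieSet : (soIn5 : Set (Matrix (Fin 5) (Fin 5) ℝ)) ⊆
    lieSet SpecialLinearGroup.coeMonoidHom (stabH3 basePoint) := by
  intro X hX t
  have ht : (t • X).trace = 0 := by
    rw [trace_smul, mem_slAlg.1 (soIn5_le_slAlg hX), smul_zero]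
  refine ⟨⟨exp (t • X), det_exp_eq_one ht⟩, mem_stabH3_basePoint.2 ?_, rfl⟩
  exact exp_transpose_mul_mul_eq (transpose_mul_baseForm5_add_eq_zero hX) t

lemma idComp_stabH3_basePoint : idComp (stabH3 basePoint) =
    expGroup SpecialLinearGroup.coeMonoidHom (soIn5 : Set (Matrix (Fin 5) (Fin 5) ℝ)) := by
  refine idComp_eq_expGroup SpecialLinearGroup.isClosedEmbedding_val soIn5_subset_lieSet ?_
  refine (lieSet_mono ((stabH3 basePoint).topologicalClosure_minimal le_rfl
    isClosed_stabH3_basePoint)).trans ?_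
  -- Any algebra beyond V(2) + V(6) is all of sl(5), so one direction in V(4) that is not skew for
  -- the form is enough.
  have hn : comp5V4 (Pi.single 0 1) ∉ lieSet SpecialLinearGroup.coeMonoidHom
      (stabH3 basePoint) := by
    intro h
    have h1 := transpose_mul_add_mul_eq_zero (X := comp5V4 (Pi.single 0 1)) (M := baseForm5)
      fun t => by
        obtain ⟨g, hg, e⟩ := h t
        have e1 : g.1 = exp (t • comp5V4 (Pi.single 0 1)) := e
        have := mem_stabH3_basePoint.1 hg
        rw [e1] at this
        exact this
    have h2 := congrFun (congrFun h1 3) 3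
    simp [baseForm5, comp5V4_apply, Matrix.mul_apply, Fin.sum_univ_five] at h2
    norm_num at h2
  have h5 : (sl2In5 : Set (Matrix (Fin 5) (Fin 5) ℝ)) ⊆ soIn5 := sl2In5_le_soIn5
  rcases lieSet_five_cases isClosed_stabH3_basePoint (h5.trans soIn5_subset_lieSet) with h | h | h
  · exact h.subset.trans h5
  · exact h.subset
  · exact absurd (h ▸ trace_comp5V4 _) hn

end BasePointLie

/-! ### Closed connected overgroups at the base point -/

section Overgroups

open NormedSpace Filter Topology

attribute [local instance] Matrix.linftyOpNormedRing Matrix.linftyOpNormedAlgebra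

lemma idComp_le {A : Type*} [Group A] [TopologicalSpace A] [IsTopologicalGroup A]
    (K : Subgroup A) : idComp K ≤ K := by
  rintro _ ⟨g, -, rfl⟩
  exact g.2

lemma sl2Diag_subset_lieSet_of_le {F : Subgroup HReal} (hF : idComp (stabH basePoint) ≤ F) :
    (sl2Diag : Set MatPair) ⊆ lieSet pairHom F := by
  intro X hX t
  obtain ⟨g, -, e⟩ := sl2Diag_subset_lieSet hX t
  refine ⟨g, hF ?_, e⟩
  rw [idComp_stabH_basePoint]
  exact mem_expGroup (sl2Diag.smul_mem t hX) e

/-- The closed connected overgroups of the identity component of the stabilizer of the base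
point. -/
lemma eq_of_idComp_stabH_basePoint_le {F : Subgroup HReal} (hcl : IsClosed (F : Set HReal))
    (hconn : IsConnected (F : Set HReal)) (hF : idComp (stabH basePoint) ≤ F) :
    F = idComp (stabH basePoint) ∨
    F = (idComp (stabH1 basePoint)).prod (idComp (stabH2 basePoint)) ∨
    F = (idComp (stabH1 basePoint)).prod ⊤ ∨
    F = (idComp (stabH3 basePoint)).prod (idComp (stabH2 basePoint)) ∨
    F = (idComp (stabH3 basePoint)).prod ⊤ ∨
    F = (⊤ : Subgroup (SpecialLinearGroup (Fin 5) ℝ)).prod (idComp (stabH2 basePoint)) ∨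
    F = (⊤ : Subgroup (SpecialLinearGroup (Fin 5) ℝ)).prod ⊤ := by
  obtain ⟨N, hN, hbr⟩ := exists_submodule_eq_lieSet_pair hcl
  have h1 := sl2Diag_subset_lieSet_of_le hF
  have h2 := lieSet_pairHom_subset F
  have h3 := eq_expGroup_of_isConnected isClosedEmbedding_pairHom hcl hconn
  rw [← hN] at h1 h2 h3
  rw [idComp_stabH_basePoint, idComp_stabH1_basePoint, idComp_stabH2_basePoint,
    idComp_stabH3_basePoint, ← expGroup_slAlg 5, ← expGroup_slAlg 3]
  simp only [← expGroup_prod]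
  rcases eq_of_commutator_mem h1 h2 hbr with h | h | h | h | h | h | h <;> rw [h] at h3
  · exact Or.inl h3
  · exact Or.inr (Or.inl h3)
  · exact Or.inr (Or.inr (Or.inl h3))
  · exact Or.inr (Or.inr (Or.inr (Or.inl h3)))
  · exact Or.inr (Or.inr (Or.inr (Or.inr (Or.inl h3))))
  · exact Or.inr (Or.inr (Or.inr (Or.inr (Or.inr (Or.inl h3)))))
  · exact Or.inr (Or.inr (Or.inr (Or.inr (Or.inr (Or.inr h3)))))

/-- The restriction to a negative definite plane of the form `baseForm5` composed with `g`. -/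
def planeDet (g : Matrix (Fin 5) (Fin 5) ℝ) : ℝ :=
  (![1, 0, 0, 0, -1] ⬝ᵥ baseForm5 *ᵥ (g *ᵥ ![1, 0, 0, 0, -1])) *
    (![0, 1, 0, 1, 0] ⬝ᵥ baseForm5 *ᵥ (g *ᵥ ![0, 1, 0, 1, 0])) -
  (![1, 0, 0, 0, -1] ⬝ᵥ baseForm5 *ᵥ (g *ᵥ ![0, 1, 0, 1, 0])) *
    (![0, 1, 0, 1, 0] ⬝ᵥ baseForm5 *ᵥ (g *ᵥ ![1, 0, 0, 0, -1]))

lemma continuous_planeDet : Continuous planeDet := by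
  unfold planeDet
  fun_prop

lemma dotProduct_baseForm5_mulVec (u v : Fin 5 → ℝ) : u ⬝ᵥ baseForm5 *ᵥ v =
    36 * (u 0 * v 4 + u 4 * v 0) - 9 * (u 1 * v 3 + u 3 * v 1) + 6 * (u 2 * v 2) := by
  rw [baseForm5]
  simp [dotProduct, Matrix.mulVec, Fin.sum_univ_five]
  ring

lemma dotProduct_baseForm5_mulVec_mulVec {g : SpecialLinearGroup (Fin 5) ℝ}
    (hg : g ∈ stabH3 basePoint) (a : Fin 5 → ℝ) :
    (g.1 *ᵥ a) ⬝ᵥ baseForm5 *ᵥ (g.1 *ᵥ a) = a ⬝ᵥ baseForm5 *ᵥ a := by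
  rw [← Phi2_basePoint, ← Phi2_basePoint]
  exact hg a

/-- If the determinant vanished, g would send some nonzero vector of the negative definite plane to
a vector orthogonal to that plane. The form has signature (3, 2), so the orthogonal complement is
positive definite, whereas g preserves the negative value. -/
lemma planeDet_ne_zero {g : SpecialLinearGroup (Fin 5) ℝ} (hg : g ∈ stabH3 basePoint) :
    planeDet g.1 ≠ 0 := by
  intro h
  set u : Fin 5 → ℝ := ![1, 0, 0, 0, -1] with hu
  set v : Fin 5 → ℝ := ![0, 1, 0, 1, 0] with hv
  set p := u ⬝ᵥ baseForm5 *ᵥ (g.1 *ᵥ u) with hp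
  set q := u ⬝ᵥ baseForm5 *ᵥ (g.1 *ᵥ v) with hq
  set r := v ⬝ᵥ baseForm5 *ᵥ (g.1 *ᵥ u) with hr
  set s := v ⬝ᵥ baseForm5 *ᵥ (g.1 *ᵥ v) with hs
  have h : p * s - q * r = 0 := h
  -- A kernel vector of the singular 2 × 2 matrix with rows (p, q) and (r, s), read off from a
  -- nonzero row.
  obtain ⟨a, b, hab, h1, h2⟩ : ∃ a b : ℝ, (a ≠ 0 ∨ b ≠ 0) ∧ a * p + b * q = 0 ∧
      a * r + b * s = 0 := by
    by_cases h0 : q = 0 ∧ p = 0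
    · by_cases h0' : s = 0 ∧ r = 0
      · exact ⟨1, 0, Or.inl one_ne_zero, by rw [h0.1, h0.2]; ring, by rw [h0'.1, h0'.2]; ring⟩
      · refine ⟨s, -r, ?_, by rw [h0.1, h0.2]; ring, by ring⟩
        rw [neg_ne_zero]
        tauto
    · refine ⟨q, -p, ?_, by ring, by linear_combination -h⟩
      rw [neg_ne_zero]
      tauto
  set y := g.1 *ᵥ (a • u + b • v) with hy
  have hy1 : y = a • (g.1 *ᵥ u) + b • (g.1 *ᵥ v) := by
    rw [hy, Matrix.mulVec_add, Matrix.mulVec_smul, Matrix.mulVec_smul]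
  have h3 : u ⬝ᵥ baseForm5 *ᵥ y = 0 := by
    rw [hy1, Matrix.mulVec_add, Matrix.mulVec_smul, Matrix.mulVec_smul, dotProduct_add,
      dotProduct_smul, dotProduct_smul]
    exact h1
  have h4 : v ⬝ᵥ baseForm5 *ᵥ y = 0 := by
    rw [hy1, Matrix.mulVec_add, Matrix.mulVec_smul, Matrix.mulVec_smul, dotProduct_add,
      dotProduct_smul, dotProduct_smul]
    exact h2
  have h5 := dotProduct_baseForm5_mulVec_mulVec hg (a • u + b • v)
  rw [← hy] at h5
  rw [dotProduct_baseForm5_mulVec] at h3 h4 h5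
  rw [dotProduct_baseForm5_mulVec] at h5
  simp [hu, hv] at h3 h4 h5
  have h6 : y 4 = y 0 := by linarith
  have h7 : y 3 = -y 1 := by linarith
  rw [h6, h7] at h5
  have h8 : 0 < a ^ 2 + b ^ 2 := by
    rcases hab with h | h
    · have := sq_pos_of_ne_zero h
      positivity
    · have := sq_pos_of_ne_zero h
      positivity
  nlinarith [sq_nonneg (y 0), sq_nonneg (y 1), sq_nonneg (y 2), sq_nonneg a, sq_nonneg b]

/-- The sign changes that fix the base point. -/
def signElement : HReal :=
  (⟨Matrix.diagonal ![1, -1, 1, -1, 1], by simp [Matrix.det_diagonal, Fin.prod_univ_five]⟩,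
    ⟨Matrix.diagonal ![-1, 1, -1], by simp [Matrix.det_diagonal, Fin.prod_univ_three]⟩)

lemma signElement_mem : signElement ∈ stabH basePoint := by
  rw [mem_stabH]
  apply Subtype.ext
  funext k
  rw [inclHG_smul_apply]
  ext i j
  simp only [signElement, Matrix.diagonal_transpose, Matrix.sum_apply, Matrix.smul_apply,
    Matrix.mul_diagonal, Matrix.diagonal_mul, Fin.sum_univ_three]
  fin_cases k <;> fin_cases i <;> fin_cases j <;>
    simp [basePoint_zero, basePoint_one, basePoint_two]

/-- `planeDet` is continuous and never zero on SO(`Phi2`), so its sign is constant on the identity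
component. It is positive at 1, while the sign matrix fixes one basis vector of the plane and
negates the other. -/
lemma signElement_fst_notMem : signElement.1 ∉ idComp (stabH3 basePoint) := by
  rintro ⟨g, hg, e⟩
  have hconn : IsPreconnected (connectedComponent (1 : stabH3 basePoint)) :=
    isPreconnected_connectedComponent
  have hcont : Continuous fun g : stabH3 basePoint => planeDet g.1.1 :=
    continuous_planeDet.comp (continuous_subtype_val.comp continuous_subtype_val)
  have h1 : 0 < planeDet (1 : stabH3 basePoint).1.1 := by
    change 0 < planeDet (1 : Matrix (Fin 5) (Fin 5) ℝ)
    simp only [planeDet, dotProduct_baseForm5_mulVec, Matrix.one_mulVec]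
    simp
    norm_num
  have h2 : planeDet g.1.1 < 0 := by
    have : g.1.1 = Matrix.diagonal ![1, -1, 1, -1, 1] := congrArg Subtype.val e
    rw [this]
    simp only [planeDet, dotProduct_baseForm5_mulVec, Matrix.mulVec_diagonal]
    simp
    norm_num
  obtain ⟨z, -, hz⟩ := hconn.intermediate_value hg mem_connectedComponent hcont.continuousOn
    ⟨h2.le, h1.le⟩
  exact planeDet_ne_zero z.2 hz

lemma le_left_of_stabH_le {x : altTensor} {K : Subgroup (SpecialLinearGroup (Fin 5) ℝ)}
    {K' : Subgroup (SpecialLinearGroup (Fin 3) ℝ)} (h : stabH x ≤ K.prod K') : stabH1 x ≤ K := by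
  rintro _ ⟨g, hg, rfl⟩
  exact (h hg).1

lemma le_right_of_stabH_le {x : altTensor} {K : Subgroup (SpecialLinearGroup (Fin 5) ℝ)}
    {K' : Subgroup (SpecialLinearGroup (Fin 3) ℝ)} (h : stabH x ≤ K.prod K') : stabH2 x ≤ K' := by
  rintro _ ⟨g, hg, rfl⟩
  exact (h hg).2

/-- The closed connected overgroups of the stabilizer of the base point. -/
lemma eq_of_stabH_basePoint_le {F : Subgroup HReal} (hcl : IsClosed (F : Set HReal))
    (hconn : IsConnected (F : Set HReal)) (hF : stabH basePoint ≤ F) :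
    F = stabH basePoint ∨
    F = (stabH1 basePoint).prod (stabH2 basePoint) ∨
    F = (stabH1 basePoint).prod ⊤ ∨
    F = (stabH3 basePoint).prod (stabH2 basePoint) ∨
    F = (stabH3 basePoint).prod ⊤ ∨
    F = (⊤ : Subgroup (SpecialLinearGroup (Fin 5) ℝ)).prod (stabH2 basePoint) ∨
    F = (⊤ : Subgroup (SpecialLinearGroup (Fin 5) ℝ)).prod ⊤ := by
  -- This removes the two groups whose first factor is the identity component of SO(`Phi2`). In the
  -- other cases each identity component lies between itself and the group it comes from.
  have hs : ∀ K', ¬ stabH basePoint ≤ (idComp (stabH3 basePoint)).prod K' := fun K' h =>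
    signElement_fst_notMem (h signElement_mem).1
  rcases eq_of_idComp_stabH_basePoint_le hcl hconn ((idComp_le _).trans hF) with
    h | h | h | h | h | h | h
  · exact Or.inl (le_antisymm (h.le.trans (idComp_le _)) hF)
  · rw [h] at hF
    rw [le_antisymm (idComp_le _) (le_left_of_stabH_le hF),
      le_antisymm (idComp_le _) (le_right_of_stabH_le hF)] at h
    exact Or.inr (Or.inl h)
  · rw [h] at hF
    rw [le_antisymm (idComp_le _) (le_left_of_stabH_le hF)] at h
    exact Or.inr (Or.inr (Or.inl h))
  · exact absurd (h ▸ hF) (hs _)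
  · exact absurd (h ▸ hF) (hs _)
  · rw [h] at hF
    rw [le_antisymm (idComp_le _) (le_right_of_stabH_le hF)] at h
    exact Or.inr (Or.inr (Or.inr (Or.inr (Or.inr (Or.inl h)))))
  · exact Or.inr (Or.inr (Or.inr (Or.inr (Or.inr (Or.inr h)))))

end Overgroups

/-! ### Conjugation to an arbitrary point of the orbit -/

section Transport

lemma coe_idComp {A : Type*} [Group A] [TopologicalSpace A] [IsTopologicalGroup A]
    (K : Subgroup A) : (idComp K : Set A) = connectedComponentIn (K : Set A) 1 := by
  rw [connectedComponentIn_eq_image (F := (K : Set A)) K.one_mem]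
  rfl

lemma idComp_map {A : Type*} [Group A] [TopologicalSpace A] [IsTopologicalGroup A]
    (e : A ≃ₜ* A) (K : Subgroup A) :
    idComp (K.map (e : A →* A)) = (idComp K).map (e : A →* A) := by
  apply SetLike.coe_injective
  rw [coe_idComp, Subgroup.coe_map, Subgroup.coe_map, coe_idComp]
  have := e.toHomeomorph.image_connectedComponentIn (s := (K : Set A)) (x := 1) K.one_mem
  refine Eq.trans ?_ this.symm
  congr 1
  exact (map_one e).symm

/-- Conjugation by an element of `GL n` on `SL n`. -/
def conjSL {n : ℕ} (g : GL (Fin n) ℝ) :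
    SpecialLinearGroup (Fin n) ℝ ≃ₜ* SpecialLinearGroup (Fin n) ℝ where
  toFun A := ⟨g.1 * A.1 * g.2, by
    rw [Matrix.det_mul_right_comm, g.val_inv, one_mul, A.2]⟩
  invFun A := ⟨g.2 * A.1 * g.1, by
    rw [Matrix.det_mul_right_comm, g.inv_val, one_mul, A.2]⟩
  left_inv A := Subtype.ext (by
    change g.2 * (g.1 * A.1 * g.2) * g.1 = A.1
    rw [← Matrix.mul_assoc, ← Matrix.mul_assoc, g.inv_val, Matrix.one_mul, Matrix.mul_assoc,
      g.inv_val, Matrix.mul_one])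
  right_inv A := Subtype.ext (by
    change g.1 * (g.2 * A.1 * g.1) * g.2 = A.1
    rw [← Matrix.mul_assoc, ← Matrix.mul_assoc, g.val_inv, Matrix.one_mul, Matrix.mul_assoc,
      g.val_inv, Matrix.mul_one])
  map_mul' A B := Subtype.ext (by
    change g.1 * (A.1 * B.1) * g.2 = (g.1 * A.1 * g.2) * (g.1 * B.1 * g.2)
    simp only [Matrix.mul_assoc]
    rw [← Matrix.mul_assoc g.2 g.1, g.inv_val, Matrix.one_mul])
  continuous_toFun := by
    refine Continuous.subtype_mk ?_ _
    exact (continuous_const.matrix_mul continuous_subtype_val).matrix_mul continuous_const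
  continuous_invFun := by
    refine Continuous.subtype_mk ?_ _
    exact (continuous_const.matrix_mul continuous_subtype_val).matrix_mul continuous_const

/-- Conjugation by an element of `GL(5) × GL(3)` on `SL(5) × SL(3)`. -/
def conjH (g : GReal) : HReal ≃ₜ* HReal where
  toMulEquiv := (conjSL g.1).toMulEquiv.prodCongr (conjSL g.2).toMulEquiv
  continuous_toFun := (conjSL g.1).continuous_toFun.prodMap (conjSL g.2).continuous_toFun
  continuous_invFun := (conjSL g.1).continuous_invFun.prodMap (conjSL g.2).continuous_invFun

lemma toGL_conjSL {n : ℕ} (g : GL (Fin n) ℝ) (A : SpecialLinearGroup (Fin n) ℝ) :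
    SpecialLinearGroup.toGL (conjSL g A) = g * SpecialLinearGroup.toGL A * g⁻¹ :=
  Units.ext rfl

lemma inclHG_conjH (g : GReal) (h : HReal) : inclHG (conjH g h) = g * inclHG h * g⁻¹ :=
  Prod.ext (toGL_conjSL g.1 h.1) (toGL_conjSL g.2 h.2)

lemma map_prod_conjH (g : GReal) (K : Subgroup (SpecialLinearGroup (Fin 5) ℝ))
    (K' : Subgroup (SpecialLinearGroup (Fin 3) ℝ)) :
    (K.prod K').map (conjH g : HReal →* HReal) =
      (K.map (conjSL g.1 :
      SpecialLinearGroup (Fin 5) ℝ →* SpecialLinearGroup (Fin 5) ℝ)).prod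
        (K'.map (conjSL g.2 :
      SpecialLinearGroup (Fin 3) ℝ →* SpecialLinearGroup (Fin 3) ℝ)) := by
  apply SetLike.coe_injective
  simp only [Subgroup.coe_map, Subgroup.coe_prod]
  exact Set.prodMap_image_prod (conjSL g.1) (conjSL g.2) _ _

lemma stabH_smul (g : GReal) (x : altTensor) :
    stabH (g • x) = (stabH x).map (conjH g : HReal →* HReal) := by
  ext h
  obtain ⟨h, rfl⟩ := (conjH g).surjective h
  have : conjH g h ∈ (stabH x).map (conjH g : HReal →* HReal) ↔ h ∈ stabH x :=
    Subgroup.mem_map_iff_mem (f := (conjH g : HReal →* HReal)) (conjH g).injective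
  rw [this, mem_stabH, mem_stabH, inclHG_conjH, smul_smul, inv_mul_cancel_right, mul_smul,
    smul_left_cancel_iff]

lemma stabH1_smul (g : GReal) (x : altTensor) :
    stabH1 (g • x) = (stabH1 x).map (conjSL g.1 :
      SpecialLinearGroup (Fin 5) ℝ →* SpecialLinearGroup (Fin 5) ℝ) := by
  rw [stabH1, stabH_smul, Subgroup.map_map, stabH1, Subgroup.map_map]
  rfl

lemma stabH2_smul (g : GReal) (x : altTensor) :
    stabH2 (g • x) = (stabH2 x).map (conjSL g.2 :
      SpecialLinearGroup (Fin 3) ℝ →* SpecialLinearGroup (Fin 3) ℝ) := by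
  rw [stabH2, stabH_smul, Subgroup.map_map, stabH2, Subgroup.map_map]
  rfl

/-- `Phi2` of the translated point is the transported form up to a nonzero scalar, and a special
orthogonal group does not change when its form is rescaled. -/
lemma stabH3_smul (g : GReal) (x : altTensor) :
    stabH3 (g • x) = (stabH3 x).map (conjSL g.1 :
      SpecialLinearGroup (Fin 5) ℝ →* SpecialLinearGroup (Fin 5) ℝ) := by
  obtain ⟨c, hc, hQ⟩ := exists_Phi2_smul g x
  ext h
  obtain ⟨h, rfl⟩ := (conjSL g.1).surjective h
  have : conjSL g.1 h ∈ (stabH3 x).map (conjSL g.1 :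
      SpecialLinearGroup (Fin 5) ℝ →* SpecialLinearGroup (Fin 5) ℝ) ↔
      h ∈ stabH3 x := Subgroup.mem_map_iff_mem
    (f := (conjSL g.1 :
      SpecialLinearGroup (Fin 5) ℝ →* SpecialLinearGroup (Fin 5) ℝ)) (conjSL g.1).injective
  rw [this]
  have key : ∀ b, Phi2 (g • x) ((conjSL g.1 h).1 *ᵥ (g.1.1 *ᵥ b)) = c * Phi2 x (h.1 *ᵥ b) := by
    intro b
    rw [← hQ, Matrix.mulVec_mulVec, Matrix.mulVec_mulVec]
    congr 2
    change g.1.1 * h.1 * g.1.2 * g.1.1 = g.1.1 * h.1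
    rw [Matrix.mul_assoc, g.1.inv_val, Matrix.mul_one]
  constructor
  · intro H b
    have := H (g.1.1 *ᵥ b)
    rw [key, hQ] at this
    exact mul_left_cancel₀ hc this
  · intro H a
    obtain ⟨b, rfl⟩ : ∃ b, a = g.1.1 *ᵥ b := ⟨g.1.2 *ᵥ a, by
      rw [Matrix.mulVec_mulVec, g.1.val_inv, Matrix.one_mulVec]⟩
    rw [key, hQ, H b]

end Transport

theorem mainTheorem3 (x : altTensor) (hx : x ∈ MulAction.orbit GReal basePoint) :
    (∀ F : Subgroup HReal, IsClosed (F : Set HReal) → IsConnected (F : Set HReal) →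
      idComp (stabH x) ≤ F →
        F = idComp (stabH x) ∨
        F = (idComp (stabH1 x)).prod (idComp (stabH2 x)) ∨
        F = (idComp (stabH1 x)).prod ⊤ ∨
        F = (idComp (stabH3 x)).prod (idComp (stabH2 x)) ∨
        F = (idComp (stabH3 x)).prod ⊤ ∨
        F = (⊤ : Subgroup (Matrix.SpecialLinearGroup (Fin 5) ℝ)).prod (idComp (stabH2 x)) ∨
        F = (⊤ : Subgroup (Matrix.SpecialLinearGroup (Fin 5) ℝ)).prod ⊤) ∧
    (∀ F : Subgroup HReal, IsClosed (F : Set HReal) → IsConnected (F : Set HReal) →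
      stabH x ≤ F →
        F = stabH x ∨
        F = (stabH1 x).prod (stabH2 x) ∨
        F = (stabH1 x).prod ⊤ ∨
        F = (stabH3 x).prod (stabH2 x) ∨
        F = (stabH3 x).prod ⊤ ∨
        F = (⊤ : Subgroup (Matrix.SpecialLinearGroup (Fin 5) ℝ)).prod (stabH2 x) ∨
        F = (⊤ : Subgroup (Matrix.SpecialLinearGroup (Fin 5) ℝ)).prod ⊤) := by
  obtain ⟨g, rfl⟩ := hx
  change (∀ F : Subgroup HReal, _ → _ → idComp (stabH (g • basePoint)) ≤ F → _) ∧
    (∀ F : Subgroup HReal, _ → _ → stabH (g • basePoint) ≤ F → _)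
  -- The full factors are also written as conjugates of themselves, so that every group on both
  -- lists becomes the image under `conjH g` of its counterpart at `w`.
  have h5 : (⊤ : Subgroup (SpecialLinearGroup (Fin 5) ℝ)) =
      (⊤ : Subgroup _).map (conjSL g.1 :
      SpecialLinearGroup (Fin 5) ℝ →* SpecialLinearGroup (Fin 5) ℝ) :=
    (Subgroup.map_top_of_surjective (conjSL g.1 :
      SpecialLinearGroup (Fin 5) ℝ →* SpecialLinearGroup (Fin 5) ℝ)
      (conjSL g.1).surjective).symm
  have h3 : (⊤ : Subgroup (SpecialLinearGroup (Fin 3) ℝ)) =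
      (⊤ : Subgroup _).map (conjSL g.2 :
      SpecialLinearGroup (Fin 3) ℝ →* SpecialLinearGroup (Fin 3) ℝ) :=
    (Subgroup.map_top_of_surjective (conjSL g.2 :
      SpecialLinearGroup (Fin 3) ℝ →* SpecialLinearGroup (Fin 3) ℝ)
      (conjSL g.2).surjective).symm
  have hinj := Subgroup.map_injective (f := (conjH g : HReal →* HReal)) (conjH g).injective
  have hF : ∀ F : Subgroup HReal, IsClosed (F : Set HReal) → IsConnected (F : Set HReal) →
      ∃ F' : Subgroup HReal, IsClosed (F' : Set HReal) ∧ IsConnected (F' : Set HReal) ∧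
        F = F'.map (conjH g : HReal →* HReal) := by
    intro F hcl hconn
    refine ⟨F.comap (conjH g : HReal →* HReal), hcl.preimage (conjH g).continuous_toFun,
      (conjH g).toHomeomorph.isConnected_preimage.2 hconn,
      (Subgroup.map_comap_eq_self_of_surjective (conjH g).surjective F).symm⟩
  rw [h5, h3]
  simp only [stabH_smul, stabH1_smul, stabH2_smul, stabH3_smul, idComp_map, ← map_prod_conjH]
  constructor
  · intro F hcl hconn hle
    obtain ⟨F', hcl', hconn', rfl⟩ := hF F hcl hconn
    simp only [hinj.eq_iff]
    exact eq_of_idComp_stabH_basePoint_le hcl' hconn'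
      ((Subgroup.map_le_map_iff_of_injective (conjH g).injective).1 hle)
  · intro F hcl hconn hle
    obtain ⟨F', hcl', hconn', rfl⟩ := hF F hcl hconn
    simp only [hinj.eq_iff]
    exact eq_of_stabH_basePoint_le hcl' hconn'
      ((Subgroup.map_le_map_iff_of_injective (conjH g).injective).1 hle)
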